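/- **Setting.** Let $n\in\mathbb N$; $\mathbb R^n$ carries the uniform norm and all cubes are closed with sides parallel to the axes. For a cube $Q$, $l(Q)$ is its side length and $cQ$ its dilation about its centre. For $k\in\mathbb Z$, $m\in\mathbb Z^n$ put $Q_{k,m}=\prod_{i=1}^n[2^{-k}m_i,2^{-k}(m_i+1)]$ (dyadic cubes); $\mathcal D_+$ is the set of those with $k\ge 0$. For $\delta>0$ let $\mathcal H^{\delta}_\infty(E)$ be the infimum of $\sum_\alpha l(Q_\alpha)^{\delta}$ over all coverings $\{Q_\alpha\}$ of $E$ by dyadic cubes with pairwise disjoint interiors. Fix $0<d\le d^*\le n$, a compact set $S\subset Q_{0,0}$ with $\mathcal H^{d^*}_\infty(S)>0$, and $\lambda\in(0,\mathcal H^{d^*}_\infty(S))$. Let $\mathcal{DF}$ be the set of all $Q\in\mathcal D_+$ with $\mathcal H^d_\infty(Q\cap S)\ge\lambda\, l(Q)^d$; let $\mathcal A_k=\{m: Q_{k,m}\in\mathcal{DF}\}$ and $\widetilde{\mathcal A}_k=\{m: Q_{k,m}\cap Q_{k,m'}\neq\emptyset \text{ for some } m'\in\mathcal A_k\}$. Let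 $\{\mathfrak m_k\}_{k\ge0}$ be a $d$-Frostman sequence on $S$: Borel measures with (M1) $\operatorname{supp}\mathfrak m_k=S$; (M2) $\mathfrak m_k(Q)\le C_1 l(Q)^d$ for every cube $Q$ with $0<l(Q)\le2^{-k}$; (M3) $\mathfrak m_k(Q_{k,m}\cap S)\ge C_2\mathcal H^d_\infty(Q_{k,m}\cap S)$ for all $m\in\mathbb Z^n$; (M4) $\mathfrak m_k=w_k\mathfrak m_0$ with $0\le w_k\in L_\infty(\mathfrak m_0)$ and $C_3^{-1}2^{(d-n)j}w_{k+j}\le w_k\le C_3w_{k+j}$ $\mathfrak m_0$-a.e. for all $k\ge0$, $j\ge1$; here $C_1,C_2,C_3>0$ do not depend on $k$, $m$, $j$ or $Q$. The average of $g$ over $Q$ with respect to $\mathfrak m$ is $\frac1{\mathfrak m(Q)}\int_Q g\,d\mathfrak m$, understood to be $0$ if $\mathfrak m(Q)=0$ (likewise for double averages). For $Q_i\in\mathcal D_+$ of level $k_i$ ($i=1,2$) put $$\Phi_f(Q_1,Q_2)=\frac1{\min\{l(Q_1),l(Q_2)\}}\cdot\frac1{\mathfrak m_{k_1}(Q_1)\,\mathfrak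 m_{k_2}(Q_2)}\int_{Q_2}\int_{Q_1}|f(x)-f(y)|\,d\mathfrak m_{k_1}(x)\,d\mathfrak m_{k_2}(y).$$ For $c\ge1$ let $f^\natural_{\{\mathfrak m_k\},\lambda,c}(x)$ be the supremum ($0$ if there are no such pairs) of $\Phi_f(\underline Q,\overline Q)$ over all $\underline Q,\overline Q\in\mathcal{DF}$ such that $x\in c\underline Q$, $l(\underline Q)\le l(\overline Q)$, $\underline Q\subset c\overline Q$, and no $Q'\in\mathcal{DF}$ satisfies $\underline Q\subset Q'$ and $l(\underline Q)<l(Q')<l(\overline Q)$. Put $$\widetilde{\mathcal N}_{p,\{\mathfrak m_k\},\lambda,c}(f)=\|f\|_{L_p(\mathfrak m_0)}+\|f^\natural_{\{\mathfrak m_k\},\lambda,c}\|_{L_p(\mathbb R^n)}.$$ Fix $\widetilde\psi_0\in C_0^\infty(\mathbb R)$ with $\chi_{[1/10,9/10]}\le\widetilde\psi_0\le\chi_{[-1/10,11/10]}$, $\widetilde\psi_0>0$ on $(-\tfrac1{10},\tfrac{11}{10})$ and $\sum_{m\in\mathbb Z}\widetilde\psi_0(\cdot-m)\equiv1$, and put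 $\psi_{k,m}(x)=\prod_{i=1}^n\widetilde\psi_0(2^kx_i-m_i)$. Let $f_{k,m}$ be the arithmetic mean of the averages $\frac1{\mathfrak m_k(Q_{k,m'})}\int_{Q_{k,m'}}f\,d\mathfrak m_k$ over all $m'\in\mathcal A_k$ with $Q_{k,m'}\subset3Q_{k,m}$ ($f_{k,m}=0$ if there are none). The special approximating sequence of $f$ is $$f_0=\sum_{Q_{0,m}\subset3Q_{0,0}}\psi_{0,m}f_{0,0},\qquad f_k=f_{k-1}+\sum_{m\in\widetilde{\mathcal A}_k}\psi_{k,m}\,(f_{k,m}-f_{k-1})\quad(k\ge1),$$ and $\operatorname{Ext}(f)(x)=f(x)$ for $x\in S$, $\operatorname{Ext}(f)(x)=\lim_{k\to\infty}f_k(x)$ for $x\in\mathbb R^n\setminus S$. **Theorem 6.5 (reverse trace theorem).** Let $p\in(1,\infty)$ and $c\ge7$. There is a constant $C>0$, depending only on $p,d,n,\lambda,c$, on $C_1,C_2,C_3$ and on the fixed function $\widetilde\psi_0$, such that the following holds for every Borel function $f:S\to[-\infty,+\infty]$ with $\widetilde{\mathcal N}_{p,\{\mathfrak m_k\},\lambda,c}(f)<\infty$.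 The $\mathcal L^n$-equivalence class of $\operatorname{Ext}(f)$ belongs to $W^1_p(\mathbb R^n)$, normed by $\|F\|_{L_p}+\sum_{i=1}^n\|D_iF\|_{L_p}$; there is a subsequence $\{f_{k_l}\}$ of the special approximating sequence whose members belong to $W^1_p(\mathbb R^n)$ and which converges weakly in $W^1_p(\mathbb R^n)$ to $\operatorname{Ext}(f)$; and $$\|\operatorname{Ext}(f)\|_{W^1_p(\mathbb R^n)}\le C\,\widetilde{\mathcal N}_{p,\{\mathfrak m_k\},\lambda,c}(f).$$ -/

import Mathlib

open MeasureTheory Filter Topology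
open scoped ENNReal NNReal ContDiff

namespace SobolevExt

noncomputable section

/-! ### Cubes

`ℝⁿ` is `Fin n → ℝ`, which carries the uniform norm. Cubes are closed with sides parallel to
the coordinate axes. -/

/-- The closed cube with centre `x` and side length `l`. -/
def cube {n : ℕ} (x : Fin n → ℝ) (l : ℝ) : Set (Fin n → ℝ) :=
  {y | ∀ i, x i - l / 2 ≤ y i ∧ y i ≤ x i + l / 2}

/-- The side length `2⁻ᵏ` of the dyadic cubes of level `k`. -/
def side (k : ℤ) : ℝ := (2 : ℝ) ^ (-k)

/-- The closed dyadic cube `Q_{k,m} = ∏ᵢ [mᵢ / 2ᵏ, (mᵢ + 1) / 2ᵏ]`. -/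
def dyadicCube {n : ℕ} (k : ℤ) (m : Fin n → ℤ) : Set (Fin n → ℝ) :=
  {y | ∀ i, (m i : ℝ) * side k ≤ y i ∧ y i ≤ ((m i : ℝ) + 1) * side k}

/-- The dilation `c Q_{k,m}` of the dyadic cube `Q_{k,m}` with respect to its centre. -/
def dilatedCube {n : ℕ} (c : ℝ) (k : ℤ) (m : Fin n → ℤ) : Set (Fin n → ℝ) :=
  cube (fun i => ((m i : ℝ) + 1 / 2) * side k) (c * side k)

/-! ### Dyadic Hausdorff content, thick dyadic cubes -/

/-- A family of dyadic cubes (given by their indices) is nonoverlapping if different cubes of it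
have disjoint interiors. -/
def Nonoverlapping {n : ℕ} (F : Set (ℤ × (Fin n → ℤ))) : Prop :=
  F.Pairwise fun a b => Disjoint (interior (dyadicCube a.1 a.2)) (interior (dyadicCube b.1 b.2))

/-- The dyadic `d`-Hausdorff content of `E`: the infimum of `∑ l(Q)ᵈ` over all coverings of `E`
by nonoverlapping families of dyadic cubes. -/
def content {n : ℕ} (d : ℝ) (E : Set (Fin n → ℝ)) : ℝ≥0∞ :=
  ⨅ (F : Set (ℤ × (Fin n → ℤ))) (_ : Nonoverlapping F)
    (_ : E ⊆ ⋃ a ∈ F, dyadicCube a.1 a.2), ∑' a : F, ENNReal.ofReal (side a.1.1 ^ d)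

/-- The index set of the `(d, lam)`-keystone family of `S`: the dyadic cubes `Q` of side length
at most one which are `(d, lam)`-thick, i.e. `content d (Q ∩ S) ≥ lam * l(Q)ᵈ`. -/
def keystone {n : ℕ} (S : Set (Fin n → ℝ)) (d lam : ℝ) : Set (ℕ × (Fin n → ℤ)) :=
  {a | ENNReal.ofReal (lam * side a.1 ^ d) ≤ content d (dyadicCube a.1 a.2 ∩ S)}

/-- `𝒜_k`: indices of the keystone cubes of level `k`. -/
def level {n : ℕ} (S : Set (Fin n → ℝ)) (d lam : ℝ) (k : ℕ) : Set (Fin n → ℤ) :=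
  {m | (k, m) ∈ keystone S d lam}

/-- `𝒜̃_k`: indices of the dyadic cubes of level `k` that touch some keystone cube of
level `k`. -/
def levelTilde {n : ℕ} (S : Set (Fin n → ℝ)) (d lam : ℝ) (k : ℕ) : Set (Fin n → ℤ) :=
  {m | ∃ m' ∈ level S d lam k, (dyadicCube k m' ∩ dyadicCube k m).Nonempty}

/-- The cube with index `b` is a `(d, lam, c)`-covering cube for the cube with index `a`. -/
structure IsCovering {n : ℕ} (S : Set (Fin n → ℝ)) (d lam c : ℝ) (a b : ℕ × (Fin n → ℤ)) :
    Prop where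
  side_le : side a.1 ≤ side b.1
  subset : dyadicCube a.1 a.2 ⊆ dilatedCube c b.1 b.2
  mem_keystone : b ∈ keystone S d lam
  not_mem_keystone : ∀ q : ℕ × (Fin n → ℤ), dyadicCube a.1 a.2 ⊆ dyadicCube q.1 q.2 →
    side a.1 < side q.1 → side q.1 < side b.1 → q ∉ keystone S d lam

/-! ### Frostman-type sequences of measures -/

/-- The sequence `μ` of measures is `d`-Frostman on `S`, with constants `C₁, C₂, C₃`. -/
structure IsFrostman {n : ℕ} (S : Set (Fin n → ℝ)) (d C₁ C₂ C₃ : ℝ)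
    (μ : ℕ → Measure (Fin n → ℝ)) : Prop where
  support_eq : ∀ k, (μ k).support = S
  upper : ∀ (k : ℕ) (x : Fin n → ℝ) (l : ℝ), 0 < l → l ≤ side k →
    μ k (cube x l) ≤ ENNReal.ofReal (C₁ * l ^ d)
  lower : ∀ (k : ℕ) (m : Fin n → ℤ),
    ENNReal.ofReal C₂ * content d (dyadicCube k m ∩ S) ≤ μ k (dyadicCube k m ∩ S)
  weights : ∃ w : ℕ → (Fin n → ℝ) → ℝ≥0,
    (∀ k, Measurable (w k)) ∧
    (∀ k, ∃ B : ℝ≥0, ∀ᵐ x ∂(μ 0), w k x ≤ B) ∧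
    (∀ k, μ k = (μ 0).withDensity fun x => (w k x : ℝ≥0∞)) ∧
    ∀ k j : ℕ, 1 ≤ j → ∀ᵐ x ∂(μ 0),
      1 / C₃ * (2 : ℝ) ^ ((d - n) * j) * (w (k + j) x : ℝ) ≤ (w k x : ℝ) ∧
      (w k x : ℝ) ≤ C₃ * (w (k + j) x : ℝ)

/-! ### Functions on `S` -/

open Classical in
/-- Real-valued version of `f : S → [-∞, ∞]`, extended by zero off `S`. It is used only in
integrals with respect to measures carried by `S` for which `f` is integrable, hence almost
everywhere finite. -/
def realPart {n : ℕ} {S : Set (Fin n → ℝ)} (f : S → EReal) (x : Fin n → ℝ) : ℝ :=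
  if h : x ∈ S then (f ⟨x, h⟩).toReal else 0

open Classical in
/-- The absolute value of `f : S → [-∞, ∞]`, extended by zero off `S`. -/
def absVal {n : ℕ} {S : Set (Fin n → ℝ)} (f : S → EReal) (x : Fin n → ℝ) : ℝ≥0∞ :=
  if h : x ∈ S then (f ⟨x, h⟩).abs else 0

/-- The normalized double average `Φ(Q₁, Q₂)` of `|f(x) - f(y)|`; each cube is equipped with the
measure of its own level. Averages over null sets are zero. -/
def phi {n : ℕ} {S : Set (Fin n → ℝ)} (μ : ℕ → Measure (Fin n → ℝ)) (f : S → EReal)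
    (a b : ℕ × (Fin n → ℤ)) : ℝ≥0∞ :=
  ENNReal.ofReal (1 / min (side a.1) (side b.1)) *
    ⨍⁻ y in dyadicCube b.1 b.2, ⨍⁻ x in dyadicCube a.1 a.2,
      ‖realPart f x - realPart f y‖ₑ ∂(μ a.1) ∂(μ b.1)

/-- The dyadic generalized Calderón-type maximal function (the supremum of the empty set
is `0`). -/
def calderonMax {n : ℕ} {S : Set (Fin n → ℝ)} (μ : ℕ → Measure (Fin n → ℝ)) (d lam c : ℝ)
    (f : S → EReal) (x : Fin n → ℝ) : ℝ≥0∞ :=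
  ⨆ (a : ℕ × (Fin n → ℤ)) (b : ℕ × (Fin n → ℤ)) (_ : x ∈ dilatedCube c a.1 a.2)
    (_ : a ∈ keystone S d lam) (_ : b ∈ keystone S d lam) (_ : IsCovering S d lam c a b),
    phi μ f a b

/-- `‖f‖_{L_p(𝔪₀)} + ‖f^♮‖_{L_p(ℝⁿ)}`. -/
def traceNorm {n : ℕ} {S : Set (Fin n → ℝ)} (μ : ℕ → Measure (Fin n → ℝ)) (d lam c : ℝ)
    (p : ℝ≥0∞) (f : S → EReal) : ℝ≥0∞ :=
  eLpNorm (absVal f) p (μ 0) + eLpNorm (calderonMax μ d lam c f) p volume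

/-! ### The approximating sequence and the extension operator -/

/-- The one-dimensional profile generating the partitions of unity. -/
structure IsProfile (ψ : ℝ → ℝ) : Prop where
  smooth : ContDiff ℝ ∞ ψ
  lower : ∀ t, (Set.Icc (1 / 10 : ℝ) (9 / 10)).indicator (fun _ => (1 : ℝ)) t ≤ ψ t
  upper : ∀ t, ψ t ≤ (Set.Icc (-1 / 10 : ℝ) (11 / 10)).indicator (fun _ => (1 : ℝ)) t
  pos : ∀ t ∈ Set.Ioo (-1 / 10 : ℝ) (11 / 10), 0 < ψ t
  sum_eq_one : ∀ t, HasSum (fun m : ℤ => ψ (t - m)) 1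

/-- `ψ_{k,m}`, a smooth bump adapted to the dyadic cube `Q_{k,m}`. -/
def bump {n : ℕ} (ψ : ℝ → ℝ) (k : ℕ) (m : Fin n → ℤ) (x : Fin n → ℝ) : ℝ :=
  ∏ i, ψ ((2 : ℝ) ^ k * x i - m i)

/-- Indices `m'` of keystone cubes of level `k` contained in `3 Q_{k,m}`. -/
def keystoneNeighbors {n : ℕ} (S : Set (Fin n → ℝ)) (d lam : ℝ) (k : ℕ) (m : Fin n → ℤ) :
    Set (Fin n → ℤ) :=
  {m' | dyadicCube k m' ⊆ dilatedCube 3 k m ∧ m' ∈ level S d lam k}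

open Classical in
/-- The coefficient `f_{k,m}`: the arithmetic mean, over the keystone neighbours of `Q_{k,m}`, of
the averages of `f` with respect to `𝔪_k`; zero if there are no such neighbours. -/
def coeff {n : ℕ} {S : Set (Fin n → ℝ)} (μ : ℕ → Measure (Fin n → ℝ)) (d lam : ℝ)
    (f : S → EReal) (k : ℕ) (m : Fin n → ℤ) : ℝ :=
  if (keystoneNeighbors S d lam k m).ncard ≠ 0 then
    1 / ((keystoneNeighbors S d lam k m).ncard : ℝ) *
      ∑ᶠ m' ∈ keystoneNeighbors S d lam k m, ⨍ x in dyadicCube k m', realPart f x ∂(μ k)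
  else 0

/-- The special approximating sequence of `f`. -/
def approxSeq {n : ℕ} {S : Set (Fin n → ℝ)} (ψ : ℝ → ℝ) (μ : ℕ → Measure (Fin n → ℝ))
    (d lam : ℝ) (f : S → EReal) : ℕ → (Fin n → ℝ) → ℝ
  | 0 => fun x =>
      ∑ᶠ m ∈ {m : Fin n → ℤ | dyadicCube 0 m ⊆ dilatedCube 3 0 (0 : Fin n → ℤ)},
        bump ψ 0 m x * coeff μ d lam f 0 0
  | k + 1 => fun x =>
      approxSeq ψ μ d lam f k x +
        ∑ᶠ m ∈ levelTilde S d lam (k + 1),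
          bump ψ (k + 1) m x * (coeff μ d lam f (k + 1) m - approxSeq ψ μ d lam f k x)

open Classical in
/-- The extension operator: `f` itself on `S`, and the pointwise limit of the special
approximating sequence off `S`. -/
def extOp {n : ℕ} {S : Set (Fin n → ℝ)} (ψ : ℝ → ℝ) (μ : ℕ → Measure (Fin n → ℝ))
    (d lam : ℝ) (f : S → EReal) (x : Fin n → ℝ) : EReal :=
  if h : x ∈ S then f ⟨x, h⟩
  else ((limUnder atTop fun k => approxSeq ψ μ d lam f k x : ℝ) : EReal)

/-! ### The Sobolev space `W¹_p(ℝⁿ)` -/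

/-- `v` is the distributional partial derivative of `u` in the direction of the `i`-th
coordinate. -/
def IsWeakPartial {n : ℕ} (i : Fin n) (u v : (Fin n → ℝ) → ℝ) : Prop :=
  ∀ φ : (Fin n → ℝ) → ℝ, ContDiff ℝ ∞ φ → HasCompactSupport φ →
    ∫ x, u x * fderiv ℝ φ x (Pi.single i 1) = -∫ x, v x * φ x

theorem integrable_mul_test {n : ℕ} {p : ℝ≥0∞} [Fact (1 ≤ p)]
    (u : Lp ℝ p (volume : Measure (Fin n → ℝ))) {φ : (Fin n → ℝ) → ℝ} (hφ : Continuous φ)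
    (hc : HasCompactSupport φ) : Integrable fun x => u x * φ x := by
  have h := ((Lp.memLp u).locallyIntegrable Fact.out).integrable_smul_left_of_hasCompactSupport
    hφ hc
  simpa [mul_comm] using h

theorem integrable_mul_fderiv_test {n : ℕ} {p : ℝ≥0∞} [Fact (1 ≤ p)]
    (u : Lp ℝ p (volume : Measure (Fin n → ℝ))) {φ : (Fin n → ℝ) → ℝ} (hφ : ContDiff ℝ ∞ φ)
    (hc : HasCompactSupport φ) (i : Fin n) :
    Integrable fun x => u x * fderiv ℝ φ x (Pi.single i 1) := by
  refine integrable_mul_test u ((hφ.continuous_fderiv (by simp)).clm_apply continuous_const) ?_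
  exact (hc.fderiv ℝ).comp_left (g := fun L : (Fin n → ℝ) →L[ℝ] ℝ => L (Pi.single i 1)) rfl

/-- `W¹_p(ℝⁿ)`, realized as the space of all `(F, (D₁F, …, D_nF))` with `F ∈ L_p` and all weak
partial derivatives `D_iF ∈ L_p`. The `L¹`-type product norms make the norm inherited from the
ambient space equal to `‖F‖_p + ∑ᵢ ‖D_iF‖_p`. -/
def W1 (n : ℕ) (p : ℝ≥0∞) [Fact (1 ≤ p)] :
    Submodule ℝ (WithLp 1 (Lp ℝ p (volume : Measure (Fin n → ℝ)) ×
      PiLp 1 fun _ : Fin n => Lp ℝ p (volume : Measure (Fin n → ℝ)))) where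
  carrier := {U | ∀ i, IsWeakPartial i U.fst (U.snd i)}
  zero_mem' := by
    intro i φ _ _
    have e : ∀ g : (Fin n → ℝ) → ℝ,
        ∫ x, (0 : Lp ℝ p (volume : Measure (Fin n → ℝ))) x * g x = 0 := fun g =>
      integral_eq_zero_of_ae (Eventually.of_forall fun x => by simp)
    exact (e _).trans (by rw [← neg_zero]; exact congrArg Neg.neg (e φ).symm)
  add_mem' := by
    intro U V hU hV i φ hφ hc
    have hu := Lp.coeFn_add U.fst V.fst
    have hv := Lp.coeFn_add (U.snd i) (V.snd i)
    have e1 : ∫ x, (U.fst + V.fst : Lp ℝ p (volume : Measure (Fin n → ℝ))) x *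
          fderiv ℝ φ x (Pi.single i 1) =
        ∫ x, (U.fst x * fderiv ℝ φ x (Pi.single i 1) +
          V.fst x * fderiv ℝ φ x (Pi.single i 1)) :=
      integral_congr_ae (hu.mono fun x hx => by simp only [hx, Pi.add_apply, add_mul])
    have e2 : ∫ x, (U.snd i + V.snd i : Lp ℝ p (volume : Measure (Fin n → ℝ))) x * φ x =
        ∫ x, (U.snd i x * φ x + V.snd i x * φ x) :=
      integral_congr_ae (hv.mono fun x hx => by simp only [hx, Pi.add_apply, add_mul])
    rw [integral_add (integrable_mul_fderiv_test _ hφ hc i)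
      (integrable_mul_fderiv_test _ hφ hc i), hU i φ hφ hc, hV i φ hφ hc] at e1
    rw [integral_add (integrable_mul_test _ hφ.continuous hc)
      (integrable_mul_test _ hφ.continuous hc)] at e2
    exact e1.trans ((neg_add _ _).symm.trans (congrArg Neg.neg e2.symm))
  smul_mem' := by
    intro r U hU i φ hφ hc
    have hu := Lp.coeFn_smul r U.fst
    have hv := Lp.coeFn_smul r (U.snd i)
    have e1 : ∫ x, (r • U.fst : Lp ℝ p (volume : Measure (Fin n → ℝ))) x *
          fderiv ℝ φ x (Pi.single i 1) =
        ∫ x, r * (U.fst x * fderiv ℝ φ x (Pi.single i 1)) :=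
      integral_congr_ae (hu.mono fun x hx => by
        simp only [hx, Pi.smul_apply, smul_eq_mul, mul_assoc])
    have e2 : ∫ x, (r • U.snd i : Lp ℝ p (volume : Measure (Fin n → ℝ))) x * φ x =
        ∫ x, r * (U.snd i x * φ x) :=
      integral_congr_ae (hv.mono fun x hx => by
        simp only [hx, Pi.smul_apply, smul_eq_mul, mul_assoc])
    rw [integral_const_mul, hU i φ hφ hc, mul_neg] at e1
    rw [integral_const_mul] at e2
    exact e1.trans (congrArg Neg.neg e2.symm)

/-- The underlying `L_p`-class of a Sobolev element. -/
def W1.fn {n : ℕ} {p : ℝ≥0∞} [Fact (1 ≤ p)] (F : W1 n p) :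
    Lp ℝ p (volume : Measure (Fin n → ℝ)) := F.1.fst

/-- The norm of `W¹_p(ℝⁿ)` is the usual one. -/
theorem W1.norm_eq {n : ℕ} {p : ℝ≥0∞} [Fact (1 ≤ p)] (F : W1 n p) :
    ‖F‖ = ‖W1.fn F‖ + ∑ i, ‖F.1.snd i‖ := by
  change ‖F.1‖ = _
  rw [WithLp.prod_norm_eq_of_nat 1 (by norm_num), PiLp.norm_eq_of_nat 1 (by norm_num)]
  simp [W1.fn]

/-- A Sobolev element is determined by its underlying `L_p`-class. -/
theorem W1.fn_injective {n : ℕ} {p : ℝ≥0∞} [Fact (1 ≤ p)] :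
    Function.Injective (W1.fn : W1 n p → _) := by
  intro F G h
  have h1 : F.1.fst = G.1.fst := h
  have h2 : ∀ i, F.1.snd i = G.1.snd i := by
    intro i
    refine Lp.ext ?_
    refine ae_eq_of_integral_contDiff_smul_eq ((Lp.memLp _).locallyIntegrable Fact.out)
      ((Lp.memLp _).locallyIntegrable Fact.out) fun φ hφ hc => ?_
    have hF := F.2 i φ hφ hc
    have hG := G.2 i φ hφ hc
    rw [h1, hG, neg_inj] at hF
    simpa [mul_comm] using hF.symm
  apply Subtype.ext
  apply (WithLp.equiv 1 _).injective
  refine Prod.ext h1 ?_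
  exact PiLp.ext h2

end

end SobolevExt

open SobolevExt

/-! The proof bounds the approximating sequence pointwise. For almost every `x`, all values
`|f_k(x)|` and gradients `‖∇f_k(x)‖` are at most one function `G(x) = L (f^♮(x) + M
1_{[-3,4]^n}(x))`, where `M` is a constant multiple of `‖f‖_{L_p(𝔪₀)}`. Moreover `f_k → Ext f`
almost everywhere. A sequence dominated in this way converges weakly in `W¹_p`, and its limit
inherits the domination, which gives the norm estimate.

Domination (`approxSeq_bounds`, `approxSeq_bounds_of_near`). If `x` is near no active cube of level
`k`, the step to level `k` changes neither the value nor the gradient at `x`. Otherwise let `x` be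
near an active cube of level `i`, let `Q` be an adjacent keystone cube, and let `q` be the average
of `f` over `Q`. Let `g` be the last earlier level at which a keystone cube contains `Q`. For `g ≤ r
≤ i`, each coefficient of level `r` seen at `x` averages over keystone cubes that form admissible
pairs with `Q`, so it differs from `q` by at most `2^{-i} f^♮(x)`. The gain is the side of the small
cube, not of the large one. At level `g` the bumps near `x` sum to one, so everything built before
is forgotten; from `g` to `i` the gradient increments are at most a constant times `2^r 2^{-i}
f^♮(x)`, a geometric sum. When there is no such ancestor of positive level, the recursion starts
from level zero, where `‖f‖_{L_p(𝔪₀)}` enters. Chaining `Q` through its keystone ancestors controls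
`q` itself.

Convergence (`ae_tendsto_approxSeq`). Off `S` the sequence is eventually constant. At density points
of `S` small dyadic cubes are keystone cubes; hence Lebesgue measure on `S` is absolutely continuous
with respect to `𝔪₀`, and the coefficients converge to `f` at Lebesgue points of `f` for `𝔪₀`.

Weak limit (`exists_mem_closure_convexHull`, `exists_weak_limit`). The weight `G^{p/2-1}` moves the
dominated gradients into a bounded subset of `L₂`, where convex combinations converge strongly by
the parallelogram law. Dominated convergence brings this back to `L_p`. Every subsequence therefore
has the same Sobolev function in its closed convex hull, which is weak convergence. -/

/-! ### Strong convergence of convex combinations and of dominated sequences. -/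

/-- Almost norm-minimal elements of the hulls of the tails form a Cauchy sequence: the infima of the
norms increase to a finite limit, and midpoints stay in the larger hull. -/
theorem exists_tendsto_convexHull_tail {H : Type*} [NormedAddCommGroup H] [InnerProductSpace ℝ H]
    [CompleteSpace H] (x : ℕ → H) (B : ℝ) (hB : ∀ k, ‖x k‖ ≤ B) :
    ∃ (u : ℕ → H) (y : H), (∀ K, u K ∈ convexHull ℝ (x '' Set.Ici K)) ∧
      Tendsto u atTop (𝓝 y) := by
  set h : ℕ → Set H := fun K => convexHull ℝ (x '' Set.Ici K) with hh
  have hmem : ∀ K, x K ∈ h K := fun K => subset_convexHull ℝ _ ⟨K, Set.mem_Ici.2 le_rfl, rfl⟩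
  have hanti : ∀ K L, K ≤ L → h L ⊆ h K := fun K L hKL =>
    convexHull_mono (Set.image_mono (Set.Ici_subset_Ici.2 hKL))
  have hbdd : ∀ K, BddBelow (norm '' h K) := fun K => ⟨0, by rintro _ ⟨z, -, rfl⟩; positivity⟩
  set c : ℕ → ℝ := fun K => sInf (norm '' h K) with hc
  have hle : ∀ K z, z ∈ h K → c K ≤ ‖z‖ := fun K z hz => csInf_le (hbdd K) ⟨z, hz, rfl⟩
  have hcB : ∀ K, c K ≤ B := fun K => (hle K _ (hmem K)).trans (hB K)
  have hc0 : ∀ K, 0 ≤ c K := fun K =>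
    le_csInf ⟨_, _, hmem K, rfl⟩ (by rintro _ ⟨z, -, rfl⟩; positivity)
  have hmono : Monotone c := fun K L hKL =>
    csInf_le_csInf (hbdd K) ⟨_, _, hmem L, rfl⟩ (Set.image_mono (hanti K L hKL))
  have hlim : Tendsto c atTop (𝓝 (⨆ K, c K)) :=
    tendsto_atTop_ciSup hmono ⟨B, by rintro _ ⟨K, rfl⟩; exact hcB K⟩
  set ℓ := ⨆ K, c K
  have hcℓ : ∀ K, c K ≤ ℓ := fun K => le_ciSup ⟨B, by rintro _ ⟨K, rfl⟩; exact hcB K⟩ K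
  have hex : ∀ K : ℕ, ∃ z ∈ h K, ‖z‖ < c K + 1 / ((K : ℝ) + 1) := fun K => by
    obtain ⟨_, ⟨z, hz, rfl⟩, hlt⟩ := exists_lt_of_csInf_lt (s := norm '' h K)
      ⟨_, _, hmem K, rfl⟩ (show sInf (norm '' h K) < c K + 1 / ((K : ℝ) + 1) by
        have : (0 : ℝ) < 1 / ((K : ℝ) + 1) := by positivity
        linarith)
    exact ⟨z, hz, hlt⟩
  choose u hu hul using hex
  -- This is the parallelogram bound for `‖u K - u L‖` with `K ≤ L`: both norms are at most `ℓ + 1 /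
  -- (K + 1)`, and the midpoint has norm at least `c K`.
  set b : ℕ → ℝ := fun K => Real.sqrt (2 * ((ℓ + 1 / ((K : ℝ) + 1)) ^ 2 +
    (ℓ + 1 / ((K : ℝ) + 1)) ^ 2) - 4 * c K ^ 2) with hb
  have hblim : Tendsto b atTop (𝓝 0) := by
    have h1 : Tendsto (fun K : ℕ => 2 * ((ℓ + 1 / ((K : ℝ) + 1)) ^ 2 +
        (ℓ + 1 / ((K : ℝ) + 1)) ^ 2) - 4 * c K ^ 2) atTop
        (𝓝 (2 * ((ℓ + 0) ^ 2 + (ℓ + 0) ^ 2) - 4 * ℓ ^ 2)) := by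
      have h2 := tendsto_one_div_add_atTop_nhds_zero_nat (𝕜 := ℝ)
      have h3 := (h2.const_add ℓ).pow 2
      exact ((h3.add h3).const_mul 2).sub ((hlim.pow 2).const_mul 4)
    have h2 := h1.sqrt
    have e : 2 * ((ℓ + 0) ^ 2 + (ℓ + 0) ^ 2) - 4 * ℓ ^ 2 = 0 := by ring
    rwa [e, Real.sqrt_zero] at h2
  have hd : ∀ K L, K ≤ L → dist (u K) (u L) ≤ b K := fun K L hKL => by
    rw [dist_eq_norm]
    refine Real.le_sqrt_of_sq_le ?_
    have hpar := parallelogram_law_with_norm ℝ (u K) (u L)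
    have hmid : (1 / 2 : ℝ) • u K + (1 / 2 : ℝ) • u L ∈ h K :=
      convex_convexHull ℝ _ (hu K) (hanti K L hKL (hu L)) (by norm_num) (by norm_num) (by norm_num)
    have h1 := hle K _ hmid
    rw [← smul_add, norm_smul] at h1
    have h1' : 2 * c K ≤ ‖u K + u L‖ := by
      have e : ‖(1 / 2 : ℝ)‖ = 1 / 2 := by norm_num
      rw [e] at h1; linarith
    have h2 : ‖u K‖ ≤ ℓ + 1 / ((K : ℝ) + 1) := by linarith [hul K, hcℓ K]
    have h3 : ‖u L‖ ≤ ℓ + 1 / ((K : ℝ) + 1) := by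
      have : 1 / ((L : ℝ) + 1) ≤ 1 / ((K : ℝ) + 1) := by gcongr
      linarith [hul L, hcℓ L]
    have h4 : ‖u K‖ ^ 2 ≤ (ℓ + 1 / ((K : ℝ) + 1)) ^ 2 := by gcongr
    have h5 : ‖u L‖ ^ 2 ≤ (ℓ + 1 / ((K : ℝ) + 1)) ^ 2 := by gcongr
    have h6 : (2 * c K) ^ 2 ≤ ‖u K + u L‖ ^ 2 := by
      have := hc0 K
      gcongr
    nlinarith
  obtain ⟨y, hy⟩ := cauchySeq_tendsto_of_complete (cauchySeq_of_le_tendsto_0' b hd hblim)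
  exact ⟨u, y, hu, hy⟩

theorem tendsto_of_mem_convexHull_tail {E : Type*} [SeminormedAddCommGroup E] [NormedSpace ℝ E]
    {x u : ℕ → E} {y : E} (hx : Tendsto x atTop (𝓝 y))
    (hu : ∀ K, u K ∈ convexHull ℝ (x '' Set.Ici K)) : Tendsto u atTop (𝓝 y) := by
  rw [Metric.tendsto_atTop] at hx ⊢
  intro ε hε
  obtain ⟨N, hN⟩ := hx ε hε
  refine ⟨N, fun K hK => ?_⟩
  refine convexHull_min ?_ (convex_ball y ε) (hu K)
  rintro _ ⟨k, hk, rfl⟩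
  exact hN k (hK.trans hk)

theorem tendsto_eLpNorm_sub_of_dominated {X E : Type*} [MeasurableSpace X] {μ : Measure X}
    [NormedAddCommGroup E] {p : ℝ≥0∞} (hp : p ≠ 0) (hp' : p ≠ ⊤) {w : ℕ → X → E} {v : X → E}
    {G : X → ℝ}
    (hw : ∀ k, AEStronglyMeasurable (w k) μ) (hG : MemLp G p μ)
    (hb : ∀ k, ∀ᵐ x ∂μ, ‖w k x‖ ≤ G x)
    (hlim : ∀ᵐ x ∂μ, Tendsto (fun k => w k x) atTop (𝓝 (v x))) :
    MemLp v p μ ∧ Tendsto (fun k => eLpNorm (w k - v) p μ) atTop (𝓝 0) := by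
  have hv : AEStronglyMeasurable v μ := aestronglyMeasurable_of_tendsto_ae atTop hw hlim
  have hbv : ∀ᵐ x ∂μ, ‖v x‖ ≤ G x := by
    filter_upwards [ae_all_iff.2 hb, hlim] with x h1 h2
    exact le_of_tendsto h2.norm (Eventually.of_forall h1)
  refine ⟨hG.mono' hv hbv, ?_⟩
  have hpos : 0 < p.toReal := ENNReal.toReal_pos hp hp'
  simp_rw [eLpNorm_eq_lintegral_rpow_enorm_toReal hp hp']
  have key : Tendsto (fun k => ∫⁻ x, ‖(w k - v) x‖ₑ ^ p.toReal ∂μ) atTop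
      (𝓝 (∫⁻ x, 0 ∂μ)) := by
    refine tendsto_lintegral_of_dominated_convergence' (fun x => ‖(2 : ℝ) * G x‖ₑ ^ p.toReal)
      (fun k => (((hw k).sub hv).enorm.pow_const _)) (fun k => ?_) ?_ ?_
    · filter_upwards [hb k, hbv] with x h1 h2
      gcongr
      rw [enorm_le_iff_norm_le]
      have h3 : ‖(w k - v) x‖ ≤ ‖w k x‖ + ‖v x‖ := norm_sub_le _ _
      exact (h3.trans (by linarith)).trans (le_abs_self _)
    · exact (lintegral_rpow_enorm_lt_top_of_eLpNorm_lt_top hp hp' (hG.const_mul 2).2).ne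
    · filter_upwards [hlim] with x hx
      have h1 : Tendsto (fun k => ‖w k x - v x‖ₑ) atTop (𝓝 0) := by
        have := (hx.sub_const (v x)).enorm
        simpa using this
      have h2 := (ENNReal.continuous_rpow_const (y := p.toReal)).tendsto 0 |>.comp h1
      simpa [ENNReal.zero_rpow_of_pos hpos, Function.comp_def] using h2
  rw [lintegral_zero] at key
  have h2 := (ENNReal.continuous_rpow_const (y := 1 / p.toReal)).tendsto 0 |>.comp key
  rwa [ENNReal.zero_rpow_of_pos (by positivity)] at h2

theorem Lp.tendsto_of_dominated {X : Type*} [MeasurableSpace X] {μ : Measure X}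
    {p : ℝ≥0∞} [Fact (1 ≤ p)] (hp' : p ≠ ⊤) {w : ℕ → Lp ℝ p μ} {v : X → ℝ} {G : X → ℝ}
    (hG : MemLp G p μ) (hb : ∀ k, ∀ᵐ x ∂μ, |w k x| ≤ G x)
    (hlim : ∀ᵐ x ∂μ, Tendsto (fun k => w k x) atTop (𝓝 (v x))) :
    ∃ h : MemLp v p μ, Tendsto w atTop (𝓝 (h.toLp v)) := by
  have hp : p ≠ 0 := (zero_lt_one.trans_le Fact.out).ne'
  obtain ⟨h1, h2⟩ := tendsto_eLpNorm_sub_of_dominated hp hp'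
    (fun k => (Lp.memLp (w k)).1) hG hb hlim
  exact ⟨h1, Lp.tendsto_Lp_of_tendsto_eLpNorm v h1 h2⟩

/-- Strong convergence in `L₂` of the weighted sequence gives almost everywhere convergence along
subsequences. Dividing by the weight and applying dominated convergence turns this into convergence
in `L_p`. -/
theorem Lp.tendsto_of_weighted_tendsto {X : Type*} [MeasurableSpace X] {μ : Measure X}
    {p : ℝ≥0∞} [Fact (1 ≤ p)] (hp' : p ≠ ⊤) {w : ℕ → Lp ℝ p μ} {y : ℕ → Lp ℝ 2 μ} {z : Lp ℝ 2 μ}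
    {G ρ : X → ℝ} (hG : MemLp G p μ) (hρ : ∀ᵐ x ∂μ, ρ x = 0 → G x = 0)
    (hb : ∀ k, ∀ᵐ x ∂μ, |w k x| ≤ G x) (hy : ∀ k, ∀ᵐ x ∂μ, y k x = ρ x * w k x)
    (hz : Tendsto y atTop (𝓝 z)) :
    ∃ v : Lp ℝ p μ, Tendsto w atTop (𝓝 v) ∧ ∀ᵐ x ∂μ, |v x| ≤ G x := by
  have hwy : ∀ k, ∀ᵐ x ∂μ, w k x = (ρ x)⁻¹ * y k x := fun k => by
    -- Where the weight vanishes, the domination forces `w k x = 0`, which agrees with the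
    -- convention `0⁻¹ = 0`.
    filter_upwards [hρ, hb k, hy k] with x h1 h2 h3
    by_cases h0 : ρ x = 0
    · rw [h1 h0, abs_nonpos_iff] at h2
      simp [h0, h2]
    · rw [h3]; field_simp
  -- The limit `(ρ x)⁻¹ * z x` does not depend on the subsequence, so the whole sequence converges.
  have hsub : ∀ ns : ℕ → ℕ, Tendsto ns atTop atTop → ∃ ms : ℕ → ℕ,
      ∀ᵐ x ∂μ, Tendsto (fun k => w (ns (ms k)) x) atTop (𝓝 ((ρ x)⁻¹ * z x)) := fun ns hns => by
    have h1 := (Lp.tendsto_Lp_iff_tendsto_eLpNorm' _ _).1 (hz.comp hns)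
    have h2 := tendstoInMeasure_of_tendsto_eLpNorm (by norm_num)
      (fun k => (Lp.memLp _).1) (Lp.memLp z).1 h1
    obtain ⟨ms, -, hms⟩ := h2.exists_seq_tendsto_ae
    refine ⟨ms, ?_⟩
    filter_upwards [hms, ae_all_iff.2 hwy] with x h3 h4
    simp_rw [h4]
    exact h3.const_mul _
  obtain ⟨ms, hms⟩ := hsub id tendsto_id
  obtain ⟨h, -⟩ := Lp.tendsto_of_dominated hp' hG (fun k => hb (id (ms k))) hms
  refine ⟨h.toLp _, ?_, ?_⟩
  · refine tendsto_of_subseq_tendsto fun ns hns => ?_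
    obtain ⟨ms, hms⟩ := hsub ns hns
    obtain ⟨h', h''⟩ := Lp.tendsto_of_dominated hp' hG (fun k => hb (ns (ms k))) hms
    exact ⟨ms, h''⟩
  · filter_upwards [h.coeFn_toLp, hms, ae_all_iff.2 hb] with x h1 h2 h3
    rw [h1]
    exact le_of_tendsto h2.abs (Eventually.of_forall fun k => h3 _)

/-! ### Weak limits in `W¹_p` under pointwise domination. -/

namespace SobolevExt

theorem tendsto_integral_mul {n : ℕ} {p : ℝ≥0∞} [Fact (1 ≤ p)]
    {u : ℕ → Lp ℝ p (volume : Measure (Fin n → ℝ))} {v : Lp ℝ p (volume : Measure (Fin n → ℝ))}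
    (hu : Tendsto u atTop (𝓝 v)) {φ : (Fin n → ℝ) → ℝ} (hφ : Continuous φ)
    (hc : HasCompactSupport φ) :
    Tendsto (fun k => ∫ x, u k x * φ x) atTop (𝓝 (∫ x, v x * φ x)) := by
  set q := ENNReal.conjExponent p
  have hpq : ENNReal.HolderConjugate p q := ENNReal.HolderConjugate.conjExponent Fact.out
  have hq : Fact (1 ≤ q) := ⟨hpq.symm.one_le⟩
  have hφq : MemLp φ q volume := hφ.memLp_of_hasCompactSupport hc
  have key : ∀ g : Lp ℝ p (volume : Measure (Fin n → ℝ)), ∫ x, g x * φ x =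
      (ContinuousLinearMap.mul ℝ ℝ).lpPairing volume p q g (hφq.toLp φ) := fun g => by
    rw [ContinuousLinearMap.lpPairing_eq_integral]
    refine integral_congr_ae ?_
    filter_upwards [hφq.coeFn_toLp] with x hx
    simp [hx]
  simp_rw [key]
  exact (((ContinuousLinearMap.mul ℝ ℝ).lpPairing volume p q).flip
    (hφq.toLp φ)).continuous.tendsto v |>.comp hu

theorem isWeakPartial_of_tendsto {n : ℕ} {p : ℝ≥0∞} [Fact (1 ≤ p)] {i : Fin n}
    {u v : ℕ → Lp ℝ p (volume : Measure (Fin n → ℝ))}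
    {u' v' : Lp ℝ p (volume : Measure (Fin n → ℝ))} (h : ∀ k, IsWeakPartial i (u k) (v k))
    (hu : Tendsto u atTop (𝓝 u')) (hv : Tendsto v atTop (𝓝 v')) : IsWeakPartial i u' v' := by
  intro φ hφ hc
  have h1 := tendsto_integral_mul hu (φ := fun x => fderiv ℝ φ x (Pi.single i 1))
    ((hφ.continuous_fderiv (by simp)).clm_apply continuous_const)
    ((hc.fderiv ℝ).comp_left (g := fun L : (Fin n → ℝ) →L[ℝ] ℝ => L (Pi.single i 1)) rfl)
  have h2 := (tendsto_integral_mul hv hφ.continuous hc).neg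
  refine tendsto_nhds_unique h1 (h2.congr fun k => (h k φ hφ hc).symm)

/-- The functions converge in `L_p` by domination, but the gradients have no pointwise limit. They
are made to converge by convex combinations chosen in a weighted `L₂`, and weak derivatives pass to
the limit. -/
theorem exists_mem_closure_convexHull {n : ℕ} {p : ℝ≥0∞} [Fact (1 ≤ p)] (hp' : p ≠ ⊤)
    {V : ℕ → W1 n p} {G F : (Fin n → ℝ) → ℝ} (hG : MemLp G p volume)
    (hb : ∀ k, ∀ᵐ x, |W1.fn (V k) x| ≤ G x) (hb' : ∀ k i, ∀ᵐ x, |(V k).1.snd i x| ≤ G x)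
    (hF : ∀ᵐ x, Tendsto (fun k => W1.fn (V k) x) atTop (𝓝 (F x))) :
    ∃ U : W1 n p, W1.fn U =ᵐ[volume] F ∧ (∀ i, ∀ᵐ x, |U.1.snd i x| ≤ G x) ∧
      U ∈ closure (convexHull ℝ (Set.range V)) := by
  have hp : p ≠ 0 := (zero_lt_one.trans_le Fact.out).ne'
  obtain ⟨hFp, hfst⟩ := Lp.tendsto_of_dominated hp' hG hb hF
  -- With this exponent `ρ |v| ≤ G^{p/2}`, a function in `L₂`, whenever `|v| ≤ G`; and `ρ` can
  -- vanish only where `G` does.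
  set ρ : (Fin n → ℝ) → ℝ := fun x => ‖G x‖ ^ (p.toReal / 2 - 1) with hρ
  have hρ0 : ∀ᵐ x, ρ x = 0 → G x = 0 := Eventually.of_forall fun x hx => by
    have := (Real.rpow_eq_zero_iff_of_nonneg (norm_nonneg (G x))).1 hx
    exact norm_eq_zero.1 this.1
  have hG2 : MemLp (fun x => ‖G x‖ ^ (p.toReal / 2)) 2 volume := by
    have := hG.norm_rpow_div (p / 2)
    rw [ENNReal.toReal_div, ENNReal.div_div_cancel hp hp'] at this
    simpa using this
  have hρG : ∀ (v : (Fin n → ℝ) → ℝ), ∀ x, |v x| ≤ G x → ‖ρ x * v x‖ ≤ ‖G x‖ ^ (p.toReal / 2) := by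
    intro v x hx
    have hGx : 0 ≤ G x := (abs_nonneg _).trans hx
    rw [norm_mul, Real.norm_of_nonneg (Real.rpow_nonneg (norm_nonneg _) _)]
    rcases hGx.eq_or_lt with h0 | h0
    · rw [← h0, abs_nonpos_iff] at hx
      rw [hx]; simp; positivity
    · rw [Real.norm_of_nonneg hGx]
      calc _ ≤ G x ^ (p.toReal / 2 - 1) * G x := by gcongr; exact hx
        _ = _ := by rw [← Real.rpow_add_one h0.ne']; ring_nf
  have hρm : AEStronglyMeasurable ρ volume :=
    (hG.1.norm.aemeasurable.pow_const _).aestronglyMeasurable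
  have hm : ∀ k i, MemLp (fun x => ρ x * (V k).1.snd i x) 2 volume := fun k i =>
    hG2.mono' (hρm.mul (Lp.memLp _).1) (by filter_upwards [hb' k i] with x hx using hρG _ x hx)
  let y : ℕ → PiLp 2 (fun _ : Fin n => Lp ℝ 2 (volume : Measure (Fin n → ℝ))) := fun k =>
    WithLp.toLp 2 fun i => (hm k i).toLp _
  obtain ⟨B, hB⟩ : ∃ B : ℝ, ∀ k, ‖y k‖ ≤ B := by
    refine ⟨Real.sqrt (∑ _i : Fin n, ‖hG2.toLp _‖ ^ 2), fun k => ?_⟩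
    rw [PiLp.norm_eq_of_L2]
    refine Real.sqrt_le_sqrt (Finset.sum_le_sum fun i _ => ?_)
    gcongr
    refine Lp.norm_le_norm_of_ae_le ?_
    filter_upwards [hb' k i, (hm k i).coeFn_toLp, hG2.coeFn_toLp] with x h1 h2 h3
    change ‖((hm k i).toLp _ : (Fin n → ℝ) → ℝ) x‖ ≤ _
    rw [h2, h3]
    exact (hρG _ x h1).trans (le_abs_self _)
  obtain ⟨u, z, hu, hz⟩ := exists_tendsto_convexHull_tail y B hB
  -- Taking hulls of pairs makes the convex coefficients found in `L₂` act on the Sobolev elements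
  -- as well.
  have hlift : ∀ K, ∃ W : W1 n p × PiLp 2 (fun _ : Fin n => Lp ℝ 2 (volume : Measure (Fin n → ℝ))),
      W ∈ convexHull ℝ ((fun k => (V k, y k)) '' Set.Ici K) ∧ W.2 = u K := fun K => by
    have h1 := hu K
    have h2 := LinearMap.image_convexHull (LinearMap.snd ℝ (W1 n p)
      (PiLp 2 (fun _ : Fin n => Lp ℝ 2 (volume : Measure (Fin n → ℝ)))))
      ((fun k => (V k, y k)) '' Set.Ici K)
    rw [Set.image_image] at h2
    change _ '' _ = convexHull ℝ (y '' Set.Ici K) at h2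
    rw [← h2] at h1
    exact h1
  choose W hW hWu using hlift
  have hW1 : ∀ K, (W K).1 ∈ convexHull ℝ (V '' Set.Ici K) := fun K => by
    have h2 := LinearMap.image_convexHull (LinearMap.fst ℝ (W1 n p)
      (PiLp 2 (fun _ : Fin n => Lp ℝ 2 (volume : Measure (Fin n → ℝ)))))
      ((fun k => (V k, y k)) '' Set.Ici K)
    rw [Set.image_image] at h2
    change _ '' _ = convexHull ℝ (V '' Set.Ici K) at h2
    rw [← h2]
    exact ⟨_, hW K, rfl⟩
  have hW2 : ∀ K, W1.fn (W K).1 ∈ convexHull ℝ ((fun k => W1.fn (V k)) '' Set.Ici K) := fun K => by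
    let T : W1 n p →ₗ[ℝ] Lp ℝ p (volume : Measure (Fin n → ℝ)) :=
      { toFun := W1.fn, map_add' := fun _ _ => rfl, map_smul' := fun _ _ => rfl }
    have h2 := LinearMap.image_convexHull T (V '' Set.Ici K)
    rw [Set.image_image] at h2
    change _ '' _ = convexHull ℝ ((fun k => W1.fn (V k)) '' Set.Ici K) at h2
    rw [← h2]
    exact ⟨_, hW1 K, rfl⟩
  have hWfst : Tendsto (fun K => W1.fn (W K).1) atTop (𝓝 (hFp.toLp F)) :=
    tendsto_of_mem_convexHull_tail hfst hW2
  have hrel : ∀ K i, (∀ᵐ x, (W K).2 i x = ρ x * (W K).1.1.snd i x) ∧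
      ∀ᵐ x, |(W K).1.1.snd i x| ≤ G x := by
    intro K
    -- The weighted relation and the bound by `G` define a convex set containing all the pairs, so
    -- they hold on the hull.
    let R : Set (W1 n p × PiLp 2 (fun _ : Fin n => Lp ℝ 2 (volume : Measure (Fin n → ℝ)))) :=
      {P | ∀ i, (∀ᵐ x, P.2 i x = ρ x * P.1.1.snd i x) ∧ ∀ᵐ x, |P.1.1.snd i x| ≤ G x}
    have hR : Convex ℝ R := by
      intro P hP Q hQ a b ha hb hab i
      have e1 : (a • P + b • Q).2 i = a • P.2 i + b • Q.2 i := rfl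
      have e2 : (a • P + b • Q).1.1.snd i = a • P.1.1.snd i + b • Q.1.1.snd i := rfl
      have c1 : ∀ᵐ x, (a • P + b • Q).2 i x = a * P.2 i x + b * Q.2 i x := by
        rw [e1]
        filter_upwards [Lp.coeFn_add (a • P.2 i) (b • Q.2 i), Lp.coeFn_smul a (P.2 i),
          Lp.coeFn_smul b (Q.2 i)] with x h1 h2 h3
        rw [h1, Pi.add_apply, h2, h3]; rfl
      have c2 : ∀ᵐ x, (a • P + b • Q).1.1.snd i x =
          a * P.1.1.snd i x + b * Q.1.1.snd i x := by
        rw [e2]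
        filter_upwards [Lp.coeFn_add (a • P.1.1.snd i) (b • Q.1.1.snd i),
          Lp.coeFn_smul a (P.1.1.snd i), Lp.coeFn_smul b (Q.1.1.snd i)] with x h1 h2 h3
        rw [h1, Pi.add_apply, h2, h3]; rfl
      constructor
      · filter_upwards [c1, c2, (hP i).1, (hQ i).1] with x h1 h2 h3 h4
        rw [h1, h2, h3, h4]; ring
      · filter_upwards [c2, (hP i).2, (hQ i).2] with x h2 h3 h4
        rw [h2]
        calc _ ≤ |a * P.1.1.snd i x| + |b * Q.1.1.snd i x| := abs_add_le _ _
          _ = a * |P.1.1.snd i x| + b * |Q.1.1.snd i x| := by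
            rw [abs_mul, abs_mul, abs_of_nonneg ha, abs_of_nonneg hb]
          _ ≤ a * G x + b * G x := by gcongr
          _ = G x := by rw [← add_mul, hab, one_mul]
    refine convexHull_min ?_ hR (hW K)
    rintro _ ⟨k, -, rfl⟩ i
    exact ⟨(hm k i).coeFn_toLp, hb' k i⟩
  have hsnd : ∀ i, ∃ v : Lp ℝ p (volume : Measure (Fin n → ℝ)),
      Tendsto (fun K => (W K).1.1.snd i) atTop (𝓝 v) ∧ ∀ᵐ x, |v x| ≤ G x := fun i => by
    refine Lp.tendsto_of_weighted_tendsto hp' (y := fun K => (W K).2 i) (z := z i) hG hρ0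
      (fun K => (hrel K i).2) (fun K => (hrel K i).1) ?_
    simp_rw [hWu]
    exact ((PiLp.continuous_apply 2 _ i).tendsto z).comp hz
  choose v hv hvG using hsnd
  let U : W1 n p := ⟨WithLp.toLp 1 (hFp.toLp F, WithLp.toLp 1 v), fun i =>
    isWeakPartial_of_tendsto (fun K => (W K).1.2 i) hWfst (hv i)⟩
  refine ⟨U, hFp.coeFn_toLp, hvG, ?_⟩
  refine mem_closure_of_tendsto (f := fun K => (W K).1) (b := atTop) ?_
    (Eventually.of_forall fun K => convexHull_mono (Set.image_subset_range _ _) (hW1 K))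
  rw [tendsto_subtype_rng]
  have h1 : Tendsto (fun K => WithLp.toLp 1 (fun i => (W K).1.1.snd i)) atTop
      (𝓝 (WithLp.toLp 1 v : PiLp 1 fun _ : Fin n => Lp ℝ p (volume : Measure (Fin n → ℝ)))) :=
    ((PiLp.continuous_toLp 1 _).tendsto v).comp (tendsto_pi_nhds.2 hv)
  exact ((WithLp.prod_continuous_toLp 1 _ _).tendsto (hFp.toLp F, WithLp.toLp 1 v)).comp
    (hWfst.prodMk_nhds h1)

theorem isWeakPartial_of_contDiff {n : ℕ} (i : Fin n) {u : (Fin n → ℝ) → ℝ}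
    (hu : ContDiff ℝ ∞ u) : IsWeakPartial i u fun x => fderiv ℝ u x (Pi.single i 1) := by
  intro φ hφ hc
  have hd : ∀ {g : (Fin n → ℝ) → ℝ}, ContDiff ℝ ∞ g →
      Continuous fun x => fderiv ℝ g x (Pi.single i 1) := fun hg =>
    (hg.continuous_fderiv (by simp)).clm_apply continuous_const
  have hc' : HasCompactSupport fun x => fderiv ℝ φ x (Pi.single i 1) :=
    (hc.fderiv ℝ).comp_left (g := fun L : (Fin n → ℝ) →L[ℝ] ℝ => L (Pi.single i 1)) rfl
  exact integral_mul_fderiv_eq_neg_fderiv_mul_of_integrable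
    (((hd hu).mul hφ.continuous).integrable_of_hasCompactSupport hc.mul_left)
    ((hu.continuous.mul (hd hφ)).integrable_of_hasCompactSupport hc'.mul_left)
    ((hu.continuous.mul hφ.continuous).integrable_of_hasCompactSupport hc.mul_left)
    (fun x _ => hu.differentiable (by simp) x) (fun x _ => hφ.differentiable (by simp) x)

theorem IsWeakPartial.congr {n : ℕ} {i : Fin n} {u v u' v' : (Fin n → ℝ) → ℝ}
    (h : IsWeakPartial i u v) (hu : u' =ᵐ[volume] u) (hv : v' =ᵐ[volume] v) :
    IsWeakPartial i u' v' := by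
  intro φ hφ hc
  have e1 : ∫ x, u' x * fderiv ℝ φ x (Pi.single i 1) = ∫ x, u x * fderiv ℝ φ x (Pi.single i 1) :=
    integral_congr_ae (hu.mono fun x hx => by simp only [hx])
  have e2 : ∫ x, v' x * φ x = ∫ x, v x * φ x :=
    integral_congr_ae (hv.mono fun x hx => by simp only [hx])
  rw [e1, e2, h φ hφ hc]

/-- A dominated sequence of test functions which converges almost everywhere and whose gradients
are dominated converges weakly in `W¹_p`. -/
theorem exists_weak_limit {n : ℕ} {p : ℝ≥0∞} [Fact (1 ≤ p)] (hp' : p ≠ ⊤)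
    {u : ℕ → (Fin n → ℝ) → ℝ} {G F : (Fin n → ℝ) → ℝ} (hu : ∀ k, ContDiff ℝ ∞ (u k))
    (hc : ∀ k, HasCompactSupport (u k)) (hG : MemLp G p volume)
    (hb : ∀ k, ∀ᵐ x, |u k x| ≤ G x) (hb' : ∀ k, ∀ᵐ x, ‖fderiv ℝ (u k) x‖ ≤ G x)
    (hF : ∀ᵐ x, Tendsto (fun k => u k x) atTop (𝓝 (F x))) :
    ∃ U : W1 n p, W1.fn U =ᵐ[volume] F ∧
      (∃ V : ℕ → W1 n p, (∀ k, W1.fn (V k) =ᵐ[volume] u k) ∧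
        ∀ Λ : W1 n p →L[ℝ] ℝ, Tendsto (fun k => Λ (V k)) atTop (𝓝 (Λ U))) ∧
      ENNReal.ofReal ‖U‖ ≤ (n + 1) * eLpNorm G p volume := by
  have hd : ∀ k i, Continuous fun x => fderiv ℝ (u k) x (Pi.single i 1) := fun k i =>
    ((hu k).continuous_fderiv (by simp)).clm_apply continuous_const
  have hdc : ∀ k i, HasCompactSupport fun x => fderiv ℝ (u k) x (Pi.single i 1) := fun k i =>
    ((hc k).fderiv ℝ).comp_left (g := fun L : (Fin n → ℝ) →L[ℝ] ℝ => L (Pi.single i 1)) rfl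
  have hum : ∀ k, MemLp (u k) p volume := fun k =>
    (hu k).continuous.memLp_of_hasCompactSupport (hc k)
  have hdm : ∀ k i, MemLp (fun x => fderiv ℝ (u k) x (Pi.single i 1)) p volume := fun k i =>
    (hd k i).memLp_of_hasCompactSupport (hdc k i)
  let V : ℕ → W1 n p := fun k =>
    ⟨WithLp.toLp 1 ((hum k).toLp _, WithLp.toLp 1 fun i => (hdm k i).toLp _), fun i =>
      (isWeakPartial_of_contDiff i (hu k)).congr (hum k).coeFn_toLp (hdm k i).coeFn_toLp⟩
  have hV : ∀ k, W1.fn (V k) =ᵐ[volume] u k := fun k => (hum k).coeFn_toLp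
  have hVb : ∀ k, ∀ᵐ x, |W1.fn (V k) x| ≤ G x := fun k => by
    filter_upwards [hV k, hb k] with x h1 h2
    rwa [h1]
  have hVb' : ∀ k i, ∀ᵐ x, |(V k).1.snd i x| ≤ G x := fun k i => by
    filter_upwards [(hdm k i).coeFn_toLp, hb' k] with x h1 h2
    change |((hdm k i).toLp _ : (Fin n → ℝ) → ℝ) x| ≤ _
    rw [h1]
    refine ((fderiv ℝ (u k) x).le_opNorm _).trans ?_
    rw [Pi.norm_single, norm_one, mul_one]
    exact h2
  have hVF : ∀ᵐ x, Tendsto (fun k => W1.fn (V k) x) atTop (𝓝 (F x)) := by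
    filter_upwards [ae_all_iff.2 hV, hF] with x h1 h2
    simpa only [h1] using h2
  -- Applied to every subsequence: the element found always has `F` as its underlying function,
  -- hence by `W1.fn_injective` it is always the same.
  have hex : ∀ φ : ℕ → ℕ, Tendsto φ atTop atTop → ∃ U : W1 n p, W1.fn U =ᵐ[volume] F ∧
      (∀ i, ∀ᵐ x, |U.1.snd i x| ≤ G x) ∧ U ∈ closure (convexHull ℝ (Set.range (V ∘ φ))) :=
    fun φ hφ => exists_mem_closure_convexHull hp' hG (fun k => hVb (φ k)) (fun k => hVb' (φ k))
      (hVF.mono fun x hx => hx.comp hφ)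
  obtain ⟨U, hUF, hUG, -⟩ := hex id tendsto_id
  have hUG0 : ∀ᵐ x, |W1.fn U x| ≤ G x := by
    filter_upwards [hUF, hVF, ae_all_iff.2 hVb] with x h1 h2 h3
    rw [h1]
    exact le_of_tendsto h2.abs (Eventually.of_forall h3)
  -- If `Λ (V k) ≤ a` infinitely often, that closed half-space contains the closed hull of a
  -- subsequence, hence `U`. Using `-Λ` as well gives convergence.
  have half : ∀ (Λ : W1 n p →L[ℝ] ℝ) (a : ℝ), a < Λ U → ∀ᶠ k in atTop, a < Λ (V k) := by
    intro Λ a ha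
    by_contra hcon
    rw [not_eventually] at hcon
    obtain ⟨φ, hφ, hφ'⟩ := extraction_of_frequently_atTop hcon
    obtain ⟨U', hU'F, -, hU'⟩ := hex φ hφ.tendsto_atTop
    have hUU' : U' = U := W1.fn_injective (Lp.ext (hU'F.trans hUF.symm))
    have h1 : closure (convexHull ℝ (Set.range (V ∘ φ))) ⊆ {W | Λ W ≤ a} := by
      refine closure_minimal (convexHull_min ?_ ?_) (isClosed_le Λ.continuous continuous_const)
      · rintro _ ⟨k, rfl⟩
        exact not_lt.1 (hφ' k)
      · exact convex_halfSpace_le Λ.toLinearMap.isLinear a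
    have h2 := h1 hU'
    rw [hUU'] at h2
    exact absurd h2 (not_le.2 ha)
  refine ⟨U, hUF, ⟨V, hV, fun Λ => tendsto_order.2 ⟨fun a ha => half Λ a ha, fun a ha => ?_⟩⟩, ?_⟩
  · have := half (-Λ) (-a) (by simpa using ha)
    filter_upwards [this] with k hk
    simpa using hk
  · rw [W1.norm_eq]
    have hnorm : ∀ g : Lp ℝ p (volume : Measure (Fin n → ℝ)), (∀ᵐ x, |g x| ≤ G x) →
        ‖g‖ ≤ (eLpNorm G p volume).toReal := fun g hg => by
      rw [Lp.norm_def]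
      exact ENNReal.toReal_mono hG.2.ne (eLpNorm_mono_ae_real hg)
    have h1 : ‖W1.fn U‖ + ∑ i, ‖U.1.snd i‖ ≤ (n + 1) * (eLpNorm G p volume).toReal := by
      have := Finset.sum_le_sum fun i (_ : i ∈ Finset.univ) => hnorm _ (hUG i)
      rw [Finset.sum_const, Finset.card_univ, Fintype.card_fin, nsmul_eq_mul] at this
      linarith [hnorm _ hUG0]
    refine (ENNReal.ofReal_le_ofReal h1).trans ?_
    rw [ENNReal.ofReal_mul (by positivity), ENNReal.ofReal_toReal hG.2.ne]
    gcongr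
    rw [ENNReal.ofReal_add (by positivity) zero_le_one]
    simp

/-! ### Geometry of dyadic cubes -/

theorem side_pos (k : ℤ) : 0 < side k := by unfold side; positivity

theorem side_natCast (k : ℕ) : side k = ((2 : ℝ) ^ k)⁻¹ := by
  simp [side, zpow_neg]

theorem side_le_side {a b : ℤ} : side a ≤ side b ↔ b ≤ a := by
  unfold side
  rw [zpow_le_zpow_iff_right₀ (by norm_num)]
  omega

theorem side_lt_side {a b : ℤ} : side a < side b ↔ b < a := by
  rw [← not_le, side_le_side, not_le]

theorem side_le_one (k : ℕ) : side k ≤ 1 := by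
  rw [side_natCast]
  exact inv_le_one_of_one_le₀ (one_le_pow₀ (by norm_num))

theorem two_pow_mul_side (k : ℕ) : (2 : ℝ) ^ k * side k = 1 := by
  rw [side_natCast]; field_simp

theorem mem_dyadicCube_iff {n : ℕ} {k : ℕ} {m : Fin n → ℤ} {x : Fin n → ℝ} :
    x ∈ dyadicCube k m ↔ ∀ i, (m i : ℝ) ≤ 2 ^ k * x i ∧ 2 ^ k * x i ≤ m i + 1 := by
  have h2 : (0 : ℝ) < 2 ^ k := by positivity
  refine forall_congr' fun i => and_congr ?_ ?_
  · rw [side_natCast, ← div_eq_mul_inv, div_le_iff₀ h2, mul_comm]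
  · rw [side_natCast, ← div_eq_mul_inv, le_div_iff₀ h2, mul_comm]

theorem mem_dilatedCube_iff {n : ℕ} {c : ℝ} {k : ℕ} {m : Fin n → ℤ} {x : Fin n → ℝ} :
    x ∈ dilatedCube c k m ↔ ∀ i, |2 ^ k * x i - m i - 1 / 2| ≤ c / 2 := by
  have h2 := two_pow_mul_side k
  have h3 := side_pos k
  have h4 : (0 : ℝ) < 2 ^ k := by positivity
  refine forall_congr' fun i => ?_
  rw [abs_le]
  refine and_congr ⟨fun h => ?_, fun h => ?_⟩ ⟨fun h => ?_, fun h => ?_⟩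
  · have := mul_le_mul_of_nonneg_left h h4.le
    beta_reduce at this ⊢
    linear_combination this - (m i + 1 / 2 - c / 2) * h2
  · have := mul_le_mul_of_nonneg_right h h3.le
    beta_reduce at this ⊢
    linear_combination this + x i * h2
  · have := mul_le_mul_of_nonneg_left h h4.le
    beta_reduce at this ⊢
    linear_combination this + (m i + 1 / 2 + c / 2) * h2
  · have := mul_le_mul_of_nonneg_right h h3.le
    beta_reduce at this ⊢
    linear_combination this - x i * h2

theorem corner_mem {n : ℕ} (k : ℕ) (m : Fin n → ℤ) :
    (fun i => (m i : ℝ) * side k) ∈ dyadicCube k m := by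
  rw [mem_dyadicCube_iff]
  intro i
  have h2 := two_pow_mul_side k
  have : (2 : ℝ) ^ k * (m i * side k) = m i := by linear_combination (m i : ℝ) * h2
  rw [this]; constructor <;> linarith

theorem corner_mem' {n : ℕ} (k : ℕ) (m : Fin n → ℤ) :
    (fun i => ((m i : ℝ) + 1) * side k) ∈ dyadicCube k m := by
  rw [mem_dyadicCube_iff]
  intro i
  have h2 := two_pow_mul_side k
  have : (2 : ℝ) ^ k * ((m i + 1) * side k) = m i + 1 := by linear_combination ((m i : ℝ) + 1) * h2
  rw [this]; constructor <;> linarith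

theorem dyadicCube_inter_nonempty_iff {n : ℕ} {k : ℕ} {m m' : Fin n → ℤ} :
    (dyadicCube k m ∩ dyadicCube k m').Nonempty ↔ ∀ i, |m i - m' i| ≤ 1 := by
  constructor
  · rintro ⟨x, hx, hx'⟩ i
    rw [mem_dyadicCube_iff] at hx hx'
    have h1 : (m i : ℝ) ≤ m' i + 1 := (hx i).1.trans (hx' i).2
    have h2 : (m' i : ℝ) ≤ m i + 1 := (hx' i).1.trans (hx i).2
    rw [abs_le]
    constructor
    · have : m' i ≤ m i + 1 := by exact_mod_cast h2
      omega
    · have : m i ≤ m' i + 1 := by exact_mod_cast h1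
      omega
  · intro h
    refine ⟨fun i => ((max (m i) (m' i) : ℤ) : ℝ) * side k, ?_, ?_⟩ <;>
    · rw [mem_dyadicCube_iff]
      intro i
      have h2 := two_pow_mul_side k
      have e : (2 : ℝ) ^ k * (((max (m i) (m' i) : ℤ) : ℝ) * side k) = (max (m i) (m' i) : ℤ) := by
        linear_combination ((max (m i) (m' i) : ℤ) : ℝ) * h2
      rw [e]
      have := abs_le.1 (h i)
      constructor
      · exact_mod_cast (by omega)
      · exact_mod_cast (by omega)

theorem dyadicCube_subset_dilatedCube_three_iff {n : ℕ} {k : ℕ} {m m' : Fin n → ℤ} :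
    dyadicCube k m' ⊆ dilatedCube 3 k m ↔ ∀ i, |m' i - m i| ≤ 1 := by
  have h2 := two_pow_mul_side k
  constructor
  · intro h i
    have h3 := (abs_le.1 (mem_dilatedCube_iff.1 (h (corner_mem k m')) i)).1
    have h4 := (abs_le.1 (mem_dilatedCube_iff.1 (h (corner_mem' k m')) i)).2
    have h5 : (m i : ℝ) ≤ m' i + 1 := by linear_combination h3 + (m' i : ℝ) * h2
    have h6 : (m' i : ℝ) ≤ m i + 1 := by linear_combination h4 - ((m' i : ℝ) + 1) * h2
    rw [abs_le]
    constructor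
    · have : m i ≤ m' i + 1 := by exact_mod_cast h5
      omega
    · have : m' i ≤ m i + 1 := by exact_mod_cast h6
      omega
  · intro h x hx
    rw [mem_dyadicCube_iff] at hx
    rw [mem_dilatedCube_iff]
    intro i
    obtain ⟨h3, h4⟩ := abs_le.1 (h i)
    have h3' : (-1 : ℝ) ≤ m' i - m i := by exact_mod_cast h3
    have h4' : (m' i : ℝ) - m i ≤ 1 := by exact_mod_cast h4
    rw [abs_le]
    constructor <;> linarith [hx i]

theorem bounds_of_dyadicCube_subset {n : ℕ} {k j : ℕ} (hjk : j ≤ k) {m m' : Fin n → ℤ}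
    (h : dyadicCube k m ⊆ dyadicCube j m') (i : Fin n) :
    (2 : ℝ) ^ (k - j) * m' i ≤ m i ∧ (m i : ℝ) + 1 ≤ 2 ^ (k - j) * (m' i + 1) := by
  have h2 := two_pow_mul_side k
  have h3 := (mem_dyadicCube_iff.1 (h (corner_mem k m)) i).1
  have h4 := (mem_dyadicCube_iff.1 (h (corner_mem' k m)) i).2
  have e : (2 : ℝ) ^ k = 2 ^ (k - j) * 2 ^ j := by rw [← pow_add]; congr 1; omega
  have hp : (0 : ℝ) < 2 ^ (k - j) := by positivity
  constructor
  · have := mul_le_mul_of_nonneg_left h3 hp.le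
    rw [e] at h2
    linear_combination this + (m i : ℝ) * h2
  · have := mul_le_mul_of_nonneg_left h4 hp.le
    rw [e] at h2
    linear_combination this - ((m i : ℝ) + 1) * h2

/-- `x` lies in the closed `6/5`-dilation of `Q_{k,m}`. -/
def Near {n : ℕ} (k : ℕ) (m : Fin n → ℤ) (x : Fin n → ℝ) : Prop :=
  ∀ i, -1 / 10 ≤ (2 : ℝ) ^ k * x i - m i ∧ (2 : ℝ) ^ k * x i - m i ≤ 11 / 10

theorem two_pow_eq_mul {i r : ℕ} (h : r ≤ i) : (2 : ℝ) ^ i = 2 ^ (i - r) * 2 ^ r := by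
  rw [← pow_add]; congr 1; omega

theorem mem_dilatedCube_of_near {n : ℕ} {c : ℝ} (hc : 7 ≤ c) {i : ℕ} {m mQ : Fin n → ℤ}
    {x : Fin n → ℝ} (hx : Near i m x) (hQ : ∀ j, |mQ j - m j| ≤ 1) : x ∈ dilatedCube c i mQ := by
  rw [mem_dilatedCube_iff]
  intro j
  obtain ⟨h1, h2⟩ := hx j
  obtain ⟨h3, h4⟩ := abs_le.1 (hQ j)
  have h3' : (-1 : ℝ) ≤ mQ j - m j := by exact_mod_cast h3
  have h4' : (mQ j : ℝ) - m j ≤ 1 := by exact_mod_cast h4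
  rw [abs_le]
  constructor <;> linarith

/-- This is where `7` is exactly what is needed: at equal levels the two indices can differ by
three, and half a side more reaches the edge of the dilated cube. At different levels the smaller
cube is scaled by at most one half, which leaves room. -/
theorem dyadicCube_subset_dilatedCube_of_near {n : ℕ} {c : ℝ} (hc : 7 ≤ c) {i r : ℕ} (hri : r ≤ i)
    {m mQ mr m' : Fin n → ℤ} {x : Fin n → ℝ} (hx : Near i m x) (hQ : ∀ j, |mQ j - m j| ≤ 1)
    (hxr : Near r mr x) (hm' : ∀ j, |m' j - mr j| ≤ 1) :
    dyadicCube i mQ ⊆ dilatedCube c r m' := by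
  intro y hy
  rw [mem_dyadicCube_iff] at hy
  rw [mem_dilatedCube_iff]
  intro j
  obtain ⟨h1, h2⟩ := hx j
  obtain ⟨h1', h2'⟩ := hxr j
  obtain ⟨h3, h4⟩ := abs_le.1 (hQ j)
  obtain ⟨h5, h6⟩ := abs_le.1 (hm' j)
  obtain ⟨h7, h8⟩ := hy j
  rcases hri.eq_or_lt with rfl | hlt
  · have h9 : (mr j : ℝ) < m j + 2 := by linarith
    have h10 : (m j : ℝ) < mr j + 2 := by linarith
    have h9' : mr j < m j + 2 := by exact_mod_cast h9
    have h10' : m j < mr j + 2 := by exact_mod_cast h10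
    have h11 : -3 ≤ mQ j - m' j := by omega
    have h12 : mQ j - m' j ≤ 3 := by omega
    have h11' : (-3 : ℝ) ≤ mQ j - m' j := by exact_mod_cast h11
    have h12' : (mQ j : ℝ) - m' j ≤ 3 := by exact_mod_cast h12
    rw [abs_le]
    constructor <;> linarith
  · have h3' : (-1 : ℝ) ≤ mQ j - m j := by exact_mod_cast h3
    have h4' : (mQ j : ℝ) - m j ≤ 1 := by exact_mod_cast h4
    have h5' : (-1 : ℝ) ≤ m' j - mr j := by exact_mod_cast h5
    have h6' : (m' j : ℝ) - mr j ≤ 1 := by exact_mod_cast h6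
    have e := two_pow_eq_mul hri
    have ht : (2 : ℝ) ≤ 2 ^ (i - r) := by
      calc (2 : ℝ) = 2 ^ 1 := (pow_one 2).symm
        _ ≤ 2 ^ (i - r) := pow_le_pow_right₀ (by norm_num) (by omega)
    have hd : |(2 : ℝ) ^ i * y j - 2 ^ i * x j| ≤ 21 / 10 := by
      rw [abs_le]; constructor <;> linarith
    have hd' : |(2 : ℝ) ^ r * y j - 2 ^ r * x j| ≤ 21 / 20 := by
      have e2 : (2 : ℝ) ^ i * y j - 2 ^ i * x j = 2 ^ (i - r) * (2 ^ r * y j - 2 ^ r * x j) := by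
        rw [e]; ring
      rw [e2, abs_mul, abs_of_pos (by positivity)] at hd
      nlinarith [abs_nonneg ((2 : ℝ) ^ r * y j - 2 ^ r * x j)]
    obtain ⟨h9, h10⟩ := abs_le.1 hd'
    rw [abs_le]
    constructor <;> linarith

/-- A keystone ancestor of strictly lower level touches every cube of its level near `x`: the error
`11/10` is at least halved in passing to level `g`, and `11/20 + 11/10 < 2`. Consequently all bumps
of level `g` alive at `x` take part in the blending. -/
theorem abs_sub_le_one_of_near_of_subset {n : ℕ} {i g : ℕ} (hgi : g < i)
    {m mQ mg m' : Fin n → ℤ} {x : Fin n → ℝ} (hx : Near i m x) (hQ : ∀ j, |mQ j - m j| ≤ 1)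
    (hsub : dyadicCube i mQ ⊆ dyadicCube g mg) (hx' : Near g m' x) (j : Fin n) :
    |mg j - m' j| ≤ 1 := by
  obtain ⟨h1, h2⟩ := hx j
  obtain ⟨h1', h2'⟩ := hx' j
  obtain ⟨h3, h4⟩ := abs_le.1 (hQ j)
  have h3' : (-1 : ℝ) ≤ mQ j - m j := by exact_mod_cast h3
  have h4' : (mQ j : ℝ) - m j ≤ 1 := by exact_mod_cast h4
  obtain ⟨h5, h6⟩ := bounds_of_dyadicCube_subset hgi.le hsub j
  have e := two_pow_eq_mul hgi.le
  have ht : (2 : ℝ) ≤ 2 ^ (i - g) := by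
    calc (2 : ℝ) = 2 ^ 1 := (pow_one 2).symm
      _ ≤ 2 ^ (i - g) := pow_le_pow_right₀ (by norm_num) (by omega)
  rw [e] at h1 h2
  have h7 : (mg j : ℝ) - 11 / 20 ≤ 2 ^ g * x j := by
    have : (2 : ℝ) ^ (i - g) * (mg j - 2 ^ g * x j) ≤ 11 / 10 := by nlinarith
    by_contra hcon
    push Not at hcon
    nlinarith
  have h8 : 2 ^ g * x j ≤ (mg j : ℝ) + 1 + 11 / 20 := by
    have : (2 : ℝ) ^ (i - g) * (2 ^ g * x j - mg j - 1) ≤ 11 / 10 := by nlinarith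
    by_contra hcon
    push Not at hcon
    nlinarith
  have h9 : (mg j : ℝ) < m' j + 2 := by linarith
  have h10 : (m' j : ℝ) < mg j + 2 := by linarith
  have h9' : mg j < m' j + 2 := by exact_mod_cast h9
  have h10' : m' j < mg j + 2 := by exact_mod_cast h10
  rw [abs_le]; constructor <;> omega

theorem mem_dilatedCube_of_subset {n : ℕ} {c : ℝ} (hc : 1 ≤ c) {i j : ℕ} (hji : j ≤ i)
    {m m' : Fin n → ℤ} {x : Fin n → ℝ} (hx : x ∈ dilatedCube c i m)
    (hsub : dyadicCube i m ⊆ dyadicCube j m') : x ∈ dilatedCube c j m' := by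
  rw [mem_dilatedCube_iff] at hx ⊢
  intro ι
  obtain ⟨h1, h2⟩ := abs_le.1 (hx ι)
  obtain ⟨h5, h6⟩ := bounds_of_dyadicCube_subset hji hsub ι
  have e := two_pow_eq_mul hji
  have ht : (1 : ℝ) ≤ 2 ^ (i - j) := one_le_pow₀ (by norm_num)
  rw [e] at h1 h2
  set t : ℝ := 2 ^ (i - j)
  have hpos : 0 < t := by linarith
  rw [abs_le]
  constructor
  · have : 0 ≤ t * (2 ^ j * x ι - m' ι - 1 / 2 + c / 2) := by nlinarith
    linarith [nonneg_of_mul_nonneg_right this hpos]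
  · have : 0 ≤ t * (c / 2 - (2 ^ j * x ι - m' ι - 1 / 2)) := by nlinarith
    linarith [nonneg_of_mul_nonneg_right this hpos]

theorem dyadicCube_subset_dilatedCube_self {n : ℕ} {c : ℝ} (hc : 1 ≤ c) (k : ℕ) (m : Fin n → ℤ) :
    dyadicCube k m ⊆ dilatedCube c k m := by
  intro x hx
  rw [mem_dyadicCube_iff] at hx
  rw [mem_dilatedCube_iff]
  intro i
  rw [abs_le]
  constructor <;> linarith [hx i]

theorem dyadicCube_subset_dilatedCube_zero {n : ℕ} {c : ℝ} (hc : 7 ≤ c) {i : ℕ}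
    {m m' : Fin n → ℤ} (hm : (dyadicCube i m ∩ dyadicCube 0 0).Nonempty) (hm' : ∀ j, |m' j| ≤ 1) :
    dyadicCube i m ⊆ dilatedCube c 0 m' := by
  obtain ⟨z, hz, hz0⟩ := hm
  intro y hy
  change y ∈ dilatedCube c ((0 : ℕ) : ℤ) m'
  change z ∈ dyadicCube ((0 : ℕ) : ℤ) 0 at hz0
  rw [mem_dyadicCube_iff] at hy hz hz0
  rw [mem_dilatedCube_iff]
  intro j
  have h1 := hy j
  have h2 := hz j
  have h3 := hz0 j
  have h4 := hm' j
  rw [abs_le] at h4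
  have h5 : (-1 : ℝ) ≤ m' j := by exact_mod_cast h4.1
  have h6 : (m' j : ℝ) ≤ 1 := by exact_mod_cast h4.2
  have ht : (1 : ℝ) ≤ 2 ^ i := one_le_pow₀ (by norm_num)
  have h7 : y j - z j ≤ 1 := by nlinarith
  have h8 : -1 ≤ y j - z j := by nlinarith
  simp only [pow_zero, one_mul, Pi.zero_apply, Int.cast_zero] at h3 ⊢
  rw [abs_le]
  constructor <;> linarith

/-- A point near an active cube of level `i` is close to the unit cube. -/
theorem bounds_of_near {n : ℕ} {i : ℕ} {m mQ : Fin n → ℤ} {x : Fin n → ℝ} (hx : Near i m x)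
    (hQ : ∀ j, |mQ j - m j| ≤ 1) (hQ0 : (dyadicCube i mQ ∩ dyadicCube 0 0).Nonempty) (j : Fin n) :
    -(21 / 10) ≤ 2 ^ i * x j ∧ 2 ^ i * (x j - 1) ≤ 21 / 10 := by
  obtain ⟨z, hz, hz0⟩ := hQ0
  change z ∈ dyadicCube ((0 : ℕ) : ℤ) 0 at hz0
  rw [mem_dyadicCube_iff] at hz hz0
  obtain ⟨h1, h2⟩ := hx j
  have h5 := hz j
  have h6 := hz0 j
  simp only [pow_zero, one_mul, Pi.zero_apply, Int.cast_zero, zero_add] at h6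
  obtain ⟨h3, h4⟩ := abs_le.1 (hQ j)
  have h3' : (-1 : ℝ) ≤ mQ j - m j := by exact_mod_cast h3
  have h4' : (mQ j : ℝ) - m j ≤ 1 := by exact_mod_cast h4
  have ht : (0 : ℝ) < 2 ^ i := by positivity
  constructor
  · nlinarith
  · nlinarith

/-- The indices `m` with `Near k m x`. -/
noncomputable def nbr {n : ℕ} (k : ℕ) (x : Fin n → ℝ) : Finset (Fin n → ℤ) :=
  Fintype.piFinset fun i => Finset.Icc ⌈(2 : ℝ) ^ k * x i - 11 / 10⌉ ⌊(2 : ℝ) ^ k * x i + 1 / 10⌋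

theorem mem_nbr {n : ℕ} {k : ℕ} {x : Fin n → ℝ} {m : Fin n → ℤ} : m ∈ nbr k x ↔ Near k m x := by
  unfold nbr Near
  rw [Fintype.mem_piFinset]
  refine forall_congr' fun i => ?_
  rw [Finset.mem_Icc, Int.ceil_le, Int.le_floor]
  constructor <;> rintro ⟨h1, h2⟩ <;> constructor <;> linarith

/-- In each coordinate, an interval of length `6/5` contains at most two integers. -/
theorem card_nbr_le {n : ℕ} (k : ℕ) (x : Fin n → ℝ) : ((nbr k x).card : ℝ) ≤ 2 ^ n := by
  have : (nbr k x).card ≤ 2 ^ n := by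
    unfold nbr
    rw [Fintype.card_piFinset]
    refine (Finset.prod_le_pow_card _ _ 2 fun i _ => ?_).trans (by simp)
    rw [Int.card_Icc]
    have h1 := Int.le_ceil ((2 : ℝ) ^ k * x i - 11 / 10)
    have h2 := Int.floor_le ((2 : ℝ) ^ k * x i + 1 / 10)
    have h3 : ((⌊(2 : ℝ) ^ k * x i + 1 / 10⌋ : ℤ) : ℝ) < ⌈(2 : ℝ) ^ k * x i - 11 / 10⌉ + 2 := by
      linarith
    have h4 : ⌊(2 : ℝ) ^ k * x i + 1 / 10⌋ < ⌈(2 : ℝ) ^ k * x i - 11 / 10⌉ + 2 := by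
      exact_mod_cast h3
    omega
  exact_mod_cast this

/-! ### Content and keystone cubes -/

theorem dyadicCube_eq_Icc {n : ℕ} (k : ℤ) (m : Fin n → ℤ) : dyadicCube k m =
    Set.Icc (fun i => (m i : ℝ) * side k) (fun i => ((m i : ℝ) + 1) * side k) := by
  ext x
  simp only [dyadicCube, Set.mem_ofPred_eq, Set.mem_Icc, Pi.le_def, forall_and]

theorem volume_dyadicCube {n : ℕ} (k : ℤ) (m : Fin n → ℤ) :
    volume (dyadicCube k m) = ENNReal.ofReal (side k ^ (n : ℝ)) := by
  rw [dyadicCube_eq_Icc, Real.volume_Icc_pi]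
  have : ∀ i, ((m i : ℝ) + 1) * side k - m i * side k = side k := fun i => by ring
  simp_rw [this]
  rw [Finset.prod_const, Finset.card_univ, Fintype.card_fin, Real.rpow_natCast,
    ENNReal.ofReal_pow (side_pos k).le]

theorem dyadicCube_eq_dilatedCube {n : ℕ} (k : ℤ) (m : Fin n → ℤ) :
    dyadicCube k m = dilatedCube 1 k m := by
  ext x
  simp only [dyadicCube, dilatedCube, cube, Set.mem_ofPred_eq]
  refine forall_congr' fun i => and_congr ?_ ?_ <;>
  · refine Iff.of_eq (congrArg₂ _ ?_ ?_) <;> ring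

theorem content_empty {n : ℕ} (d : ℝ) : content d (∅ : Set (Fin n → ℝ)) = 0 := by
  refine le_antisymm ?_ zero_le
  refine (iInf₂_le ∅ (by simp [Nonoverlapping])).trans ((iInf_le _ (by simp)).trans ?_)
  simp

theorem nonempty_of_mem_keystone {n : ℕ} {S : Set (Fin n → ℝ)} {d lam : ℝ} (hlam : 0 < lam)
    {a : ℕ × (Fin n → ℤ)} (ha : a ∈ keystone S d lam) : (dyadicCube a.1 a.2 ∩ S).Nonempty := by
  rw [Set.nonempty_iff_ne_empty]
  intro h
  have h1 : ENNReal.ofReal (lam * side a.1 ^ d) ≤ content d (dyadicCube a.1 a.2 ∩ S) := ha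
  rw [h, content_empty, nonpos_iff_eq_zero, ENNReal.ofReal_eq_zero] at h1
  exact absurd h1 (not_le.2 (mul_pos hlam (Real.rpow_pos_of_pos (side_pos _) _)))

theorem content_le_one {n : ℕ} (d : ℝ) {E : Set (Fin n → ℝ)} (hE : E ⊆ dyadicCube 0 0) :
    content d E ≤ 1 := by
  refine (iInf₂_le {(0, 0)} (by simp [Nonoverlapping])).trans
    ((iInf_le _ (by simpa using hE)).trans ?_)
  rw [tsum_singleton ((0 : ℤ), (0 : Fin n → ℤ)) (fun a => ENNReal.ofReal (side a.1 ^ d))]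
  simp [side]

/-- A cover containing a cube of side at least one already costs at least `1`, hence at least `lam`.
In any other cover all sides are below one, and lowering the exponent from `ds` to `d` only
increases the sum. -/
theorem zero_mem_keystone {n : ℕ} {S : Set (Fin n → ℝ)} {d ds lam : ℝ} (hd : 0 < d)
    (hds : d ≤ ds) (hS : S ⊆ dyadicCube 0 0) (hlam : ENNReal.ofReal lam < content ds S) :
    ((0, 0) : ℕ × (Fin n → ℤ)) ∈ keystone S d lam := by
  change ENNReal.ofReal (lam * side ((0 : ℕ) : ℤ) ^ d) ≤ content d (dyadicCube ((0 : ℕ) : ℤ) 0 ∩ S)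
  have e : dyadicCube ((0 : ℕ) : ℤ) 0 ∩ S = S := Set.inter_eq_right.2 hS
  have e0 : side ((0 : ℕ) : ℤ) = 1 := by simp [side]
  rw [e, e0, Real.one_rpow, mul_one]
  refine le_iInf fun F => le_iInf fun hF => le_iInf fun hcov => ?_
  by_cases hbig : ∃ a ∈ F, a.1 ≤ 0
  · obtain ⟨a, haF, ha⟩ := hbig
    refine (hlam.le.trans (content_le_one ds hS)).trans ?_
    refine le_trans ?_ (ENNReal.le_tsum (⟨a, haF⟩ : F))
    rw [ENNReal.one_le_ofReal]
    refine Real.one_le_rpow ?_ hd.le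
    have := side_le_side.2 ha
    simpa [side] using this
  · push Not at hbig
    refine hlam.le.trans ?_
    refine (iInf₂_le F hF).trans ((iInf_le _ hcov).trans ?_)
    refine ENNReal.tsum_le_tsum fun a => ENNReal.ofReal_le_ofReal ?_
    refine Real.rpow_le_rpow_of_exponent_ge (side_pos _) ?_ hds
    have := side_le_side.2 (hbig a.1 a.2).le
    simpa [side] using this

/-- Either a covering cube is at least as large as `Q_{k,m}`, or all are smaller; then `d ≤ n` lets
each side to the power `d - n` be replaced by that of level `k`, and countable subadditivity of
volume applies. -/
theorem volume_le_content {n : ℕ} {d : ℝ} (hd : 0 ≤ d) (hdn : d ≤ n) {k : ℤ} {m : Fin n → ℤ}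
    {E : Set (Fin n → ℝ)} (hE : E ⊆ dyadicCube k m) :
    ENNReal.ofReal (side k ^ (d - n)) * volume E ≤ content d E := by
  refine le_iInf fun F => le_iInf fun _ => le_iInf fun hcov => ?_
  have hadd : ∀ j : ℤ, side j ^ (d - n) * side j ^ (n : ℝ) = side j ^ d := fun j => by
    rw [← Real.rpow_add (side_pos j)]; ring_nf
  by_cases hbig : ∃ a ∈ F, a.1 ≤ k
  · obtain ⟨a, haF, ha⟩ := hbig
    refine le_trans ?_ (ENNReal.le_tsum (⟨a, haF⟩ : F))
    calc _ ≤ ENNReal.ofReal (side k ^ (d - n)) * volume (dyadicCube k m) := by gcongr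
      _ = ENNReal.ofReal (side k ^ d) := by
        rw [volume_dyadicCube, ← ENNReal.ofReal_mul (Real.rpow_nonneg (side_pos k).le _), hadd]
      _ ≤ _ := ENNReal.ofReal_le_ofReal
        (Real.rpow_le_rpow (side_pos k).le (side_le_side.2 ha) hd)
  · push Not at hbig
    have hFc : F.Countable := Set.to_countable F
    calc _ ≤ ENNReal.ofReal (side k ^ (d - n)) * volume (⋃ a ∈ F, dyadicCube a.1 a.2) := by gcongr
      _ ≤ ENNReal.ofReal (side k ^ (d - n)) * ∑' a : F, volume (dyadicCube a.1.1 a.1.2) := by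
        gcongr
        exact measure_biUnion_le _ hFc _
      _ = ∑' a : F, ENNReal.ofReal (side k ^ (d - n)) * volume (dyadicCube a.1.1 a.1.2) :=
        ENNReal.tsum_mul_left.symm
      _ ≤ _ := by
        refine ENNReal.tsum_le_tsum fun a => ?_
        rw [volume_dyadicCube, ← ENNReal.ofReal_mul (Real.rpow_nonneg (side_pos k).le _)]
        refine ENNReal.ofReal_le_ofReal ?_
        rw [← hadd a.1.1]
        refine mul_le_mul_of_nonneg_right ?_ (Real.rpow_nonneg (side_pos _).le _)
        exact Real.rpow_le_rpow_of_nonpos (side_pos _) (side_le_side.2 (hbig a.1 a.2).le)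
          (by linarith)

theorem mem_levelTilde_iff {n : ℕ} {S : Set (Fin n → ℝ)} {d lam : ℝ} {k : ℕ}
    {m : Fin n → ℤ} :
    m ∈ levelTilde S d lam k ↔ ∃ m', (k, m') ∈ keystone S d lam ∧ ∀ i, |m' i - m i| ≤ 1 := by
  constructor
  · rintro ⟨m', h, h'⟩
    exact ⟨m', h, dyadicCube_inter_nonempty_iff.1 h'⟩
  · rintro ⟨m', h, h'⟩
    exact ⟨m', h, dyadicCube_inter_nonempty_iff.2 h'⟩

theorem bounds_of_mem_keystone {n : ℕ} {S : Set (Fin n → ℝ)} {d lam : ℝ} (hlam : 0 < lam)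
    (hS : S ⊆ dyadicCube 0 0) {k : ℕ} {m : Fin n → ℤ} (hm : (k, m) ∈ keystone S d lam)
    (i : Fin n) : -1 ≤ m i ∧ m i ≤ 2 ^ k := by
  obtain ⟨z, hz, hzS⟩ := nonempty_of_mem_keystone hlam hm
  have hz0 : z ∈ dyadicCube ((0 : ℕ) : ℤ) 0 := hS hzS
  rw [mem_dyadicCube_iff] at hz hz0
  have h1 := hz i
  have h2 := hz0 i
  simp only [pow_zero, one_mul, Pi.zero_apply, Int.cast_zero, zero_add] at h2
  have ht : (0 : ℝ) < 2 ^ k := by positivity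
  have h3 : (-1 : ℝ) ≤ m i := by nlinarith
  have h4 : (m i : ℝ) ≤ 2 ^ k := by nlinarith
  exact ⟨by exact_mod_cast h3, by exact_mod_cast h4⟩

theorem finite_levelTilde {n : ℕ} {S : Set (Fin n → ℝ)} {d lam : ℝ} (hlam : 0 < lam)
    (hS : S ⊆ dyadicCube 0 0) (k : ℕ) : (levelTilde S d lam k).Finite := by
  refine (Set.finite_Icc (fun _ : Fin n => (-2 : ℤ)) (fun _ => 2 ^ k + 1)).subset ?_
  intro m hm
  obtain ⟨m', h1, h2⟩ := mem_levelTilde_iff.1 hm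
  rw [Set.mem_Icc, Pi.le_def, Pi.le_def]
  refine ⟨fun i => ?_, fun i => ?_⟩ <;>
  · have h3 := bounds_of_mem_keystone hlam hS h1 i
    have h4 := abs_le.1 (h2 i)
    omega

theorem mem_keystoneNeighbors_iff {n : ℕ} {S : Set (Fin n → ℝ)} {d lam : ℝ} {k : ℕ}
    {m m' : Fin n → ℤ} : m' ∈ keystoneNeighbors S d lam k m ↔
      (∀ i, |m' i - m i| ≤ 1) ∧ (k, m') ∈ keystone S d lam := by
  unfold keystoneNeighbors
  rw [Set.mem_ofPred_eq, dyadicCube_subset_dilatedCube_three_iff]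
  rfl

theorem finite_keystoneNeighbors {n : ℕ} {S : Set (Fin n → ℝ)} {d lam : ℝ} {k : ℕ}
    {m : Fin n → ℤ} : (keystoneNeighbors S d lam k m).Finite := by
  refine (Set.finite_Icc (fun i => m i - 1) (fun i => m i + 1)).subset ?_
  intro m' hm'
  have h := (mem_keystoneNeighbors_iff.1 hm').1
  rw [Set.mem_Icc, Pi.le_def, Pi.le_def]
  refine ⟨fun i => ?_, fun i => ?_⟩ <;>
  · have h4 := abs_le.1 (h i)
    omega

/-! ### Frostman sequences -/

section Frostman

variable {n : ℕ} {S : Set (Fin n → ℝ)} {d lam C₁ C₂ C₃ : ℝ} {μ : ℕ → Measure (Fin n → ℝ)}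

theorem IsFrostman.measure_compl (hμ : IsFrostman S d C₁ C₂ C₃ μ) (k : ℕ) : μ k Sᶜ = 0 := by
  rw [← hμ.support_eq k]; exact Measure.measure_compl_support

theorem IsFrostman.measure_dyadicCube_le (hμ : IsFrostman S d C₁ C₂ C₃ μ) (k : ℕ)
    (m : Fin n → ℤ) : μ k (dyadicCube k m) ≤ ENNReal.ofReal (C₁ * side k ^ d) := by
  rw [dyadicCube_eq_dilatedCube, dilatedCube, one_mul]
  exact hμ.upper k _ _ (side_pos k) le_rfl

theorem IsFrostman.isFiniteMeasure (hμ : IsFrostman S d C₁ C₂ C₃ μ) (hS : S ⊆ dyadicCube 0 0)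
    (k : ℕ) : IsFiniteMeasure (μ k) := by
  have h0 : IsFiniteMeasure (μ 0) := by
    refine ⟨?_⟩
    calc μ 0 Set.univ ≤ μ 0 (dyadicCube ((0 : ℕ) : ℤ) 0) + μ 0 Sᶜ := by
          rw [← Set.compl_union_self S]
          exact (measure_union_le _ _).trans (by
            rw [add_comm]; gcongr; exact hS)
      _ < ⊤ := by
          rw [hμ.measure_compl, add_zero]
          exact (hμ.measure_dyadicCube_le 0 0).trans_lt ENNReal.ofReal_lt_top
  obtain ⟨w, -, hB, hw, -⟩ := hμ.weights
  obtain ⟨B, hB⟩ := hB k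
  rw [hw k]
  refine isFiniteMeasure_withDensity ?_
  refine ne_of_lt ?_
  calc ∫⁻ x, (w k x : ℝ≥0∞) ∂(μ 0) ≤ ∫⁻ _, (B : ℝ≥0∞) ∂(μ 0) :=
        lintegral_mono_ae (hB.mono fun x hx => by exact_mod_cast hx)
    _ < ⊤ := by
      rw [lintegral_const]
      exact ENNReal.mul_lt_top ENNReal.coe_lt_top (measure_lt_top _ _)

theorem IsFrostman.exists_le_smul (hμ : IsFrostman S d C₁ C₂ C₃ μ) (k : ℕ) :
    ∃ B : ℝ≥0, μ k ≤ (B : ℝ≥0∞) • μ 0 := by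
  obtain ⟨w, -, hB, hw, -⟩ := hμ.weights
  obtain ⟨B, hB⟩ := hB k
  refine ⟨B, ?_⟩
  rw [hw k, ← withDensity_const]
  exact withDensity_mono (hB.mono fun x hx => ENNReal.coe_le_coe.2 hx)

/-- The weight condition is used between levels `0` and `k`. The constant involves the supremum of
`w₀`, so it is not uniform over Frostman sequences; it serves only for almost everywhere convergence
and never enters the norm estimate. -/
theorem IsFrostman.exists_le_smul_pow (hμ : IsFrostman S d C₁ C₂ C₃ μ) (hC₃ : 0 < C₃) :
    ∃ B : ℝ, 0 < B ∧ ∀ k, 1 ≤ k → μ k ≤ ENNReal.ofReal (B * side k ^ (d - n)) • μ 0 := by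
  obtain ⟨w, -, hB, hw, hww⟩ := hμ.weights
  obtain ⟨B, hB⟩ := hB 0
  refine ⟨(B + 1) * C₃, by positivity, fun k hk => ?_⟩
  rw [hw k, ← withDensity_const]
  refine withDensity_mono ?_
  filter_upwards [hB, hww 0 k hk] with x h1 h2
  have h3 := h2.1
  rw [zero_add] at h3
  have h4 : (2 : ℝ) ^ ((d - n) * k) = (side k ^ (d - n))⁻¹ := by
    rw [side, mul_comm, Real.rpow_mul (by norm_num), Real.rpow_natCast, zpow_neg, zpow_natCast,
      Real.inv_rpow (by positivity), inv_inv]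
  rw [h4] at h3
  have hs : 0 < side k ^ (d - n) := Real.rpow_pos_of_pos (side_pos _) _
  have h1' : (w 0 x : ℝ) ≤ B := by exact_mod_cast h1
  have h5 : (w k x : ℝ) ≤ (B + 1) * C₃ * side k ^ (d - n) := by
    have e : (w k x : ℝ) = (1 / C₃ * (side k ^ (d - n))⁻¹ * w k x) * (C₃ * side k ^ (d - n)) := by
      field_simp
    rw [e]
    calc _ ≤ ((B : ℝ) + 1) * (C₃ * side k ^ (d - n)) := by gcongr; linarith
      _ = _ := by ring
  rw [← ENNReal.ofReal_coe_nnreal]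
  exact ENNReal.ofReal_le_ofReal h5

theorem IsFrostman.le_measure_of_mem_keystone (hμ : IsFrostman S d C₁ C₂ C₃ μ) (hC₂ : 0 < C₂)
    {k : ℕ} {m : Fin n → ℤ} (hm : (k, m) ∈ keystone S d lam) :
    ENNReal.ofReal (C₂ * lam * side k ^ d) ≤ μ k (dyadicCube k m) := by
  have h1 : ENNReal.ofReal (lam * side k ^ d) ≤ content d (dyadicCube k m ∩ S) := hm
  calc _ = ENNReal.ofReal C₂ * ENNReal.ofReal (lam * side k ^ d) := by
        rw [← ENNReal.ofReal_mul hC₂.le, mul_assoc]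
    _ ≤ ENNReal.ofReal C₂ * content d (dyadicCube k m ∩ S) := by gcongr
    _ ≤ _ := hμ.lower k m
    _ ≤ _ := measure_mono Set.inter_subset_left

theorem IsFrostman.measure_ne_zero (hμ : IsFrostman S d C₁ C₂ C₃ μ) (hC₂ : 0 < C₂)
    (hlam : 0 < lam) {k : ℕ} {m : Fin n → ℤ} (hm : (k, m) ∈ keystone S d lam) :
    μ k (dyadicCube k m) ≠ 0 := by
  refine (lt_of_lt_of_le ?_ (hμ.le_measure_of_mem_keystone hC₂ hm)).ne'
  rw [ENNReal.ofReal_pos]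
  have := Real.rpow_pos_of_pos (side_pos k) d
  positivity

variable {f : S → EReal}

theorem measurable_realPart (hS : MeasurableSet S) (hf : Measurable f) :
    Measurable (realPart f) := by
  classical
  unfold realPart
  exact Measurable.dite (s := S) (hf.ereal_toReal) measurable_const hS

theorem enorm_realPart_le (x : Fin n → ℝ) : ‖realPart f x‖ₑ ≤ absVal f x := by
  unfold realPart absVal
  split_ifs with h
  · induction f ⟨x, h⟩ with
    | bot => simp
    | top => simp
    | coe r =>
      rw [EReal.toReal_coe, EReal.abs_def, Real.enorm_eq_ofReal_abs]
  · simp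

theorem memLp_realPart {p : ℝ≥0∞} (hS : MeasurableSet S) (hf : Measurable f)
    (h : eLpNorm (absVal f) p (μ 0) < ⊤) : MemLp (realPart f) p (μ 0) :=
  ⟨(measurable_realPart hS hf).aestronglyMeasurable,
    (eLpNorm_mono_enorm fun x => by simpa using enorm_realPart_le x).trans_lt h⟩

theorem integrable_realPart (hμ : IsFrostman S d C₁ C₂ C₃ μ) (hS : S ⊆ dyadicCube 0 0)
    {p : ℝ≥0∞} (hp : 1 ≤ p) (h : MemLp (realPart f) p (μ 0)) (k : ℕ) :
    Integrable (realPart f) (μ k) := by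
  have := hμ.isFiniteMeasure hS 0
  obtain ⟨B, hB⟩ := hμ.exists_le_smul k
  exact ((h.integrable hp).smul_measure ENNReal.coe_ne_top).mono_measure hB

end Frostman

/-! ### Partitions of unity -/

section Bump

variable {n : ℕ} {ψ : ℝ → ℝ}

theorem IsProfile.nonneg (hψ : IsProfile ψ) (t : ℝ) : 0 ≤ ψ t :=
  (Set.indicator_nonneg (fun _ _ => zero_le_one) t).trans (hψ.lower t)

theorem IsProfile.eq_zero (hψ : IsProfile ψ) {t : ℝ} (ht : t ∉ Set.Icc (-1 / 10 : ℝ) (11 / 10)) :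
    ψ t = 0 :=
  le_antisymm ((hψ.upper t).trans (by rw [Set.indicator_of_notMem ht])) (hψ.nonneg t)

theorem bump_nonneg (hψ : IsProfile ψ) (k : ℕ) (m : Fin n → ℤ) (x : Fin n → ℝ) :
    0 ≤ bump ψ k m x :=
  Finset.prod_nonneg fun _ _ => hψ.nonneg _

theorem bump_eq_zero (hψ : IsProfile ψ) {k : ℕ} {m : Fin n → ℤ} {x : Fin n → ℝ}
    (h : ¬Near k m x) : bump ψ k m x = 0 := by
  unfold Near at h
  push Not at h
  obtain ⟨i, hi⟩ := h
  refine Finset.prod_eq_zero (Finset.mem_univ i) (hψ.eq_zero fun h' => ?_)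
  exact absurd h'.2 (not_le.2 (hi h'.1))

theorem sum_nbr_bump (hψ : IsProfile ψ) (k : ℕ) (x : Fin n → ℝ) :
    ∑ m ∈ nbr k x, bump ψ k m x = 1 := by
  unfold nbr bump
  rw [← Finset.prod_univ_sum
    (fun i => Finset.Icc ⌈(2 : ℝ) ^ k * x i - 11 / 10⌉ ⌊(2 : ℝ) ^ k * x i + 1 / 10⌋)
    (fun i (j : ℤ) => ψ (2 ^ k * x i - j))]
  refine Finset.prod_eq_one fun i _ => ?_
  refine (hasSum_sum_of_ne_finset_zero fun j hj => hψ.eq_zero fun h => hj ?_).unique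
    (hψ.sum_eq_one (2 ^ k * x i))
  rw [Finset.mem_Icc, Int.ceil_le, Int.le_floor]
  constructor <;> linarith [h.1, h.2]

theorem sum_bump_le_one (hψ : IsProfile ψ) (k : ℕ) (T : Finset (Fin n → ℤ)) (x : Fin n → ℝ) :
    ∑ m ∈ T, bump ψ k m x ≤ 1 := by
  classical
  rw [← sum_nbr_bump hψ k x, ← Finset.sum_filter_of_ne (p := fun m => Near k m x)
    fun m _ hm => not_not.1 fun h => hm (bump_eq_zero hψ h)]
  refine Finset.sum_le_sum_of_subset_of_nonneg (fun m hm => ?_) fun m _ _ => bump_nonneg hψ k m x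
  exact mem_nbr.2 (Finset.mem_filter.1 hm).2

theorem sum_bump_eq_one (hψ : IsProfile ψ) {k : ℕ} {T : Finset (Fin n → ℤ)} {x : Fin n → ℝ}
    (hT : ∀ m, Near k m x → m ∈ T) : ∑ m ∈ T, bump ψ k m x = 1 := by
  rw [← sum_nbr_bump hψ k x]
  refine (Finset.sum_subset (fun m hm => hT m (mem_nbr.1 hm)) fun m _ hm => ?_).symm
  exact bump_eq_zero hψ fun h => hm (mem_nbr.2 h)

theorem contDiff_bump (hψ : IsProfile ψ) (k : ℕ) (m : Fin n → ℤ) : ContDiff ℝ ∞ (bump ψ k m) := by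
  unfold bump
  have := hψ.smooth
  exact contDiff_prod fun i _ => this.comp ((contDiff_const.mul (contDiff_apply ℝ ℝ i)).sub
    contDiff_const)

theorem differentiable_bump (hψ : IsProfile ψ) (k : ℕ) (m : Fin n → ℤ) :
    Differentiable ℝ (bump ψ k m) :=
  (contDiff_bump hψ k m).differentiable (by simp)

theorem isClosed_near (k : ℕ) (m : Fin n → ℤ) : IsClosed {x | Near k m x} := by
  have : {x : Fin n → ℝ | Near k m x} = ⋂ i, {x | -1 / 10 ≤ (2 : ℝ) ^ k * x i - m i ∧
      (2 : ℝ) ^ k * x i - m i ≤ 11 / 10} := by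
    ext x; simp [Near]
  rw [this]
  refine isClosed_iInter fun i => ?_
  have h : Continuous fun x : Fin n → ℝ => (2 : ℝ) ^ k * x i - m i := by fun_prop
  exact (isClosed_le continuous_const h).inter (isClosed_le h continuous_const)

theorem tsupport_bump_subset (hψ : IsProfile ψ) (k : ℕ) (m : Fin n → ℤ) :
    tsupport (bump ψ k m) ⊆ {x | Near k m x} :=
  closure_minimal (fun _ hx => not_not.1 fun h => hx (bump_eq_zero hψ h)) (isClosed_near k m)

theorem hasCompactSupport_bump (hψ : IsProfile ψ) (k : ℕ) (m : Fin n → ℤ) :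
    HasCompactSupport (bump ψ k m) := by
  refine HasCompactSupport.of_support_subset_isCompact (K := Set.Icc
    (fun i => ((2 : ℝ) ^ k)⁻¹ * (m i - 1 / 10)) (fun i => ((2 : ℝ) ^ k)⁻¹ * (m i + 11 / 10)))
    isCompact_Icc ?_
  intro x hx
  have h : Near k m x := not_not.1 fun h => hx (bump_eq_zero hψ h)
  have h2 : (0 : ℝ) < 2 ^ k := by positivity
  rw [Set.mem_Icc, Pi.le_def, Pi.le_def]
  refine ⟨fun i => ?_, fun i => ?_⟩
  · rw [inv_mul_le_iff₀ h2]; linarith [(h i).1]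
  · rw [le_inv_mul_iff₀ h2]; linarith [(h i).2]

theorem fderiv_bump_eq_zero (hψ : IsProfile ψ) {k : ℕ} {m : Fin n → ℤ} {x : Fin n → ℝ}
    (h : ¬Near k m x) : fderiv ℝ (bump ψ k m) x = 0 :=
  fderiv_of_notMem_tsupport ℝ fun hx => h (tsupport_bump_subset hψ k m hx)

/-- All bumps are rescaled translates of a single smooth compactly supported one; the dilation
produces the factor `2 ^ k`. -/
theorem exists_norm_fderiv_bump_le (n : ℕ) (hψ : IsProfile ψ) :
    ∃ K : ℝ, 0 < K ∧ ∀ (k : ℕ) (m : Fin n → ℤ) (x : Fin n → ℝ),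
      ‖fderiv ℝ (bump ψ k m) x‖ ≤ K * 2 ^ k := by
  obtain ⟨K, hK⟩ := ((contDiff_bump (n := n) hψ 0 0).continuous_fderiv
    (by simp)).bounded_above_of_compact_support
    ((hasCompactSupport_bump (n := n) hψ 0 0).fderiv ℝ)
  refine ⟨|K| + 1, by positivity, fun k m x => ?_⟩
  have e : bump ψ k m = fun x => bump ψ 0 (0 : Fin n → ℤ) ((2 : ℝ) ^ k • x - fun i => (m i : ℝ)) := by
    ext x; simp [bump]
  have h1 : HasFDerivAt (fun x : Fin n → ℝ => (2 : ℝ) ^ k • x - fun i => (m i : ℝ))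
      ((2 : ℝ) ^ k • ContinuousLinearMap.id ℝ (Fin n → ℝ)) x :=
    ((hasFDerivAt_id x).const_smul ((2 : ℝ) ^ k)).sub_const (fun i => (m i : ℝ))
  have h2 := ((differentiable_bump (n := n) hψ 0 0)
    ((2 : ℝ) ^ k • x - fun i => (m i : ℝ))).hasFDerivAt.comp x h1
  rw [e, show (fun x => bump ψ 0 (0 : Fin n → ℤ) ((2 : ℝ) ^ k • x - fun i => (m i : ℝ))) =
    bump ψ 0 (0 : Fin n → ℤ) ∘ (fun x : Fin n → ℝ => (2 : ℝ) ^ k • x - fun i => (m i : ℝ)) from rfl,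
    h2.fderiv, ContinuousLinearMap.comp_smul, norm_smul, ContinuousLinearMap.comp_id, mul_comm]
  have h3 := (hK ((2 : ℝ) ^ k • x - fun i => (m i : ℝ))).trans (le_abs_self K)
  rw [norm_pow, Real.norm_ofNat]
  gcongr
  linarith

theorem sum_le_of_near {k : ℕ} {T : Finset (Fin n → ℤ)} {x : Fin n → ℝ} {a : (Fin n → ℤ) → ℝ}
    {A : ℝ} (hA : 0 ≤ A) (ha : ∀ m ∈ T, Near k m x → a m ≤ A) (ha' : ∀ m, ¬Near k m x → a m = 0) :
    ∑ m ∈ T, a m ≤ 2 ^ n * A := by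
  classical
  rw [← Finset.sum_filter_of_ne (p := fun m => Near k m x)
    fun m _ hm => not_not.1 fun h => hm (ha' m h)]
  calc _ ≤ ∑ m ∈ T.filter (fun m => Near k m x), A :=
        Finset.sum_le_sum fun m hm => ha m (Finset.mem_filter.1 hm).1 (Finset.mem_filter.1 hm).2
    _ = (T.filter (fun m => Near k m x)).card * A := by rw [Finset.sum_const, nsmul_eq_mul]
    _ ≤ 2 ^ n * A := by
      gcongr
      refine le_trans ?_ (card_nbr_le k x)
      exact_mod_cast Finset.card_le_card fun m hm => mem_nbr.2 (Finset.mem_filter.1 hm).2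

/-! ### One step of the approximating sequence -/

/-- Replaces `g` by the coefficients `c m` near the cubes `Q_{k,m}`, `m ∈ T`. -/
noncomputable def blend (ψ : ℝ → ℝ) (k : ℕ) (T : Finset (Fin n → ℤ)) (c : (Fin n → ℤ) → ℝ)
    (g : (Fin n → ℝ) → ℝ) (x : Fin n → ℝ) : ℝ :=
  g x + ∑ m ∈ T, bump ψ k m x * (c m - g x)

variable {k : ℕ} {T : Finset (Fin n → ℤ)} {c : (Fin n → ℤ) → ℝ} {g : (Fin n → ℝ) → ℝ}
  {x : Fin n → ℝ} {q ε K : ℝ}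

theorem contDiff_blend (hψ : IsProfile ψ) (hg : ContDiff ℝ ∞ g) :
    ContDiff ℝ ∞ (blend ψ k T c g) :=
  hg.add (ContDiff.sum fun m _ => (contDiff_bump hψ k m).mul (contDiff_const.sub hg))

theorem hasCompactSupport_blend (hψ : IsProfile ψ) (hg : HasCompactSupport g) :
    HasCompactSupport (blend ψ k T c g) := by
  refine hg.add ?_
  induction T using Finset.cons_induction with
  | empty =>
    simp_rw [Finset.sum_empty]
    exact HasCompactSupport.zero
  | cons m T hm ih =>
    simp_rw [Finset.sum_cons]
    exact (hasCompactSupport_bump hψ k m).mul_right.add ih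

theorem blend_eq_self (hψ : IsProfile ψ) (h : ∀ m ∈ T, ¬Near k m x) :
    blend ψ k T c g x = g x := by
  unfold blend
  rw [Finset.sum_eq_zero, add_zero]
  intro m hm
  rw [bump_eq_zero hψ (h m hm), zero_mul]

/-- The blended value is a convex combination of the old value and the coefficients, so closeness to
a reference value `q` is preserved. -/
theorem blend_sub (q : ℝ) : blend ψ k T c g x - q = (1 - ∑ m ∈ T, bump ψ k m x) * (g x - q) +
    ∑ m ∈ T, bump ψ k m x * (c m - q) := by
  have : ∑ m ∈ T, bump ψ k m x * (c m - g x) =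
      ∑ m ∈ T, bump ψ k m x * (c m - q) - (∑ m ∈ T, bump ψ k m x) * (g x - q) := by
    rw [Finset.sum_mul, ← Finset.sum_sub_distrib]
    exact Finset.sum_congr rfl fun m _ => by ring
  rw [blend, this]; ring

theorem abs_sum_bump_mul_le (hψ : IsProfile ψ) {a : (Fin n → ℤ) → ℝ}
    (ha : ∀ m ∈ T, Near k m x → |a m| ≤ ε) :
    |∑ m ∈ T, bump ψ k m x * a m| ≤ (∑ m ∈ T, bump ψ k m x) * ε := by
  rw [Finset.sum_mul]
  refine (Finset.abs_sum_le_sum_abs _ _).trans (Finset.sum_le_sum fun m hm => ?_)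
  rw [abs_mul, abs_of_nonneg (bump_nonneg hψ k m x)]
  by_cases hn : Near k m x
  · exact mul_le_mul_of_nonneg_left (ha m hm hn) (bump_nonneg hψ k m x)
  · rw [bump_eq_zero hψ hn, zero_mul, zero_mul]

theorem abs_blend_sub_le (hψ : IsProfile ψ) (hg : |g x - q| ≤ ε)
    (hc : ∀ m ∈ T, Near k m x → |c m - q| ≤ ε) : |blend ψ k T c g x - q| ≤ ε := by
  rw [blend_sub]
  have h1 := sum_bump_le_one hψ k T x
  refine (abs_add_le _ _).trans ?_
  have h2 := abs_sum_bump_mul_le hψ hc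
  rw [abs_mul, abs_of_nonneg (sub_nonneg.2 h1)]
  have h3 := mul_le_mul_of_nonneg_left hg (sub_nonneg.2 h1)
  linarith

theorem abs_blend_sub_le_of_full (hψ : IsProfile ψ) (hT : ∀ m, Near k m x → m ∈ T)
    (hc : ∀ m ∈ T, Near k m x → |c m - q| ≤ ε) : |blend ψ k T c g x - q| ≤ ε := by
  rw [blend_sub, sum_bump_eq_one hψ hT, sub_self, zero_mul, zero_add]
  simpa only [sum_bump_eq_one hψ hT, one_mul] using abs_sum_bump_mul_le hψ hc

theorem hasFDerivAt_blend (hψ : IsProfile ψ) (hg : DifferentiableAt ℝ g x) :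
    HasFDerivAt (blend ψ k T c g) ((1 - ∑ m ∈ T, bump ψ k m x) • fderiv ℝ g x +
      ∑ m ∈ T, (c m - g x) • fderiv ℝ (bump ψ k m) x) x := by
  have h1 : ∀ m ∈ T, HasFDerivAt (fun y => bump ψ k m y * (c m - g y))
      (bump ψ k m x • (-fderiv ℝ g x) + (c m - g x) • fderiv ℝ (bump ψ k m) x) x := fun m _ =>
    (differentiable_bump hψ k m x).hasFDerivAt.mul (hg.hasFDerivAt.const_sub (c m))
  refine (hg.hasFDerivAt.add (HasFDerivAt.fun_sum h1)).congr_fderiv ?_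
  rw [Finset.sum_add_distrib, ← Finset.sum_smul]
  ext v
  simp only [add_apply, smul_apply,
    neg_apply, smul_eq_mul]
  ring

theorem fderiv_blend_eq_self (hψ : IsProfile ψ) (hg : DifferentiableAt ℝ g x)
    (h : ∀ m ∈ T, ¬Near k m x) : fderiv ℝ (blend ψ k T c g) x = fderiv ℝ g x := by
  rw [(hasFDerivAt_blend hψ hg).fderiv, Finset.sum_eq_zero fun m hm => bump_eq_zero hψ (h m hm),
    Finset.sum_eq_zero fun m hm => by rw [fderiv_bump_eq_zero hψ (h m hm), smul_zero]]
  simp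

theorem norm_sum_smul_fderiv_bump_le (hψ : IsProfile ψ) (hK : 0 ≤ K)
    (hb : ∀ m : Fin n → ℤ, ‖fderiv ℝ (bump ψ k m) x‖ ≤ K * 2 ^ k) {a : (Fin n → ℤ) → ℝ}
    (hε : 0 ≤ ε) (ha : ∀ m ∈ T, Near k m x → |a m| ≤ ε) :
    ‖∑ m ∈ T, a m • fderiv ℝ (bump ψ k m) x‖ ≤ 2 ^ n * (K * 2 ^ k * ε) := by
  refine (norm_sum_le _ _).trans (sum_le_of_near (k := k) (x := x) (by positivity)
    (fun m hm hn => ?_) fun m hn => ?_)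
  · rw [norm_smul, mul_comm]
    exact mul_le_mul (hb m) (ha m hm hn) (abs_nonneg _) (by positivity)
  · rw [fderiv_bump_eq_zero hψ hn, smul_zero, norm_zero]

/-- The old gradient is multiplied by a number in `[0, 1]`; the new terms are at most `2 ^ n` bump
gradients times `|c m - g x| ≤ 2 * ε`. -/
theorem norm_fderiv_blend_le (hψ : IsProfile ψ) (hg : DifferentiableAt ℝ g x) (hK : 0 ≤ K)
    (hb : ∀ m : Fin n → ℤ, ‖fderiv ℝ (bump ψ k m) x‖ ≤ K * 2 ^ k) (hgq : |g x - q| ≤ ε)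
    (hc : ∀ m ∈ T, Near k m x → |c m - q| ≤ ε) :
    ‖fderiv ℝ (blend ψ k T c g) x‖ ≤ ‖fderiv ℝ g x‖ + 2 ^ n * (K * 2 ^ k * (2 * ε)) := by
  rw [(hasFDerivAt_blend hψ hg).fderiv]
  have hε : 0 ≤ ε := (abs_nonneg _).trans hgq
  have h0 : 0 ≤ ∑ m ∈ T, bump ψ k m x := Finset.sum_nonneg fun m _ => bump_nonneg hψ k m x
  have h1 := sum_bump_le_one hψ k T x
  refine (norm_add_le _ _).trans (add_le_add ?_ ?_)
  · rw [norm_smul, Real.norm_of_nonneg (sub_nonneg.2 h1)]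
    exact mul_le_of_le_one_left (norm_nonneg _) (by linarith)
  · refine norm_sum_smul_fderiv_bump_le hψ hK hb (by positivity) fun m hm hn => ?_
    calc |c m - g x| = |(c m - q) - (g x - q)| := by ring_nf
      _ ≤ |c m - q| + |g x - q| := abs_sub _ _
      _ ≤ 2 * ε := by linarith [hc m hm hn]

/-- When the bumps in `T` sum to one at `x`, the old gradient drops out. Their sum is maximal at
`x`, so its derivative vanishes there and `g x` may be replaced by `q`: no information on `g` beyond
differentiability is needed. -/
theorem norm_fderiv_blend_le_of_full (hψ : IsProfile ψ) (hg : DifferentiableAt ℝ g x) (hK : 0 ≤ K)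
    (hb : ∀ m : Fin n → ℤ, ‖fderiv ℝ (bump ψ k m) x‖ ≤ K * 2 ^ k)
    (hT : ∀ m, Near k m x → m ∈ T) (hε : 0 ≤ ε) (hc : ∀ m ∈ T, Near k m x → |c m - q| ≤ ε) :
    ‖fderiv ℝ (blend ψ k T c g) x‖ ≤ 2 ^ n * (K * 2 ^ k * ε) := by
  have hs : ∑ m ∈ T, fderiv ℝ (bump ψ k m) x = 0 := by
    have h1 : IsLocalMax (fun y => ∑ m ∈ T, bump ψ k m y) x := Eventually.of_forall fun y => by
      change _ ≤ ∑ m ∈ T, bump ψ k m x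
      rw [sum_bump_eq_one hψ hT]
      exact sum_bump_le_one hψ k T y
    rw [← h1.fderiv_eq_zero, fderiv_fun_sum fun m _ => differentiable_bump hψ k m x]
  rw [(hasFDerivAt_blend hψ hg).fderiv, sum_bump_eq_one hψ hT, sub_self, zero_smul, zero_add]
  have e : ∑ m ∈ T, (c m - g x) • fderiv ℝ (bump ψ k m) x =
      ∑ m ∈ T, (c m - q) • fderiv ℝ (bump ψ k m) x := by
    have : ∀ m ∈ T, (c m - g x) • fderiv ℝ (bump ψ k m) x =
        (c m - q) • fderiv ℝ (bump ψ k m) x + (q - g x) • fderiv ℝ (bump ψ k m) x := fun m _ => by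
      rw [← add_smul]; congr 1; ring
    rw [Finset.sum_congr rfl this, Finset.sum_add_distrib, ← Finset.smul_sum, hs, smul_zero,
      add_zero]
  rw [e]
  exact norm_sum_smul_fderiv_bump_le hψ hK hb hε hc

end Bump

/-! ### The approximating sequence -/

section Approx

variable {n : ℕ} {ψ : ℝ → ℝ} {S : Set (Fin n → ℝ)} {d lam : ℝ} {μ : ℕ → Measure (Fin n → ℝ)}
  {f : S → EReal}

theorem approxSeq_succ (hlam : 0 < lam) (hS : S ⊆ dyadicCube 0 0) (k : ℕ) :
    approxSeq ψ μ d lam f (k + 1) = blend ψ (k + 1)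
      (finite_levelTilde (d := d) hlam hS (k + 1)).toFinset (coeff μ d lam f (k + 1))
      (approxSeq ψ μ d lam f k) := by
  ext x
  change approxSeq ψ μ d lam f k x + ∑ᶠ m ∈ levelTilde S d lam (k + 1),
    bump ψ (k + 1) m x * (coeff μ d lam f (k + 1) m - approxSeq ψ μ d lam f k x) = _
  rw [finsum_mem_eq_finite_toFinset_sum _ (finite_levelTilde hlam hS (k + 1))]
  rfl

/-- The indices of the unit cubes contained in `3 Q_{0,0}`. -/
noncomputable def unitNbr (n : ℕ) : Finset (Fin n → ℤ) := Finset.Icc (fun _ => -1) fun _ => 1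

theorem mem_unitNbr {n : ℕ} {m : Fin n → ℤ} : m ∈ unitNbr n ↔ ∀ i, |m i| ≤ 1 := by
  unfold unitNbr
  rw [Finset.mem_Icc, Pi.le_def, Pi.le_def]
  simp only [abs_le, forall_and]

theorem approxSeq_zero : approxSeq ψ μ d lam f 0 = blend ψ 0 (unitNbr n)
    (fun _ => coeff μ d lam f 0 0) 0 := by
  have e : {m : Fin n → ℤ | dyadicCube 0 m ⊆ dilatedCube 3 0 (0 : Fin n → ℤ)} = ↑(unitNbr n) := by
    ext m
    rw [Finset.mem_coe, mem_unitNbr]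
    refine (dyadicCube_subset_dilatedCube_three_iff (k := 0) (m := 0) (m' := m)).trans ?_
    simp
  ext x
  rw [approxSeq, e]
  beta_reduce
  rw [finsum_mem_coe_finset, blend]
  simp

theorem contDiff_approxSeq (hψ : IsProfile ψ) (hlam : 0 < lam) (hS : S ⊆ dyadicCube 0 0) (k : ℕ) :
    ContDiff ℝ ∞ (approxSeq ψ μ d lam f k) := by
  induction k with
  | zero => rw [approxSeq_zero]; exact contDiff_blend hψ contDiff_const
  | succ k ih => rw [approxSeq_succ hlam hS]; exact contDiff_blend hψ ih

theorem hasCompactSupport_approxSeq (hψ : IsProfile ψ) (hlam : 0 < lam) (hS : S ⊆ dyadicCube 0 0)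
    (k : ℕ) : HasCompactSupport (approxSeq ψ μ d lam f k) := by
  induction k with
  | zero => rw [approxSeq_zero]; exact hasCompactSupport_blend hψ HasCompactSupport.zero
  | succ k ih => rw [approxSeq_succ hlam hS]; exact hasCompactSupport_blend hψ ih

end Approx

end SobolevExt

/-! ### Differences of averages, and the last index with a given property. -/

theorem enorm_integral_sub_integral_le {X : Type*} [MeasurableSpace X] {P Q : Measure X}
    [IsProbabilityMeasure P] [IsProbabilityMeasure Q] {g : X → ℝ} (hP : Integrable g P)
    (hQ : Integrable g Q) :
    ‖∫ x, g x ∂P - ∫ y, g y ∂Q‖ₑ ≤ ∫⁻ y, ∫⁻ x, ‖g x - g y‖ₑ ∂P ∂Q := by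
  have h1 : ∫ x, g x ∂P - ∫ y, g y ∂Q = ∫ y, (∫ x, (g x - g y) ∂P) ∂Q := by
    have : ∀ y, ∫ x, (g x - g y) ∂P = ∫ x, g x ∂P - g y := fun y => by
      rw [integral_sub hP (integrable_const _)]; simp
    simp_rw [this]
    rw [integral_sub (integrable_const _) hQ]; simp
  rw [h1]
  refine (enorm_integral_le_lintegral_enorm _).trans (lintegral_mono fun y => ?_)
  exact enorm_integral_le_lintegral_enorm _

theorem Nat.exists_greatest_lt {P : ℕ → Prop} {i : ℕ} (h : ∃ j < i, P j) :
    ∃ j < i, P j ∧ ∀ l, j < l → l < i → ¬P l := by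
  induction i with
  | zero => obtain ⟨j, hj, -⟩ := h; omega
  | succ i ih =>
    by_cases hi : P i
    · exact ⟨i, by omega, hi, fun l h1 h2 => by omega⟩
    · obtain ⟨j, hj, hPj⟩ := h
      have hji : j ≠ i := by rintro rfl; exact hi hPj
      obtain ⟨j', hj', hP, hmax⟩ := ih ⟨j, by omega, hPj⟩
      refine ⟨j', by omega, hP, fun l h1 h2 => ?_⟩
      rcases (Nat.lt_succ_iff.1 h2).eq_or_lt with rfl | h3
      · exact hi
      · exact hmax l h1 h3

namespace SobolevExt

/-! ### Pointwise domination by the maximal function. -/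

section Pointwise

variable {n : ℕ} {S : Set (Fin n → ℝ)} {d lam c C₁ C₂ C₃ : ℝ} {μ : ℕ → Measure (Fin n → ℝ)}
  {f : S → EReal} {x : Fin n → ℝ}

/-- The average of `f` over `Q_{k,m}` with respect to the measure of level `k`. -/
noncomputable def cubeAvg (μ : ℕ → Measure (Fin n → ℝ)) (f : S → EReal) (k : ℕ)
    (m : Fin n → ℤ) : ℝ :=
  ⨍ x in dyadicCube k m, realPart f x ∂(μ k)

/-- The double average in `phi` bounds the difference of the two averages; since `r ≤ i`, the
minimum in its normalization is `side i`. -/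
theorem enorm_cubeAvg_sub_le (hμ : IsFrostman S d C₁ C₂ C₃ μ) (hS : S ⊆ dyadicCube 0 0)
    (hC₂ : 0 < C₂) (hlam : 0 < lam) (hf : ∀ k, Integrable (realPart f) (μ k)) {i r : ℕ}
    (hri : r ≤ i) {m m' : Fin n → ℤ} (hm : (i, m) ∈ keystone S d lam)
    (hm' : (r, m') ∈ keystone S d lam) :
    ‖cubeAvg μ f i m - cubeAvg μ f r m'‖ₑ ≤
      ENNReal.ofReal (side i) * phi μ f (i, m) (r, m') := by
  have hfi := hμ.isFiniteMeasure hS i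
  have hfr := hμ.isFiniteMeasure hS r
  have hni : NeZero ((μ i).restrict (dyadicCube i m)) :=
    ⟨by rw [Ne, Measure.restrict_eq_zero]; exact hμ.measure_ne_zero hC₂ hlam hm⟩
  have hnr : NeZero ((μ r).restrict (dyadicCube r m')) :=
    ⟨by rw [Ne, Measure.restrict_eq_zero]; exact hμ.measure_ne_zero hC₂ hlam hm'⟩
  have hint : ∀ (k : ℕ) (m : Fin n → ℤ), μ k (dyadicCube k m) ≠ 0 → Integrable (realPart f)
      (((μ k).restrict (dyadicCube k m) Set.univ)⁻¹ • (μ k).restrict (dyadicCube k m)) :=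
    fun k m h => ((hf k).restrict).smul_measure
      (ENNReal.inv_ne_top.2 (by rwa [Measure.restrict_apply_univ]))
  have key := enorm_integral_sub_integral_le (hint i m (hμ.measure_ne_zero hC₂ hlam hm))
    (hint r m' (hμ.measure_ne_zero hC₂ hlam hm'))
  refine key.trans_eq ?_
  have hs : min (side i) (side r) = side i := min_eq_left (side_le_side.2 (by exact_mod_cast hri))
  have e1 : ENNReal.ofReal (side i) * ENNReal.ofReal (1 / min (side i) (side r)) = 1 := by
    rw [hs, ← ENNReal.ofReal_mul (side_pos _).le, mul_one_div_cancel (side_pos _).ne',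
      ENNReal.ofReal_one]
  rw [phi, ← mul_assoc, e1, one_mul]
  rfl

theorem phi_le_calderonMax {a b : ℕ × (Fin n → ℤ)} (hx : x ∈ dilatedCube c a.1 a.2)
    (ha : a ∈ keystone S d lam) (hb : b ∈ keystone S d lam) (hab : IsCovering S d lam c a b) :
    phi μ f a b ≤ calderonMax μ d lam c f x :=
  le_iSup_of_le a (le_iSup_of_le b (le_iSup_of_le hx (le_iSup_of_le ha (le_iSup_of_le hb
    (le_iSup_of_le hab le_rfl)))))

/-- No keystone cube of a level strictly between `r` and `i` contains `Q_{i,m}`. -/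
def NoKeystoneBetween (S : Set (Fin n → ℝ)) (d lam : ℝ) (r i : ℕ) (m : Fin n → ℤ) : Prop :=
  ∀ j m', r < j → j < i → dyadicCube i m ⊆ dyadicCube j m' → (j, m') ∉ keystone S d lam

theorem abs_cubeAvg_sub_le (hμ : IsFrostman S d C₁ C₂ C₃ μ) (hS : S ⊆ dyadicCube 0 0)
    (hC₂ : 0 < C₂) (hlam : 0 < lam) (hf : ∀ k, Integrable (realPart f) (μ k))
    (hA : calderonMax μ d lam c f x ≠ ⊤) {i r : ℕ} (hri : r ≤ i) {m m' : Fin n → ℤ}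
    (hm : (i, m) ∈ keystone S d lam) (hm' : (r, m') ∈ keystone S d lam)
    (hx : x ∈ dilatedCube c i m) (hsub : dyadicCube i m ⊆ dilatedCube c r m')
    (hno : NoKeystoneBetween S d lam r i m) :
    |cubeAvg μ f i m - cubeAvg μ f r m'| ≤ side i * (calderonMax μ d lam c f x).toReal := by
  have hcov : IsCovering S d lam c (i, m) (r, m') :=
    { side_le := side_le_side.2 (by exact_mod_cast hri)
      subset := hsub
      mem_keystone := hm'
      not_mem_keystone := fun q h1 h2 h3 => by
        rw [side_lt_side] at h2 h3
        exact hno q.1 q.2 (by exact_mod_cast h3) (by exact_mod_cast h2) h1 }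
  have h1 := (enorm_cubeAvg_sub_le hμ hS hC₂ hlam hf hri hm hm').trans
    (mul_le_mul_right (phi_le_calderonMax hx hm hm' hcov) _)
  have h2 := ENNReal.toReal_mono (ENNReal.mul_ne_top ENNReal.ofReal_ne_top hA) h1
  rwa [toReal_enorm, ENNReal.toReal_mul, ENNReal.toReal_ofReal (side_pos _).le,
    Real.norm_eq_abs] at h2

theorem abs_coeff_sub_le {k : ℕ} {m : Fin n → ℤ} {q ε : ℝ}
    (hne : (keystoneNeighbors S d lam k m).Nonempty)
    (h : ∀ m' ∈ keystoneNeighbors S d lam k m, |cubeAvg μ f k m' - q| ≤ ε) :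
    |coeff μ d lam f k m - q| ≤ ε := by
  have hfin : (keystoneNeighbors S d lam k m).Finite := finite_keystoneNeighbors
  have hN : 0 < (keystoneNeighbors S d lam k m).ncard := (Set.ncard_pos hfin).2 hne
  have hN' : (0 : ℝ) < (keystoneNeighbors S d lam k m).ncard := by exact_mod_cast hN
  have e : coeff μ d lam f k m = 1 / ((keystoneNeighbors S d lam k m).ncard : ℝ) *
      ∑ m' ∈ hfin.toFinset, cubeAvg μ f k m' := by
    rw [coeff, if_pos hN.ne', finsum_mem_eq_finite_toFinset_sum _ hfin]
    rfl
  have hcard : (hfin.toFinset.card : ℝ) = (keystoneNeighbors S d lam k m).ncard := by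
    rw [Set.ncard_eq_toFinset_card _ hfin]
  have e2 : coeff μ d lam f k m - q = 1 / ((keystoneNeighbors S d lam k m).ncard : ℝ) *
      ∑ m' ∈ hfin.toFinset, (cubeAvg μ f k m' - q) := by
    rw [e, Finset.sum_sub_distrib, Finset.sum_const, nsmul_eq_mul, hcard]
    field_simp
  rw [e2, abs_mul, abs_of_pos (by positivity), one_div, inv_mul_le_iff₀ hN', ← hcard]
  refine (Finset.abs_sum_le_sum_abs _ _).trans ?_
  rw [← nsmul_eq_mul]
  exact Finset.sum_le_card_nsmul _ _ _ fun m' hm' => h m' (hfin.mem_toFinset.1 hm')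

theorem keystoneNeighbors_nonempty {k : ℕ} {m : Fin n → ℤ} (hm : m ∈ levelTilde S d lam k) :
    (keystoneNeighbors S d lam k m).Nonempty := by
  obtain ⟨m', h1, h2⟩ := mem_levelTilde_iff.1 hm
  exact ⟨m', mem_keystoneNeighbors_iff.2 ⟨h2, h1⟩⟩

/-- Each keystone neighbour averaged in the coefficient is a covering cube of `Q_{i,mQ}` and `x ∈ c
Q_{i,mQ}`, so the pair competes in the supremum at `x`. The error carries the fine scale `side i`
although the coefficient lives on the coarser level `r`. -/
theorem abs_coeff_sub_cubeAvg_le (hμ : IsFrostman S d C₁ C₂ C₃ μ) (hS : S ⊆ dyadicCube 0 0)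
    (hC₂ : 0 < C₂) (hlam : 0 < lam) (hc : 7 ≤ c) (hf : ∀ k, Integrable (realPart f) (μ k))
    (hA : calderonMax μ d lam c f x ≠ ⊤) {i r : ℕ} (hri : r ≤ i) {m mQ mr : Fin n → ℤ}
    (hm : Near i m x) (hmQ : ∀ j, |mQ j - m j| ≤ 1) (hQ : (i, mQ) ∈ keystone S d lam)
    (hmr : Near r mr x) (hmr' : mr ∈ levelTilde S d lam r)
    (hno : NoKeystoneBetween S d lam r i mQ) :
    |coeff μ d lam f r mr - cubeAvg μ f i mQ| ≤
      side i * (calderonMax μ d lam c f x).toReal := by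
  refine abs_coeff_sub_le (keystoneNeighbors_nonempty hmr') fun m' hm' => ?_
  obtain ⟨h1, h2⟩ := mem_keystoneNeighbors_iff.1 hm'
  rw [abs_sub_comm]
  exact abs_cubeAvg_sub_le hμ hS hC₂ hlam hf hA hri hQ h2 (mem_dilatedCube_of_near hc hm hmQ)
    (dyadicCube_subset_dilatedCube_of_near hc hri hm hmQ hmr h1) hno

/-- The analogue for `f_{0,0}`; the inclusion in the dilated unit cubes now comes from `Q_{i,mQ}`
meeting the unit cube. -/
theorem abs_coeff_zero_sub_cubeAvg_le (hμ : IsFrostman S d C₁ C₂ C₃ μ) (hS : S ⊆ dyadicCube 0 0)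
    (hC₂ : 0 < C₂) (hlam : 0 < lam) (hc : 7 ≤ c) (hf : ∀ k, Integrable (realPart f) (μ k))
    (h0 : ((0, 0) : ℕ × (Fin n → ℤ)) ∈ keystone S d lam)
    (hA : calderonMax μ d lam c f x ≠ ⊤) {i : ℕ} {mQ : Fin n → ℤ}
    (hx : x ∈ dilatedCube c i mQ) (hQ : (i, mQ) ∈ keystone S d lam)
    (hno : NoKeystoneBetween S d lam 0 i mQ) :
    |coeff μ d lam f 0 0 - cubeAvg μ f i mQ| ≤
      side i * (calderonMax μ d lam c f x).toReal := by
  have hQ0 : (dyadicCube i mQ ∩ dyadicCube 0 0).Nonempty :=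
    (nonempty_of_mem_keystone hlam hQ).mono (Set.inter_subset_inter_right _ hS)
  refine abs_coeff_sub_le ⟨0, mem_keystoneNeighbors_iff.2 ⟨by simp, h0⟩⟩ fun m' hm' => ?_
  obtain ⟨h1, h2⟩ := mem_keystoneNeighbors_iff.1 hm'
  rw [abs_sub_comm]
  exact abs_cubeAvg_sub_le hμ hS hC₂ hlam hf hA (zero_le) hQ h2 hx
    (dyadicCube_subset_dilatedCube_zero hc hQ0 (by simpa using h1)) hno

theorem two_mul_side_le {j i : ℕ} (hji : j < i) : 2 * side i ≤ side j := by
  rw [side_natCast, side_natCast]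
  have h1 : (2 : ℝ) ^ (j + 1) ≤ 2 ^ i := pow_le_pow_right₀ (by norm_num) hji
  have h2 : (0 : ℝ) < 2 ^ j := by positivity
  rw [pow_succ] at h1
  have h3 : ((2 : ℝ) ^ i)⁻¹ ≤ (2 ^ j * 2)⁻¹ := inv_anti₀ (by positivity) h1
  rw [mul_inv] at h3
  linarith

/-- Pass to the smallest keystone cube of larger side containing the present one, and repeat. Each
jump costs the side of its smaller cube, and the form `2 - side i` closes the induction because `2 *
side i ≤ side j` for `j < i`. -/
theorem abs_cubeAvg_sub_cubeAvg_zero_le (hμ : IsFrostman S d C₁ C₂ C₃ μ)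
    (hS : S ⊆ dyadicCube 0 0) (hC₂ : 0 < C₂) (hlam : 0 < lam) (hc : 7 ≤ c)
    (hf : ∀ k, Integrable (realPart f) (μ k))
    (h0 : ((0, 0) : ℕ × (Fin n → ℤ)) ∈ keystone S d lam)
    (hA : calderonMax μ d lam c f x ≠ ⊤) {i : ℕ} {mQ : Fin n → ℤ}
    (hx : x ∈ dilatedCube c i mQ) (hQ : (i, mQ) ∈ keystone S d lam) :
    |cubeAvg μ f i mQ - cubeAvg μ f 0 0| ≤
      (2 - side i) * (calderonMax μ d lam c f x).toReal := by
  induction i using Nat.strong_induction_on generalizing mQ with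
  | _ i ih =>
  set a := (calderonMax μ d lam c f x).toReal
  have ha : 0 ≤ a := ENNReal.toReal_nonneg
  by_cases hex : ∃ j < i, ∃ mj, dyadicCube i mQ ⊆ dyadicCube j mj ∧ (j, mj) ∈ keystone S d lam
  · obtain ⟨j, hji, ⟨mj, hsub, hj⟩, hmax⟩ := Nat.exists_greatest_lt hex
    have h1 := ih j hji (mem_dilatedCube_of_subset (by linarith) hji.le hx hsub) hj
    have h2 := abs_cubeAvg_sub_le hμ hS hC₂ hlam hf hA hji.le hQ hj hx
      (hsub.trans (dyadicCube_subset_dilatedCube_self (by linarith) j mj))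
      (fun l m' hl hl' hs hk => hmax l hl hl' ⟨m', hs, hk⟩)
    have h3 := two_mul_side_le hji
    have h4 := abs_sub_le (cubeAvg μ f i mQ) (cubeAvg μ f j mj) (cubeAvg μ f 0 0)
    have h5 : 2 * side i * a ≤ side j * a := mul_le_mul_of_nonneg_right h3 ha
    linarith
  · push Not at hex
    have hQ0 : (dyadicCube i mQ ∩ dyadicCube 0 0).Nonempty :=
      (nonempty_of_mem_keystone hlam hQ).mono (Set.inter_subset_inter_right _ hS)
    have h2 := abs_cubeAvg_sub_le hμ hS hC₂ hlam hf hA (zero_le) hQ h0 hx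
      (dyadicCube_subset_dilatedCube_zero hc hQ0 (by simp))
      (fun l m' _ hl' hs => hex l hl' m' hs)
    have h3 := side_le_one i
    have h4 : side i * a ≤ 1 * a := mul_le_mul_of_nonneg_right h3 ha
    linarith

/-- Propagation of value and gradient estimates through the levels `g, …, i`. -/
theorem approxSeq_bounds_of_le {ψ : ℝ → ℝ} (hψ : IsProfile ψ) (hlam : 0 < lam)
    (hS : S ⊆ dyadicCube 0 0) {K : ℝ} (hK : 0 ≤ K)
    (hb : ∀ (k : ℕ) (m : Fin n → ℤ) (x : Fin n → ℝ), ‖fderiv ℝ (bump ψ k m) x‖ ≤ K * 2 ^ k)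
    {g i : ℕ} (hgi : g ≤ i) {q ε : ℝ}
    (hv : |approxSeq ψ μ d lam f g x - q| ≤ ε)
    (hD : ‖fderiv ℝ (approxSeq ψ μ d lam f g) x‖ ≤ 2 ^ n * (K * 2 ^ g * (4 * ε)))
    (hcoeff : ∀ r m, g < r → r ≤ i → m ∈ levelTilde S d lam r → Near r m x →
      |coeff μ d lam f r m - q| ≤ ε) :
    |approxSeq ψ μ d lam f i x - q| ≤ ε ∧
      ‖fderiv ℝ (approxSeq ψ μ d lam f i) x‖ ≤ 2 ^ n * (K * 2 ^ i * (4 * ε)) := by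
  induction i, hgi using Nat.le_induction with
  | base => exact ⟨hv, hD⟩
  | succ r hr ih =>
    obtain ⟨h1, h2⟩ := ih fun r' m h3 h4 => hcoeff r' m h3 (by omega)
    have h3 : ∀ m ∈ (finite_levelTilde (d := d) hlam hS (r + 1)).toFinset, Near (r + 1) m x →
        |coeff μ d lam f (r + 1) m - q| ≤ ε := fun m hm hn =>
      hcoeff (r + 1) m (by omega) le_rfl ((Set.Finite.mem_toFinset _).1 hm) hn
    rw [approxSeq_succ hlam hS]
    refine ⟨abs_blend_sub_le hψ h1 h3, ?_⟩
    refine (norm_fderiv_blend_le hψ ((contDiff_approxSeq hψ hlam hS r).differentiable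
      (by simp) x) hK (fun m => hb (r + 1) m x) h1 h3).trans ?_
    -- The factor `4` reproduces itself: `4 * 2 ^ r + 2 * 2 ^ (r + 1) = 4 * 2 ^ (r + 1)`.
    refine (add_le_add_left h2 _).trans (le_of_eq ?_)
    ring

/-- Estimates at a point near an active cube of level `i ≥ 1`. -/
theorem approxSeq_bounds_of_near {ψ : ℝ → ℝ} (hψ : IsProfile ψ)
    (hμ : IsFrostman S d C₁ C₂ C₃ μ)
    (hS : S ⊆ dyadicCube 0 0) (hC₂ : 0 < C₂) (hlam : 0 < lam) (hc : 7 ≤ c)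
    (hf : ∀ k, Integrable (realPart f) (μ k))
    (h0 : ((0, 0) : ℕ × (Fin n → ℤ)) ∈ keystone S d lam)
    (hA : calderonMax μ d lam c f x ≠ ⊤) {M : ℝ}
    (hM : ∀ m, (0, m) ∈ keystone S d lam → |cubeAvg μ f 0 m| ≤ M) {K : ℝ} (hK : 0 ≤ K)
    (hb : ∀ (k : ℕ) (m : Fin n → ℤ) (x : Fin n → ℝ), ‖fderiv ℝ (bump ψ k m) x‖ ≤ K * 2 ^ k)
    {i : ℕ} (hi : 1 ≤ i) {m : Fin n → ℤ} (hm : m ∈ levelTilde S d lam i) (hx : Near i m x) :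
    |approxSeq ψ μ d lam f i x| ≤ 3 * (calderonMax μ d lam c f x).toReal + M ∧
      ‖fderiv ℝ (approxSeq ψ μ d lam f i) x‖ ≤
        2 ^ n * (K * (12 * (calderonMax μ d lam c f x).toReal + 6 * M)) := by
  set a := (calderonMax μ d lam c f x).toReal with ha_def
  have ha : 0 ≤ a := ENNReal.toReal_nonneg
  have hM0 : 0 ≤ M := (abs_nonneg _).trans (hM 0 h0)
  obtain ⟨mQ, hQ, hmQ⟩ := mem_levelTilde_iff.1 hm
  have hxQ := mem_dilatedCube_of_near hc hx hmQ
  have hQ0 : (dyadicCube i mQ ∩ dyadicCube 0 0).Nonempty :=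
    (nonempty_of_mem_keystone hlam hQ).mono (Set.inter_subset_inter_right _ hS)
  set q := cubeAvg μ f i mQ
  have hsi := side_pos i
  have hε : side i * a ≤ a := mul_le_of_le_one_left ha (side_le_one i)
  have hε0 : 0 ≤ side i * a := by positivity
  have hq : |q| ≤ 2 * a + M := by
    have h1 := abs_cubeAvg_sub_cubeAvg_zero_le hμ hS hC₂ hlam hc hf h0 hA hxQ hQ
    have h2 := hM 0 h0
    have h3 := abs_sub_abs_le_abs_sub q (cubeAvg μ f 0 0)
    have h4 : (2 - side i) * a ≤ 2 * a := mul_le_mul_of_nonneg_right (by linarith) ha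
    linarith
  -- From a level `g` with good value and gradient the estimate runs up to level `i`, where `2 ^ i`
  -- cancels `side i`. It remains to find such a starting level.
  have fin : ∀ g, g ≤ i → NoKeystoneBetween S d lam g i mQ →
      |approxSeq ψ μ d lam f g x - q| ≤ side i * a →
      ‖fderiv ℝ (approxSeq ψ μ d lam f g) x‖ ≤ 2 ^ n * (K * 2 ^ g * (side i * a)) →
      |approxSeq ψ μ d lam f i x| ≤ 3 * a + M ∧
      ‖fderiv ℝ (approxSeq ψ μ d lam f i) x‖ ≤ 2 ^ n * (K * (12 * a + 6 * M)) := by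
    intro g hgi hno h1 h2
    obtain ⟨h3, h4⟩ := approxSeq_bounds_of_le hψ hlam hS hK hb hgi h1
      (h2.trans (mul_le_mul_of_nonneg_left (mul_le_mul_of_nonneg_left (by linarith)
        (by positivity)) (by positivity))) fun r mr hgr hri hmr hnr =>
        abs_coeff_sub_cubeAvg_le hμ hS hC₂ hlam hc hf hA hri hx hmQ hQ hnr hmr
          fun j m' hj => hno j m' (by omega)
    constructor
    · have := abs_sub_abs_le_abs_sub (approxSeq ψ μ d lam f i x) q
      linarith
    · refine h4.trans ?_
      have e : K * 2 ^ i * (4 * (side i * a)) = K * (4 * a) := by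
        linear_combination K * 4 * a * two_pow_mul_side i
      rw [e]
      gcongr
      linarith
  -- The starting level is the last one, between `1` and `i - 1`, with a keystone cube containing
  -- `Q`; blending is full there.
  by_cases hex : ∃ j < i, 1 ≤ j ∧ ∃ mj, dyadicCube i mQ ⊆ dyadicCube j mj ∧
      (j, mj) ∈ keystone S d lam
  · obtain ⟨g, hgi, ⟨hg1, mg, hsub, hg⟩, hmax⟩ := Nat.exists_greatest_lt hex
    have hno : NoKeystoneBetween S d lam g i mQ := fun l m' hl hl' hs hk =>
      hmax l hl hl' ⟨by omega, m', hs, hk⟩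
    obtain ⟨g, rfl⟩ : ∃ g', g = g' + 1 := ⟨g - 1, by omega⟩
    have hfull : ∀ m', Near (g + 1) m' x →
        m' ∈ (finite_levelTilde (d := d) hlam hS (g + 1)).toFinset := fun m' hm' => by
      rw [Set.Finite.mem_toFinset]
      exact mem_levelTilde_iff.2
        ⟨mg, hg, abs_sub_le_one_of_near_of_subset hgi hx hmQ hsub hm'⟩
    have hcoeff : ∀ m' ∈ (finite_levelTilde (d := d) hlam hS (g + 1)).toFinset,
        Near (g + 1) m' x → |coeff μ d lam f (g + 1) m' - q| ≤ side i * a := fun m' hm' hn =>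
      abs_coeff_sub_cubeAvg_le hμ hS hC₂ hlam hc hf hA hgi.le hx hmQ hQ hn
        ((Set.Finite.mem_toFinset _).1 hm') hno
    refine fin (g + 1) hgi.le hno ?_ ?_
    · rw [approxSeq_succ hlam hS]
      exact abs_blend_sub_le_of_full hψ hfull hcoeff
    · rw [approxSeq_succ hlam hS]
      exact norm_fderiv_blend_le_of_full hψ ((contDiff_approxSeq hψ hlam hS g).differentiable
        (by simp) x) hK (fun m => hb (g + 1) m x) hfull hε0 hcoeff
  · push Not at hex
    have hno : NoKeystoneBetween S d lam 0 i mQ := fun l m' hl hl' hs =>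
      hex l hl' (by omega) m' hs
    have hc0 : |coeff μ d lam f 0 0 - q| ≤ side i * a :=
      abs_coeff_zero_sub_cubeAvg_le hμ hS hC₂ hlam hc hf h0 hA hxQ hQ hno
    -- For `i = 1` the level-zero bumps need not sum to one at `x`. The reference value is then `0`:
    -- `f_0` is bounded by `M`, the coefficients by `3 * a + M`, and the gradients add up to the
    -- stated `12 * a + 6 * M`.
    rcases hi.eq_or_lt with rfl | hi2
    · have hc00 : |coeff μ d lam f 0 0 - 0| ≤ M :=
        abs_coeff_sub_le ⟨0, mem_keystoneNeighbors_iff.2 ⟨by simp, h0⟩⟩ fun m' hm' => by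
          rw [sub_zero]; exact hM m' (mem_keystoneNeighbors_iff.1 hm').2
      have hv0 : |approxSeq ψ μ d lam f 0 x - 0| ≤ M := by
        rw [approxSeq_zero]
        exact abs_blend_sub_le hψ (by simpa using hM0) fun _ _ _ => hc00
      have hD0 : ‖fderiv ℝ (approxSeq ψ μ d lam f 0) x‖ ≤ 2 ^ n * (K * 2 ^ 0 * (2 * M)) := by
        rw [approxSeq_zero]
        refine (norm_fderiv_blend_le (q := 0) hψ (differentiableAt_const (0 : ℝ)) hK
          (fun m => hb 0 m x) (by simpa using hM0) fun _ _ _ => hc00).trans (le_of_eq ?_)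
        rw [show fderiv ℝ (fun _ : Fin n → ℝ => (0 : ℝ)) x = 0 from fderiv_const_apply 0]
        simp
      have h1 : ∀ m ∈ (finite_levelTilde (d := d) hlam hS 1).toFinset, Near 1 m x →
          |coeff μ d lam f 1 m - 0| ≤ 3 * a + M := fun m' hm' hn => by
        have h2 := abs_coeff_sub_cubeAvg_le hμ hS hC₂ hlam hc hf hA le_rfl hx hmQ hQ hn
          ((Set.Finite.mem_toFinset _).1 hm') fun j _ hj hj' => by omega
        have h3 := abs_sub_abs_le_abs_sub (coeff μ d lam f 1 m') q
        rw [sub_zero]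
        linarith
      have hv0' : |approxSeq ψ μ d lam f 0 x - 0| ≤ 3 * a + M := hv0.trans (by linarith)
      rw [approxSeq_succ hlam hS]
      constructor
      · simpa using abs_blend_sub_le hψ hv0' h1
      · refine (norm_fderiv_blend_le hψ ((contDiff_approxSeq hψ hlam hS 0).differentiable
          (by simp) x) hK (fun m => hb 1 m x) hv0' h1).trans ?_
        refine (add_le_add_left hD0 _).trans (le_of_eq ?_)
        ring
    -- For `i ≥ 2` each coordinate of `x` is within `21/40` of `[0, 1]`, so every unit cube near `x`
    -- lies in `3 Q_{0,0}` and level zero is a full starting level.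
    · have hfull : ∀ m', Near 0 m' x → m' ∈ unitNbr n := fun m' hm' => by
        rw [mem_unitNbr]
        intro j
        obtain ⟨h1, h2⟩ := bounds_of_near hx hmQ hQ0 j
        obtain ⟨h3, h4⟩ := hm' j
        rw [pow_zero, one_mul] at h3 h4
        have h4' : (4 : ℝ) ≤ 2 ^ i := by
          calc (4 : ℝ) = 2 ^ 2 := by norm_num
            _ ≤ 2 ^ i := pow_le_pow_right₀ (by norm_num) hi2
        have h5 : -(21 / 40) ≤ x j := by
          by_contra hcon
          push Not at hcon
          nlinarith
        have h6 : x j ≤ 1 + 21 / 40 := by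
          by_contra hcon
          push Not at hcon
          nlinarith
        have h7 : (-2 : ℝ) < m' j := by linarith
        have h8 : (m' j : ℝ) < 2 := by linarith
        have h7' : -2 < m' j := by exact_mod_cast h7
        have h8' : m' j < 2 := by exact_mod_cast h8
        rw [abs_le]
        constructor <;> omega
      refine fin 0 (zero_le) hno ?_ ?_
      · rw [approxSeq_zero]
        exact abs_blend_sub_le_of_full hψ hfull fun _ _ _ => hc0
      · rw [approxSeq_zero]
        exact norm_fderiv_blend_le_of_full hψ (differentiableAt_const (0 : ℝ)) hK
          (fun m => hb 0 m x) hfull hε0 fun _ _ _ => hc0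

/-- The approximating sequence and its gradients are dominated by the maximal function. -/
theorem approxSeq_bounds {ψ : ℝ → ℝ} (hψ : IsProfile ψ) (hμ : IsFrostman S d C₁ C₂ C₃ μ)
    (hS : S ⊆ dyadicCube 0 0) (hC₂ : 0 < C₂) (hlam : 0 < lam) (hc : 7 ≤ c)
    (hf : ∀ k, Integrable (realPart f) (μ k))
    (h0 : ((0, 0) : ℕ × (Fin n → ℤ)) ∈ keystone S d lam)
    (hA : calderonMax μ d lam c f x ≠ ⊤) {M : ℝ}
    (hM : ∀ m, (0, m) ∈ keystone S d lam → |cubeAvg μ f 0 m| ≤ M) {K : ℝ} (hK : 0 ≤ K)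
    (hb : ∀ (k : ℕ) (m : Fin n → ℤ) (x : Fin n → ℝ), ‖fderiv ℝ (bump ψ k m) x‖ ≤ K * 2 ^ k)
    (k : ℕ) :
    |approxSeq ψ μ d lam f k x| ≤ 3 * (calderonMax μ d lam c f x).toReal +
        (Set.Icc (fun _ => -3) (fun _ => 4)).indicator (fun _ => M) x ∧
      ‖fderiv ℝ (approxSeq ψ μ d lam f k) x‖ ≤
        2 ^ n * (K * (12 * (calderonMax μ d lam c f x).toReal +
          6 * (Set.Icc (fun _ => -3) (fun _ => 4)).indicator (fun _ => M) x)) := by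
  set a := (calderonMax μ d lam c f x).toReal with ha_def
  have ha : 0 ≤ a := ENNReal.toReal_nonneg
  have hM0 : 0 ≤ M := (abs_nonneg _).trans (hM 0 h0)
  have hI0 : 0 ≤ (Set.Icc (fun _ : Fin n => (-3 : ℝ)) (fun _ => 4)).indicator (fun _ => M) x :=
    Set.indicator_nonneg (fun _ _ => hM0) x
  induction k with
  | zero =>
    by_cases hex : ∃ m ∈ unitNbr n, Near 0 m x
    · obtain ⟨m, hm, hx⟩ := hex
      have hxI : x ∈ Set.Icc (fun _ : Fin n => (-3 : ℝ)) (fun _ => 4) := by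
        rw [Set.mem_Icc, Pi.le_def, Pi.le_def]
        refine ⟨fun j => ?_, fun j => ?_⟩ <;>
        · obtain ⟨h1, h2⟩ := hx j
          obtain ⟨h3, h4⟩ := abs_le.1 (mem_unitNbr.1 hm j)
          have h3' : (-1 : ℝ) ≤ m j := by exact_mod_cast h3
          have h4' : (m j : ℝ) ≤ 1 := by exact_mod_cast h4
          rw [pow_zero, one_mul] at h1 h2
          linarith
      rw [Set.indicator_of_mem hxI]
      have hc00 : |coeff μ d lam f 0 0 - 0| ≤ M :=
        abs_coeff_sub_le ⟨0, mem_keystoneNeighbors_iff.2 ⟨by simp, h0⟩⟩ fun m' hm' => by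
          rw [sub_zero]; exact hM m' (mem_keystoneNeighbors_iff.1 hm').2
      rw [approxSeq_zero]
      constructor
      · have h1 := abs_blend_sub_le (T := unitNbr n) (k := 0) (g := 0) (x := x) hψ
          (by simpa using hM0) fun _ _ _ => hc00
        rw [sub_zero] at h1
        linarith
      · refine (norm_fderiv_blend_le (q := 0) hψ (differentiableAt_const (0 : ℝ)) hK
          (fun m => hb 0 m x) (by simpa using hM0) fun _ _ _ => hc00).trans ?_
        rw [show fderiv ℝ (fun _ : Fin n → ℝ => (0 : ℝ)) x = 0 from fderiv_const_apply 0,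
          norm_zero, zero_add, pow_zero, mul_one]
        gcongr
        linarith
    · push Not at hex
      rw [approxSeq_zero, blend_eq_self hψ hex,
        fderiv_blend_eq_self (g := 0) hψ (differentiableAt_const (0 : ℝ)) hex,
        show fderiv ℝ (0 : (Fin n → ℝ) → ℝ) x = 0 from fderiv_const_apply 0]
      simp only [Pi.zero_apply, abs_zero, norm_zero]
      constructor <;> positivity
  | succ k ih =>
    by_cases hex : ∃ m ∈ levelTilde S d lam (k + 1), Near (k + 1) m x
    · obtain ⟨m, hm, hx⟩ := hex
      obtain ⟨mQ, hQ, hmQ⟩ := mem_levelTilde_iff.1 hm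
      have hQ0 : (dyadicCube (k + 1 : ℕ) mQ ∩ dyadicCube 0 0).Nonempty :=
        (nonempty_of_mem_keystone hlam hQ).mono (Set.inter_subset_inter_right _ hS)
      have hxI : x ∈ Set.Icc (fun _ : Fin n => (-3 : ℝ)) (fun _ => 4) := by
        have h4' : (1 : ℝ) ≤ 2 ^ (k + 1) := one_le_pow₀ (by norm_num)
        rw [Set.mem_Icc, Pi.le_def, Pi.le_def]
        refine ⟨fun j => ?_, fun j => ?_⟩
        · have h1 := (bounds_of_near hx hmQ hQ0 j).1
          by_contra hcon
          push Not at hcon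
          nlinarith
        · have h1 := (bounds_of_near hx hmQ hQ0 j).2
          by_contra hcon
          push Not at hcon
          nlinarith
      rw [Set.indicator_of_mem hxI]
      exact approxSeq_bounds_of_near hψ hμ hS hC₂ hlam hc hf h0 hA hM hK hb (by omega) hm hx
    -- No active cube of level `k + 1` is near `x`, so the value and gradient of the previous level
    -- persist.
    · push Not at hex
      have hex' : ∀ m ∈ (finite_levelTilde (d := d) hlam hS (k + 1)).toFinset,
          ¬Near (k + 1) m x := fun m hm => hex m ((Set.Finite.mem_toFinset _).1 hm)
      rw [approxSeq_succ hlam hS, blend_eq_self hψ hex', fderiv_blend_eq_self hψ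
        ((contDiff_approxSeq hψ hlam hS k).differentiable (by simp) x) hex']
      exact ih

end Pointwise

/-! ### Almost everywhere convergence to the extension. -/

section AEConvergence

variable {n : ℕ} {S : Set (Fin n → ℝ)} {d lam C₁ C₂ C₃ : ℝ} {μ : ℕ → Measure (Fin n → ℝ)}
  {f : S → EReal} {x : Fin n → ℝ} {ψ : ℝ → ℝ}

theorem tendsto_side_mul {r : ℝ} (hr : 0 < r) :
    Tendsto (fun k : ℕ => r * side k) atTop (𝓝[>] 0) := by
  refine tendsto_nhdsWithin_iff.2 ⟨?_, Eventually.of_forall fun k => mul_pos hr (side_pos k)⟩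
  have h : Tendsto (fun k : ℕ => side k) atTop (𝓝 0) := by
    simp_rw [side_natCast, ← inv_pow]
    exact tendsto_pow_atTop_nhds_zero_of_lt_one (by norm_num) (by norm_num)
  simpa using h.const_mul r

theorem dist_le_of_near {k : ℕ} {m mQ : Fin n → ℤ} {y : Fin n → ℝ} (hx : Near k m x)
    (hmQ : ∀ j, |mQ j - m j| ≤ 1) (hy : y ∈ dyadicCube k mQ) : dist y x ≤ 3 * side k := by
  rw [dist_pi_le_iff (mul_nonneg (by norm_num) (side_pos k).le)]
  intro j
  rw [mem_dyadicCube_iff] at hy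
  obtain ⟨h1, h2⟩ := hx j
  obtain ⟨h3, h4⟩ := abs_le.1 (hmQ j)
  obtain ⟨h5, h6⟩ := hy j
  have h3' : (-1 : ℝ) ≤ mQ j - m j := by exact_mod_cast h3
  have h4' : (mQ j : ℝ) - m j ≤ 1 := by exact_mod_cast h4
  have ht : (0 : ℝ) < 2 ^ k := by positivity
  rw [Real.dist_eq, side_natCast, ← div_eq_mul_inv, le_div_iff₀ ht, ← abs_of_pos ht, ← abs_mul,
    abs_le]
  constructor <;> linarith

/-- Off `S` the approximating sequence is eventually constant. -/
theorem tendsto_approxSeq_of_notMem (hψ : IsProfile ψ) (hlam : 0 < lam) (hS : S ⊆ dyadicCube 0 0)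
    (hSc : IsClosed S) (hx : x ∉ S) : Tendsto (fun k => approxSeq ψ μ d lam f k x) atTop
      (𝓝 (limUnder atTop fun k => approxSeq ψ μ d lam f k x)) := by
  obtain ⟨δ, hδ, hball⟩ := Metric.isOpen_iff.1 hSc.isOpen_compl x hx
  -- An active cube of level `k` near `x` touches a keystone cube, whose points of `S` lie within `3
  -- * side k` of `x`; this is impossible once `3 * side k < δ`.
  have h1 : ∀ᶠ k : ℕ in atTop, 3 * side k < δ :=
    (tendsto_nhdsWithin_iff.1 (tendsto_side_mul (r := 3) (by norm_num))).1.eventually_lt_const hδ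
  obtain ⟨N, hN⟩ := eventually_atTop.1 h1
  have hstep : ∀ k, N ≤ k → approxSeq ψ μ d lam f k x = approxSeq ψ μ d lam f N x := by
    intro k hk
    induction k, hk using Nat.le_induction with
    | base => rfl
    | succ k hk ih =>
      rw [approxSeq_succ hlam hS, blend_eq_self hψ, ih]
      intro m hm hn
      obtain ⟨mQ, hQ, hmQ⟩ :=
        mem_levelTilde_iff.1 ((Set.Finite.mem_toFinset _).1 hm)
      obtain ⟨y, hy, hyS⟩ := nonempty_of_mem_keystone hlam hQ
      exact hball (Metric.mem_ball.2 ((dist_le_of_near hn hmQ hy).trans_lt (hN _ (by omega)))) hyS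
  exact tendsto_nhds_limUnder ⟨_, tendsto_const_nhds.congr'
    (eventually_atTop.2 ⟨N, fun k hk => (hstep k hk).symm⟩)⟩

/-- The index of a dyadic cube of level `k` containing `x`. -/
noncomputable def cubeIndex (k : ℕ) (x : Fin n → ℝ) (i : Fin n) : ℤ := ⌊(2 : ℝ) ^ k * x i⌋

theorem mem_dyadicCube_cubeIndex (k : ℕ) (x : Fin n → ℝ) : x ∈ dyadicCube k (cubeIndex k x) := by
  rw [mem_dyadicCube_iff]
  exact fun i => ⟨Int.floor_le _, (Int.lt_floor_add_one _).le⟩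

theorem near_cubeIndex (k : ℕ) (x : Fin n → ℝ) : Near k (cubeIndex k x) x := fun i => by
  have h := mem_dyadicCube_iff.1 (mem_dyadicCube_cubeIndex k x) i
  constructor <;> linarith

theorem abs_cubeIndex_sub_le {k : ℕ} {m : Fin n → ℤ} (hx : Near k m x) (i : Fin n) :
    |cubeIndex k x i - m i| ≤ 1 := by
  have h := mem_dyadicCube_iff.1 (mem_dyadicCube_cubeIndex k x) i
  obtain ⟨h1, h2⟩ := hx i
  have h3 : (cubeIndex k x i : ℝ) < m i + 2 := by linarith
  have h4 : (m i : ℝ) < cubeIndex k x i + 2 := by linarith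
  have h3' : cubeIndex k x i < m i + 2 := by exact_mod_cast h3
  have h4' : m i < cubeIndex k x i + 2 := by exact_mod_cast h4
  rw [abs_le]
  constructor <;> omega

theorem dyadicCube_cubeIndex_subset (k : ℕ) (x : Fin n → ℝ) {r : ℝ} (hr : 3 ≤ r) :
    dyadicCube k (cubeIndex k x) ⊆ Metric.closedBall x (r * side k) := fun y hy =>
  Metric.mem_closedBall.2 ((dist_le_of_near (near_cubeIndex k x) (by simp) hy).trans
    (mul_le_mul_of_nonneg_right hr (side_pos k).le))

theorem volume_closedBall_side {r : ℝ} (hr : 0 ≤ r) (k : ℕ) (x : Fin n → ℝ) :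
    volume (Metric.closedBall x (r * side k)) =
      ENNReal.ofReal ((2 * r) ^ n * side k ^ (n : ℝ)) := by
  rw [Real.volume_pi_closedBall _ (mul_nonneg hr (side_pos k).le), Fintype.card_fin,
    Real.rpow_natCast, ← mul_pow, mul_assoc]

/-- Near almost every point of `S` all small dyadic cubes are keystone cubes. -/
theorem ae_eventually_mem_keystone (hSm : MeasurableSet S) (hd : 0 ≤ d) (hdn : d ≤ n)
    (hlam : 0 < lam) (hlam1 : lam < 1) : ∀ᵐ x : Fin n → ℝ, x ∈ S →
      ∀ᶠ k : ℕ in atTop, (k, cubeIndex k x) ∈ keystone S d lam := by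
  filter_upwards [Besicovitch.ae_tendsto_measure_inter_div_of_measurableSet
    (volume : Measure (Fin n → ℝ)) hSm.compl] with x hx hxS
  rw [Set.indicator_of_notMem (by simpa using hxS)] at hx
  have h1 := hx.comp (tendsto_side_mul (r := 3) (by norm_num))
  -- The ball of radius `3 * side k` has `6 ^ n` times the volume of the cube inside it. With this
  -- threshold, less than the fraction `1 - lam` of the cube lies off `S`.
  have hη : (0 : ℝ) < (1 - lam) / 6 ^ n := div_pos (by linarith) (by positivity)
  filter_upwards [h1.eventually_lt_const (ENNReal.ofReal_pos.2 hη)] with k hk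
  have hs : 0 < side k ^ (n : ℝ) := Real.rpow_pos_of_pos (side_pos k) _
  have hvol := volume_closedBall_side (r := 3) (by norm_num) k x
  have h6 : (2 * 3 : ℝ) ^ n = 6 ^ n := by norm_num
  rw [h6] at hvol
  simp only [Function.comp_apply] at hk
  rw [hvol, ENNReal.div_lt_iff (Or.inl (ENNReal.ofReal_pos.2 (by positivity)).ne')
    (Or.inl ENNReal.ofReal_ne_top), ← ENNReal.ofReal_mul hη.le] at hk
  have e1 : (1 - lam) / 6 ^ n * (6 ^ n * side k ^ (n : ℝ)) = (1 - lam) * side k ^ (n : ℝ) := by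
    field_simp
  rw [e1] at hk
  set Q := dyadicCube k (cubeIndex k x)
  have h2 : volume Q ≤ volume (Q ∩ S) + ENNReal.ofReal ((1 - lam) * side k ^ (n : ℝ)) := by
    calc volume Q ≤ volume (Q ∩ S) + volume (Sᶜ ∩ Metric.closedBall x (3 * side k)) := by
          refine (measure_mono fun y hy => ?_).trans (measure_union_le _ _)
          by_cases hyS : y ∈ S
          · exact Or.inl ⟨hy, hyS⟩
          · exact Or.inr ⟨hyS, dyadicCube_cubeIndex_subset k x le_rfl hy⟩
      _ ≤ _ := by gcongr
  have h3 : ENNReal.ofReal (lam * side k ^ (n : ℝ)) ≤ volume (Q ∩ S) := by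
    rw [volume_dyadicCube] at h2
    have e2 : ENNReal.ofReal (side k ^ (n : ℝ)) = ENNReal.ofReal (lam * side k ^ (n : ℝ)) +
        ENNReal.ofReal ((1 - lam) * side k ^ (n : ℝ)) := by
      rw [← ENNReal.ofReal_add (by positivity) (mul_nonneg (by linarith) hs.le)]
      ring_nf
    rw [e2] at h2
    exact (ENNReal.add_le_add_iff_right ENNReal.ofReal_ne_top).1 h2
  change ENNReal.ofReal (lam * side k ^ d) ≤ content d (Q ∩ S)
  refine le_trans ?_ (volume_le_content hd hdn Set.inter_subset_left)
  refine le_trans (le_of_eq ?_) (mul_le_mul_right h3 _)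
  rw [← ENNReal.ofReal_mul (Real.rpow_nonneg (side_pos k).le _)]
  congr 1
  have e3 : side k ^ (d - n) * side k ^ (n : ℝ) = side k ^ d := by
    rw [← Real.rpow_add (side_pos k)]; ring_nf
  linear_combination -lam * e3

/-- A keystone cube has `μ k`-mass at least a multiple of `side k ^ d`, and `μ k` is at most a
multiple of `side k ^ (d - n)` times `μ 0`. Hence its `μ 0`-mass is at least a multiple of its
volume, and the density of `μ 0` is positive almost everywhere on `S`. -/
theorem volume_restrict_absolutelyContinuous (hμ : IsFrostman S d C₁ C₂ C₃ μ)
    (hS : S ⊆ dyadicCube 0 0) (hSm : MeasurableSet S) (hd : 0 ≤ d) (hdn : d ≤ n) (hC₂ : 0 < C₂)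
    (hC₃ : 0 < C₃) (hlam : 0 < lam) (hlam1 : lam < 1) :
    (volume : Measure (Fin n → ℝ)).restrict S ≪ μ 0 := by
  have hfin := hμ.isFiniteMeasure hS 0
  obtain ⟨B, hB, hBμ⟩ := hμ.exists_le_smul_pow hC₃
  have hpos : ∀ᵐ x : Fin n → ℝ, x ∈ S → 0 < (μ 0).rnDeriv volume x := by
    filter_upwards [ae_eventually_mem_keystone hSm hd hdn hlam hlam1,
      Besicovitch.ae_tendsto_rnDeriv (μ 0) (volume : Measure (Fin n → ℝ))] with x h1 h2 hxS
    have h3 := h2.comp (tendsto_side_mul (r := 3) (by norm_num))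
    have hη : (0 : ℝ) < C₂ * lam / (B * 6 ^ n) := by positivity
    refine (ENNReal.ofReal_pos.2 hη).trans_le (ge_of_tendsto h3 ?_)
    filter_upwards [h1 hxS, eventually_ge_atTop 1] with k hk hk1
    have hs : 0 < side k ^ (n : ℝ) := Real.rpow_pos_of_pos (side_pos k) _
    have hs' : 0 < side k ^ (d - n) := Real.rpow_pos_of_pos (side_pos k) _
    have h6 : (2 * 3 : ℝ) ^ n = 6 ^ n := by norm_num
    simp only [Function.comp_apply]
    rw [volume_closedBall_side (by norm_num), h6, ENNReal.le_div_iff_mul_le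
      (Or.inl (ENNReal.ofReal_pos.2 (by positivity)).ne') (Or.inl ENNReal.ofReal_ne_top),
      ← ENNReal.ofReal_mul hη.le]
    have h4 := (hμ.le_measure_of_mem_keystone hC₂ hk).trans (hBμ k hk1 _)
    rw [Measure.smul_apply, smul_eq_mul] at h4
    have h5 : ENNReal.ofReal (C₂ * lam * side k ^ d / (B * side k ^ (d - n))) ≤
        μ 0 (dyadicCube k (cubeIndex k x)) := by
      rw [ENNReal.ofReal_div_of_pos (by positivity)]
      exact ENNReal.div_le_of_le_mul' h4
    refine le_trans (le_of_eq ?_) (h5.trans (measure_mono (dyadicCube_cubeIndex_subset k x le_rfl)))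
    congr 1
    have e3 : side k ^ d = side k ^ (d - n) * side k ^ (n : ℝ) := by
      rw [← Real.rpow_add (side_pos k)]; ring_nf
    rw [e3]
    field_simp
  refine Measure.AbsolutelyContinuous.mk fun E hE hE0 => ?_
  have h1 := (Measure.setLIntegral_rnDeriv_le (μ := μ 0) (ν := volume) E).trans hE0.le
  rw [nonpos_iff_eq_zero, lintegral_eq_zero_iff (Measure.measurable_rnDeriv _ _),
    EventuallyEq, ae_restrict_iff' hE] at h1
  rw [Measure.restrict_apply hE, ← compl_compl (E ∩ S)]
  change ∀ᵐ x, x ∈ (E ∩ S)ᶜ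
  filter_upwards [h1, hpos] with x h2 h3 h4
  exact (h3 h4.2).ne' (h2 h4.1)

/-- An average for `μ k` is estimated by an oscillation for the fixed measure `μ 0`, to which
differentiation theorems apply; the powers `d - n` and `d` combine to `-n`. -/
theorem abs_cubeAvg_sub_const_le (hμ : IsFrostman S d C₁ C₂ C₃ μ) (hS : S ⊆ dyadicCube 0 0)
    (hC₂ : 0 < C₂) (hlam : 0 < lam) (hf : ∀ k, Integrable (realPart f) (μ k)) {B : ℝ} (hB : 0 < B)
    {k : ℕ} (hBμ : μ k ≤ ENNReal.ofReal (B * side k ^ (d - n)) • μ 0) {m : Fin n → ℤ}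
    (hm : (k, m) ∈ keystone S d lam) {E : Set (Fin n → ℝ)} (hE : dyadicCube k m ⊆ E) (v : ℝ) :
    |cubeAvg μ f k m - v| ≤ B / (C₂ * lam) * (side k ^ (n : ℝ))⁻¹ *
      ∫ y in E, |realPart f y - v| ∂(μ 0) := by
  have hfk := hμ.isFiniteMeasure hS k
  have hf0 := hμ.isFiniteMeasure hS 0
  have hsd : 0 < side k ^ d := Real.rpow_pos_of_pos (side_pos k) _
  have hsn : 0 < side k ^ (n : ℝ) := Real.rpow_pos_of_pos (side_pos k) _
  have hsdn : 0 < side k ^ (d - n) := Real.rpow_pos_of_pos (side_pos k) _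
  have hμQ : C₂ * lam * side k ^ d ≤ (μ k).real (dyadicCube k m) := by
    have := hμ.le_measure_of_mem_keystone hC₂ hm
    exact (ENNReal.ofReal_le_iff_le_toReal (measure_ne_top _ _)).1 this
  have hpos : 0 < (μ k).real (dyadicCube k m) := lt_of_lt_of_le (by positivity) hμQ
  have h1 : cubeAvg μ f k m - v =
      ((μ k).real (dyadicCube k m))⁻¹ * ∫ y in dyadicCube k m, (realPart f y - v) ∂(μ k) := by
    rw [cubeAvg, setAverage_eq, integral_sub (hf k).restrict (integrable_const _),
      setIntegral_const, smul_eq_mul, smul_eq_mul]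
    field_simp
  have hi0 : Integrable (fun y => |realPart f y - v|) (μ 0) :=
    ((hf 0).sub (integrable_const _)).abs
  have h2 : |∫ y in dyadicCube k m, (realPart f y - v) ∂(μ k)| ≤
      B * side k ^ (d - n) * ∫ y in E, |realPart f y - v| ∂(μ 0) := by
    calc _ ≤ ∫ y in dyadicCube k m, |realPart f y - v| ∂(μ k) := abs_integral_le_integral_abs
      _ ≤ ∫ y in dyadicCube k m, |realPart f y - v|
          ∂(ENNReal.ofReal (B * side k ^ (d - n)) • μ 0) := by
        refine integral_mono_measure (Measure.restrict_mono le_rfl hBμ)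
          (Eventually.of_forall fun y => abs_nonneg _) ?_
        exact (hi0.smul_measure ENNReal.ofReal_ne_top).restrict
      _ = B * side k ^ (d - n) * ∫ y in dyadicCube k m, |realPart f y - v| ∂(μ 0) := by
        rw [Measure.restrict_smul, integral_smul_measure, ENNReal.toReal_ofReal (by positivity),
          smul_eq_mul]
      _ ≤ _ := by
        refine mul_le_mul_of_nonneg_left ?_ (by positivity)
        exact setIntegral_mono_set hi0.integrableOn (Eventually.of_forall fun y => abs_nonneg _)
          (LE.le.eventuallyLE hE)
  have hI : 0 ≤ ∫ y in E, |realPart f y - v| ∂(μ 0) := integral_nonneg fun y => abs_nonneg _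
  rw [h1, abs_mul, abs_inv, abs_of_pos hpos]
  calc _ ≤ (C₂ * lam * side k ^ d)⁻¹ *
        (B * side k ^ (d - n) * ∫ y in E, |realPart f y - v| ∂(μ 0)) := by gcongr
    _ = _ := by
      have e3 : side k ^ d = side k ^ (d - n) * side k ^ (n : ℝ) := by
        rw [← Real.rpow_add (side_pos k)]; ring_nf
      rw [e3]
      field_simp

/-- Almost everywhere on `S` the approximating sequence converges to `f`. -/
theorem ae_tendsto_approxSeq_of_mem (hψ : IsProfile ψ) (hμ : IsFrostman S d C₁ C₂ C₃ μ)
    (hS : S ⊆ dyadicCube 0 0) (hSm : MeasurableSet S) (hd : 0 ≤ d) (hdn : d ≤ n) (hC₂ : 0 < C₂)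
    (hC₃ : 0 < C₃) (hlam : 0 < lam) (hlam1 : lam < 1) (hf : ∀ k, Integrable (realPart f) (μ k)) :
    ∀ᵐ x : Fin n → ℝ, x ∈ S →
      Tendsto (fun k => approxSeq ψ μ d lam f k x) atTop (𝓝 (realPart f x)) := by
  have hfin := hμ.isFiniteMeasure hS 0
  obtain ⟨B, hB, hBμ⟩ := hμ.exists_le_smul_pow hC₃
  have hleb := (volume_restrict_absolutelyContinuous hμ hS hSm hd hdn hC₂ hC₃ hlam hlam1).ae_le
    ((Besicovitch.vitaliFamily (μ 0)).ae_tendsto_average_norm_sub (hf 0).locallyIntegrable)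
  have hleb' := (ae_restrict_iff' hSm).1 hleb
  filter_upwards [ae_eventually_mem_keystone hSm hd hdn hlam hlam1,
    Besicovitch.ae_tendsto_rnDeriv (μ 0) (volume : Measure (Fin n → ℝ)),
    Measure.rnDeriv_lt_top (μ 0) volume, hleb'] with x h1 h2 h3 h4 hxS
  set I : ℕ → ℝ := fun k =>
    ⨍ y in Metric.closedBall x (3 * side k), ‖realPart f y - realPart f x‖ ∂(μ 0) with hI
  have hI0 : Tendsto I atTop (𝓝 0) :=
    ((h4 hxS).comp (Besicovitch.tendsto_filterAt (μ 0) x)).comp (tendsto_side_mul (by norm_num))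
  have hρ := (ENNReal.tendsto_toReal h3.ne).comp
    (h2.comp (tendsto_side_mul (r := 3) (by norm_num)))
  set ε : ℕ → ℝ := fun k => B / (C₂ * lam) * (side k ^ (n : ℝ))⁻¹ *
    ∫ y in Metric.closedBall x (3 * side k), |realPart f y - realPart f x| ∂(μ 0) with hε
  -- The error is a constant times the ratio `μ 0` to volume of the ball times the mean oscillation
  -- of `f`. The ratio tends to a finite density and the oscillation to zero.
  have hεI : ∀ k, ε k = B / (C₂ * lam) * 6 ^ n * ((μ 0 (Metric.closedBall x (3 * side k)) /
      volume (Metric.closedBall x (3 * side k))).toReal * I k) := fun k => by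
    have hsn : 0 < side k ^ (n : ℝ) := Real.rpow_pos_of_pos (side_pos k) _
    have h6 : (2 * 3 : ℝ) ^ n = 6 ^ n := by norm_num
    have e := measure_smul_setAverage (μ := μ 0) (fun y => ‖realPart f y - realPart f x‖)
      (measure_ne_top (μ 0) (Metric.closedBall x (3 * side k)))
    rw [smul_eq_mul] at e
    rw [ENNReal.toReal_div, volume_closedBall_side (by norm_num), h6,
      ENNReal.toReal_ofReal (by positivity)]
    simp only [hε, hI]
    change _ = B / (C₂ * lam) * 6 ^ n * ((μ 0).real _ / _ * _)
    simp_rw [← Real.norm_eq_abs]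
    rw [← e]
    field_simp
  have hε0 : Tendsto ε atTop (𝓝 0) := by
    have := (hρ.mul hI0).const_mul (B / (C₂ * lam) * 6 ^ n)
    rw [mul_zero, mul_zero] at this
    refine this.congr fun k => (hεI k).symm
  rw [tendsto_iff_dist_tendsto_zero]
  refine squeeze_zero' (Eventually.of_forall fun k => dist_nonneg) ?_ hε0
  filter_upwards [h1 hxS, eventually_ge_atTop 1] with k hk hk1
  rw [Real.dist_eq]
  obtain ⟨k, rfl⟩ : ∃ k', k = k' + 1 := ⟨k - 1, by omega⟩
  rw [approxSeq_succ hlam hS]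
  -- The cube containing `x` is a keystone cube, so all cubes near `x` are active and the previous
  -- function plays no role.
  refine abs_blend_sub_le_of_full hψ (fun m hm => ?_) fun m hm hn => ?_
  · rw [Set.Finite.mem_toFinset]
    exact mem_levelTilde_iff.2 ⟨_, hk, abs_cubeIndex_sub_le hm⟩
  · refine abs_coeff_sub_le
      (keystoneNeighbors_nonempty ((Set.Finite.mem_toFinset _).1 hm)) fun m' hm' => ?_
    obtain ⟨h5, h6⟩ := mem_keystoneNeighbors_iff.1 hm'
    exact abs_cubeAvg_sub_const_le hμ hS hC₂ hlam hf hB (hBμ _ hk1) h6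
      (fun y hy => Metric.mem_closedBall.2 (dist_le_of_near hn h5 hy)) _

theorem measurable_absVal (hSm : MeasurableSet S) (hf : Measurable f) : Measurable (absVal f) := by
  classical
  have h : Measurable EReal.abs := EReal.measurable_of_measurable_real (by
    simp_rw [EReal.abs_def]
    fun_prop)
  unfold absVal
  exact Measurable.dite (s := S) (h.comp hf) measurable_const hSm

/-- The finite norm makes `f` finite `μ 0`-almost everywhere, and absolute continuity transfers this
to Lebesgue measure on `S`; passing to real values therefore loses nothing. -/
theorem ae_tendsto_approxSeq (hψ : IsProfile ψ) (hμ : IsFrostman S d C₁ C₂ C₃ μ)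
    (hS : S ⊆ dyadicCube 0 0) (hSc : IsClosed S) (hd : 0 ≤ d) (hdn : d ≤ n) (hC₂ : 0 < C₂)
    (hC₃ : 0 < C₃) (hlam : 0 < lam) (hlam1 : lam < 1) (hf : ∀ k, Integrable (realPart f) (μ k))
    (hfm : Measurable f) {p : ℝ≥0∞} (hp : p ≠ 0) (hp' : p ≠ ⊤)
    (hfp : eLpNorm (absVal f) p (μ 0) < ⊤) :
    ∀ᵐ x : Fin n → ℝ, extOp ψ μ d lam f x = ((extOp ψ μ d lam f x).toReal : EReal) ∧
      Tendsto (fun k => approxSeq ψ μ d lam f k x) atTop (𝓝 (extOp ψ μ d lam f x).toReal) := by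
  have hpos : 0 < p.toReal := ENNReal.toReal_pos hp hp'
  have h1 : ∀ᵐ x ∂(μ 0), absVal f x < ⊤ := by
    have h2 := lintegral_rpow_enorm_lt_top_of_eLpNorm_lt_top hp hp' hfp
    simp only [enorm_eq_self] at h2
    filter_upwards [ae_lt_top ((measurable_absVal hSc.measurableSet hfm).pow_const _) h2.ne]
      with x hx
    exact (ENNReal.rpow_lt_top_iff_of_pos hpos).1 hx
  have h2 := (ae_restrict_iff' hSc.measurableSet).1 ((volume_restrict_absolutelyContinuous hμ hS
    hSc.measurableSet hd hdn hC₂ hC₃ hlam hlam1).ae_le h1)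
  filter_upwards [h2, ae_tendsto_approxSeq_of_mem hψ hμ hS hSc.measurableSet hd hdn hC₂ hC₃ hlam
    hlam1 hf] with x h3 h4
  by_cases hx : x ∈ S
  · have e : extOp ψ μ d lam f x = f ⟨x, hx⟩ := by rw [extOp, dif_pos hx]
    have e2 : realPart f x = (f ⟨x, hx⟩).toReal := by rw [realPart, dif_pos hx]
    have h5 := h3 hx
    rw [absVal, dif_pos hx] at h5
    rw [e, ← e2]
    refine ⟨?_, h4 hx⟩
    rw [e2, EReal.coe_toReal]
    · rintro h; simp [h] at h5
    · rintro h; simp [h] at h5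
  · have e : extOp ψ μ d lam f x =
        ((limUnder atTop fun k => approxSeq ψ μ d lam f k x : ℝ) : EReal) := by
      rw [extOp, dif_neg hx]
    rw [e, EReal.toReal_coe]
    exact ⟨rfl, tendsto_approxSeq_of_notMem hψ hlam hS hSc hx⟩

end AEConvergence

/-! ### Measurability and norm of the dominating function. -/

section Domination

variable {n : ℕ} {S : Set (Fin n → ℝ)} {d lam c C₁ C₂ C₃ : ℝ} {μ : ℕ → Measure (Fin n → ℝ)}
  {f : S → EReal}

/-- Hölder's inequality on a unit cube whose mass lies between `C₂ * lam` and `C₁`. -/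
theorem abs_cubeAvg_zero_le (hμ : IsFrostman S d C₁ C₂ C₃ μ) (hS : S ⊆ dyadicCube 0 0)
    (hC₁ : 0 < C₁) (hC₂ : 0 < C₂) (hlam : 0 < lam) {p : ℝ≥0∞} (hp : 1 ≤ p)
    (hSm : MeasurableSet S) (hfm : Measurable f) (hfp : eLpNorm (absVal f) p (μ 0) < ⊤)
    {m : Fin n → ℤ} (hm : (0, m) ∈ keystone S d lam) :
    |cubeAvg μ f 0 m| ≤ (C₂ * lam)⁻¹ * C₁ ^ (1 - 1 / p.toReal) *
      (eLpNorm (absVal f) p (μ 0)).toReal := by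
  have hfin := hμ.isFiniteMeasure hS 0
  set Q := dyadicCube ((0 : ℕ) : ℤ) m
  have hs : side ((0 : ℕ) : ℤ) = 1 := by simp [side]
  have hexp : 0 ≤ 1 - 1 / p.toReal := by
    rcases eq_or_ne p ⊤ with rfl | hp'
    · simp
    · have h1 : 1 ≤ p.toReal := by
        rw [← ENNReal.toReal_one]; exact ENNReal.toReal_mono hp' hp
      rw [sub_nonneg, div_le_one (by linarith)]
      exact h1
  have hQle : μ 0 Q ≤ ENNReal.ofReal C₁ := by
    have := hμ.measure_dyadicCube_le 0 m
    rwa [hs, Real.one_rpow, mul_one] at this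
  have hQge : C₂ * lam ≤ (μ 0).real Q := by
    have := hμ.le_measure_of_mem_keystone hC₂ hm
    rw [hs, Real.one_rpow, mul_one] at this
    exact (ENNReal.ofReal_le_iff_le_toReal (measure_ne_top _ _)).1 this
  have hpos : 0 < (μ 0).real Q := lt_of_lt_of_le (by positivity) hQge
  have h1 : ∫ y in Q, ‖realPart f y‖ ∂(μ 0) ≤
      C₁ ^ (1 - 1 / p.toReal) * (eLpNorm (absVal f) p (μ 0)).toReal := by
    have hm1 := (measurable_realPart hSm hfm).aestronglyMeasurable (μ := (μ 0).restrict Q)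
    have h2 : ∫⁻ y in Q, ‖realPart f y‖ₑ ∂(μ 0) ≤
        ENNReal.ofReal (C₁ ^ (1 - 1 / p.toReal)) * eLpNorm (absVal f) p (μ 0) := by
      rw [← eLpNorm_one_eq_lintegral_enorm]
      refine (eLpNorm_le_eLpNorm_mul_rpow_measure_univ hp hm1).trans ?_
      rw [mul_comm, Measure.restrict_apply_univ, ENNReal.toReal_one, div_one,
        ← ENNReal.ofReal_rpow_of_pos hC₁]
      gcongr
      refine (eLpNorm_mono_measure _ Measure.restrict_le_self).trans ?_
      exact eLpNorm_mono_enorm fun x => by simpa using enorm_realPart_le x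
    rw [integral_norm_eq_lintegral_enorm hm1]
    refine (ENNReal.toReal_mono (ENNReal.mul_ne_top ENNReal.ofReal_ne_top hfp.ne) h2).trans ?_
    rw [ENNReal.toReal_mul, ENNReal.toReal_ofReal (by positivity)]
  rw [cubeAvg, setAverage_eq, smul_eq_mul, abs_mul, abs_inv, abs_of_pos hpos, mul_assoc]
  refine mul_le_mul (inv_anti₀ (by positivity) hQge) ?_ (abs_nonneg _) (by positivity)
  exact (norm_integral_le_integral_norm _).trans h1

theorem measurableSet_dilatedCube (c : ℝ) (k : ℤ) (m : Fin n → ℤ) :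
    MeasurableSet (dilatedCube c k m) := by
  have : dilatedCube c k m = Set.Icc (fun i => ((m i : ℝ) + 1 / 2) * side k - c * side k / 2)
      (fun i => ((m i : ℝ) + 1 / 2) * side k + c * side k / 2) := by
    ext x
    simp only [dilatedCube, cube, Set.mem_ofPred_eq, Set.mem_Icc, Pi.le_def, forall_and]
  rw [this]
  exact measurableSet_Icc

/-- A countable supremum of constant multiples of indicators of cubes. -/
theorem measurable_calderonMax : Measurable (calderonMax μ d lam c f) := by
  unfold calderonMax
  refine Measurable.iSup fun a => Measurable.iSup fun b => ?_
  have : (fun x => ⨆ (_ : x ∈ dilatedCube c a.1 a.2) (_ : a ∈ keystone S d lam)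
      (_ : b ∈ keystone S d lam) (_ : IsCovering S d lam c a b), phi μ f a b) =
      (dilatedCube c a.1 a.2).indicator (fun _ => ⨆ (_ : a ∈ keystone S d lam)
        (_ : b ∈ keystone S d lam) (_ : IsCovering S d lam c a b), phi μ f a b) := by
    ext x
    by_cases hx : x ∈ dilatedCube c a.1 a.2 <;> simp [hx]
  rw [this]
  exact measurable_const.indicator (measurableSet_dilatedCube _ _ _)

theorem enorm_toReal_calderonMax_le (x : Fin n → ℝ) :
    ‖(calderonMax μ d lam c f x).toReal‖ₑ ≤ calderonMax μ d lam c f x := by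
  rw [Real.enorm_of_nonneg ENNReal.toReal_nonneg]
  exact ENNReal.ofReal_toReal_le

theorem eLpNorm_dominating_le {p : ℝ≥0∞} (hp : 1 ≤ p) (hp' : p ≠ ⊤) {L M : ℝ} (hL : 0 ≤ L)
    (hM : 0 ≤ M) :
    eLpNorm (fun x => L * ((calderonMax μ d lam c f x).toReal +
      (Set.Icc (fun _ => -3) (fun _ => 4)).indicator (fun _ => M) x)) p volume ≤
    ENNReal.ofReal L * (eLpNorm (calderonMax μ d lam c f) p volume +
      ENNReal.ofReal (M * (7 ^ n) ^ (1 / p.toReal))) := by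
  have hp0 : p ≠ 0 := (zero_lt_one.trans_le hp).ne'
  have hm := (measurable_calderonMax (μ := μ) (d := d) (lam := lam) (c := c)
    (f := f)).ennreal_toReal.aestronglyMeasurable (μ := volume)
  refine (eLpNorm_const_smul_le (c := L) (f := fun x => (calderonMax μ d lam c f x).toReal +
      (Set.Icc (fun _ => -3) (fun _ => 4)).indicator (fun _ => M) x)).trans ?_
  rw [Real.enorm_of_nonneg hL]
  gcongr
  refine (eLpNorm_add_le hm (aestronglyMeasurable_const.indicator measurableSet_Icc) hp).trans ?_
  gcongr
  · exact eLpNorm_mono_enorm fun x => by simpa using enorm_toReal_calderonMax_le x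
  · rw [eLpNorm_indicator_const measurableSet_Icc hp0 hp', Real.enorm_of_nonneg hM,
      Real.volume_Icc_pi, Finset.prod_const, Finset.card_univ, Fintype.card_fin,
      ENNReal.ofReal_mul hM, ← ENNReal.ofReal_rpow_of_pos (by positivity),
      ENNReal.ofReal_pow (by norm_num)]
    norm_num

end Domination

end SobolevExt

/-! ### Assembly of the theorem. -/

theorem theorem6p5 (n : ℕ) (d lam c : ℝ) (hd : 0 < d) (hlam : 0 < lam) (hc : 7 ≤ c)
    (p : ℝ≥0∞) [Fact (1 ≤ p)] (hp : 1 < p) (hp' : p ≠ ⊤)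
    (C₁ C₂ C₃ : ℝ) (hC₁ : 0 < C₁) (hC₂ : 0 < C₂) (hC₃ : 0 < C₃)
    (ψ : ℝ → ℝ) (hψ : IsProfile ψ) :
    ∃ C : ℝ, 0 < C ∧
      ∀ (ds : ℝ), d ≤ ds → ds ≤ n →
      ∀ (S : Set (Fin n → ℝ)), IsCompact S → S ⊆ dyadicCube 0 0 →
        ENNReal.ofReal lam < content ds S →
      ∀ (μ : ℕ → Measure (Fin n → ℝ)), IsFrostman S d C₁ C₂ C₃ μ →
      ∀ (f : S → EReal), Measurable f → traceNorm μ d lam c p f < ⊤ →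
        ∃ F : W1 n p,
          (∀ᵐ x, extOp ψ μ d lam f x = ((W1.fn F x : ℝ) : EReal)) ∧
          (∃ kl : ℕ → ℕ, StrictMono kl ∧ ∃ G : ℕ → W1 n p,
            (∀ l, W1.fn (G l) =ᵐ[volume] approxSeq ψ μ d lam f (kl l)) ∧
            ∀ Λ : W1 n p →L[ℝ] ℝ, Tendsto (fun l => Λ (G l)) atTop (𝓝 (Λ F))) ∧
          ENNReal.ofReal ‖F‖ ≤ ENNReal.ofReal C * traceNorm μ d lam c p f := by
  obtain ⟨K, hK, hb⟩ := exists_norm_fderiv_bump_le n hψ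
  have hp0 : p ≠ 0 := (zero_lt_one.trans hp).ne'
  -- `L` absorbs the factors of the value and gradient bounds, `L₁` is the Hölder constant on unit
  -- cubes, and `V` is the `L_p` norm of the indicator of `[-3, 4]^n`.
  set L : ℝ := 3 + 2 ^ n * (K * 12) with hL_def
  set L₁ : ℝ := (C₂ * lam)⁻¹ * C₁ ^ (1 - 1 / p.toReal) with hL₁_def
  set V : ℝ := (7 ^ n) ^ (1 / p.toReal) with hV_def
  have hL : 0 < L := by positivity
  have hL₁ : 0 < L₁ := by positivity
  have hV : 0 < V := by positivity
  refine ⟨(n + 1) * (L * (1 + L₁ * V)), by positivity, ?_⟩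
  intro ds hds hdsn S hSc hS hcont μ hμ f hfm hN
  have hdn : d ≤ n := hds.trans hdsn
  -- The density argument needs `lam < 1`; it follows because a subset of the unit cube has content
  -- at most one.
  have hlam1 : lam < 1 := by
    have := hcont.trans_le (content_le_one ds hS)
    rwa [← ENNReal.ofReal_one, ENNReal.ofReal_lt_ofReal_iff one_pos] at this
  have h0 := zero_mem_keystone hd hds hS hcont
  have hSm := hSc.isClosed.measurableSet
  obtain ⟨hfp, hAp⟩ := ENNReal.add_lt_top.1 hN
  have hf : ∀ k, Integrable (realPart f) (μ k) :=
    integrable_realPart hμ hS hp.le (memLp_realPart hSm hfm hfp)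
  set M : ℝ := L₁ * (eLpNorm (absVal f) p (μ 0)).toReal with hM_def
  have hM0 : 0 ≤ M := by positivity
  have hM : ∀ m, (0, m) ∈ keystone S d lam → |cubeAvg μ f 0 m| ≤ M := fun m hm =>
    abs_cubeAvg_zero_le hμ hS hC₁ hC₂ hlam hp.le hSm hfm hfp hm
  set G : (Fin n → ℝ) → ℝ := fun x => L * ((calderonMax μ d lam c f x).toReal +
    (Set.Icc (fun _ => -3) (fun _ => 4)).indicator (fun _ => M) x) with hG_def
  have hGle := eLpNorm_dominating_le (μ := μ) (d := d) (lam := lam) (c := c) (f := f) hp.le hp'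
    hL.le hM0
  have hGp : MemLp G p volume := by
    refine ⟨?_, hGle.trans_lt (ENNReal.mul_lt_top ENNReal.ofReal_lt_top
      (ENNReal.add_lt_top.2 ⟨hAp, ENNReal.ofReal_lt_top⟩))⟩
    exact ((measurable_calderonMax.ennreal_toReal.add (measurable_const.indicator
      measurableSet_Icc)).const_mul L).aestronglyMeasurable
  have hAfin : ∀ᵐ x, calderonMax μ d lam c f x ≠ ⊤ := by
    have h2 := lintegral_rpow_enorm_lt_top_of_eLpNorm_lt_top hp0 hp' hAp
    simp only [enorm_eq_self] at h2
    filter_upwards [ae_lt_top (measurable_calderonMax.pow_const _) h2.ne] with x hx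
    exact ((ENNReal.rpow_lt_top_iff_of_pos (ENNReal.toReal_pos hp0 hp')).1 hx).ne
  have hbounds : ∀ k, ∀ᵐ x, |approxSeq ψ μ d lam f k x| ≤ G x ∧
      ‖fderiv ℝ (approxSeq ψ μ d lam f k) x‖ ≤ G x := fun k => by
    filter_upwards [hAfin] with x hx
    obtain ⟨h1, h2⟩ := approxSeq_bounds hψ hμ hS hC₂ hlam hc hf h0 hx hM hK.le hb k
    set a := (calderonMax μ d lam c f x).toReal
    have ha : 0 ≤ a := ENNReal.toReal_nonneg
    have hI : 0 ≤ (Set.Icc (fun _ : Fin n => (-3 : ℝ)) (fun _ => 4)).indicator (fun _ => M) x :=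
      Set.indicator_nonneg (fun _ _ => hM0) x
    have hKn : 0 < (2 : ℝ) ^ n * K := by positivity
    simp only [hG_def, hL_def]
    constructor
    · nlinarith [mul_nonneg hKn.le ha, mul_nonneg hKn.le hI]
    · nlinarith [mul_nonneg hKn.le ha, mul_nonneg hKn.le hI]
  have hae := ae_tendsto_approxSeq hψ hμ hS hSc.isClosed hd.le hdn hC₂ hC₃ hlam hlam1 hf hfm hp0
    hp' hfp
  obtain ⟨F, hF, ⟨W, hW, hΛ⟩, hnorm⟩ := exists_weak_limit hp'
    (fun k => contDiff_approxSeq hψ hlam hS k) (fun k => hasCompactSupport_approxSeq hψ hlam hS k)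
    hGp (fun k => (hbounds k).mono fun x hx => hx.1) (fun k => (hbounds k).mono fun x hx => hx.2)
    (hae.mono fun x hx => hx.2)
  -- The whole sequence converges weakly, so the identity serves as the subsequence.
  refine ⟨F, ?_, ⟨id, strictMono_id, W, hW, hΛ⟩, hnorm.trans ?_⟩
  · filter_upwards [hae, hF] with x h1 h2
    rw [h2]
    exact h1.1
  · have e1 : ENNReal.ofReal (M * V) =
        ENNReal.ofReal (L₁ * V) * eLpNorm (absVal f) p (μ 0) := by
      rw [hM_def, mul_right_comm, ENNReal.ofReal_mul (by positivity), ENNReal.ofReal_toReal hfp.ne]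
    calc _ ≤ ((n : ℝ≥0∞) + 1) * (ENNReal.ofReal L * (eLpNorm (calderonMax μ d lam c f) p volume +
          ENNReal.ofReal (M * V))) := by gcongr
      _ ≤ ((n : ℝ≥0∞) + 1) * (ENNReal.ofReal L * (ENNReal.ofReal (1 + L₁ * V) *
          traceNorm μ d lam c p f)) := by
        gcongr
        rw [e1, ENNReal.ofReal_add zero_le_one (by positivity), ENNReal.ofReal_one, add_mul,
          one_mul]
        exact add_le_add le_add_self (mul_le_mul_right le_self_add _)
      _ = _ := by
        rw [ENNReal.ofReal_mul (by positivity), ENNReal.ofReal_mul hL.le,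
          ENNReal.ofReal_add (by positivity) zero_le_one, ENNReal.ofReal_natCast,
          ENNReal.ofReal_one]
        ring
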